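/- Let $k\ge 0$ be an integer and $t\in\mathbb C$. Let $\mathcal P_k(t)$ be the partition algebra over $\mathbb C$: its basis is the set of set partitions ("diagrams") of $\{1,\dots,k\}\cup\{1',\dots,k'\}$ (top and bottom points), and the product of diagrams $d,e$ is $t^N$ times the diagram obtained by stacking $d$ on top of $e$ and forgetting the middle points, where $N$ is the number of components contained in the middle row. Identify $\sigma\in\mathfrak S_k$ with the diagram with blocks $\{\sigma(j),j'\}$, put $e_k=\frac1{k!}\sum_{\sigma\in\mathfrak S_k}\sigma$, and let $\mathcal{SP}_k(t)=e_k\mathcal P_k(t)e_k$ be the spherical partition algebra, with unit $e_k$. Let $\Lambda^k$ be the set of all partitions of the integers $0,1,\dots,k$, ordered by dominance among partitions of the same integer, and by $\lambda\lhd\mu$ whenever $|\lambda|>|\mu|$. *Cellular algebras.* A cell datum for a $\mathbb C$-algebra $A$ on a poset $\Lambda$ consists of finite (possibly empty) sets $T(\lambda)$, $\lambda\in\Lambda$, and a basis $\{C_{st}\mid \lambda\in\Lambda,\ s,t\in T(\lambda)\}$ of $A$ such that the linear map $C_{st}\mapsto C_{ts}$ is an algebra anti-automorphism, and such that for all $\lambda$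 and $a\in A$ there are scalars $r_{asu}$ with $aC_{st}\equiv\sum_{u\in T(\lambda)}r_{asu}C_{ut}$ modulo $\mathrm{span}\{C_{vw}\mid v,w\in T(\mu),\ \mu>\lambda\}$ for all $s,t\in T(\lambda)$. Its cell module at $\lambda$ is the $A$-module with basis $\{C_s\mid s\in T(\lambda)\}$ and action $aC_s=\sum_u r_{asu}C_u$. *The modules $\Delta_k(\lambda)$.* Let $\lambda\in\Lambda^k$ and $l=|\lambda|$. Let $\mathfrak t^\lambda$ be the row reading tableau of shape $\lambda$, $\mathfrak S_\lambda\le\mathfrak S_l$ its row stabilizer and, for tableaux $\mathfrak s,\mathfrak t$ of shape $\lambda$, let $x_{\mathfrak s\mathfrak t}=\sum_{w\in\mathfrak S_\lambda}d(\mathfrak s)\,w\,d(\mathfrak t)^{-1}\in\mathbb C\mathfrak S_l$, where $d(\mathfrak s)\mathfrak t^\lambda=\mathfrak s$. A half diagram $(c,S)$ is a set partition $c$ of $\{1,\dots,k\}$ with a set $S$ of $l$ distinguished blocks, numbered by increasing minimal elements. For half diagrams $(c,S)$, $(d,T)$ and $w\in\mathfrak S_l$ let $g((c,S)\otimes w\otimes(d,T))$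 be the diagram with the blocks of $c$ on top and those of $d$ at the bottom, in which the $j$-th block of $T$ is joined to the $w(j)$-th block of $S$ for each $j$, and no other blocks are joined; extend $g$ linearly in $w$. For $\mathfrak c=(\mathfrak s,c,S)$ and $\mathfrak d=(\mathfrak t,d,T)$ with $\mathfrak s,\mathfrak t$ standard of shape $\lambda$, put $C_{\mathfrak c\mathfrak d}=g((c,S)\otimes x_{\mathfrak s\mathfrak t}\otimes(d,T))$. Let $\mathcal P_k^{\rhd\lambda}(t)$ be the left ideal of $\mathcal P_k(t)$ generated by all $C_{\mathfrak c\mathfrak d}$ belonging to partitions $\mu\rhd\lambda$, and let $\Delta_k(\lambda)\subseteq\mathcal P_k(t)/\mathcal P_k^{\rhd\lambda}(t)$ be the submodule generated by the classes of all $C_{\mathfrak c\mathfrak d_\lambda}$ with $\mathfrak c$ belonging to $\lambda$, where $\mathfrak d_\lambda$ is given by $\mathfrak t^\lambda$, the set partition with blocks $\{1\},\dots,\{l\},\{l+1,\dots,k\}$ (the last one omitted if $l=k$), and the distinguished blocks $\{1\},\dots,\{l\}$. **Theorem.** The algebra $\mathcal{SP}_k(t)$ has a cell datum on the poset $\Lambda^k$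 such that, for every $\lambda\in\Lambda^k$, the cell module at $\lambda$ is isomorphic, as an $\mathcal{SP}_k(t)$-module, to the truncation $e_k\Delta_k(\lambda)=\{e_kv\mid v\in\Delta_k(\lambda)\}$. -/

import Mathlib

/-! ## Composition of set partitions -/

namespace SphericalPartition

/-- The number of blocks of the set partition `r` of `X` that do not meet the image of `i`. -/
noncomputable def missing {X Y : Type} (r : Setoid X) (i : Y → X) : ℕ :=
  Nat.card {q : Quotient r // ∀ y, (Quotient.mk r (i y)) ≠ q}

theorem missing_comp {X Y Z : Type} [Finite X] [Finite Y] (r : Setoid X) (i : Y → X) (j : Z → Y) :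
    missing r (i ∘ j) = missing r i + missing (r.comap i) j := by
  unfold missing
  rw [← Nat.card_sum]
  symm
  let ι : Quotient (r.comap i) → Quotient r := Quotient.map' (s₁ := r.comap i) (s₂ := r) i (fun _ _ h => h)
  have hι : ∀ p q, ι p = ι q → p = q := by
    intro p q
    induction p using Quotient.inductionOn
    induction q using Quotient.inductionOn
    intro h
    exact Quotient.sound (s := r.comap i) (Quotient.exact (s := r) h)
  refine Nat.card_congr (Equiv.ofBijective (Sum.elim
    (fun q => ⟨q.1, fun z => q.2 (j z)⟩)
    (fun p => ⟨ι p.1, fun z h => p.2 z (hι _ _ h)⟩)) ⟨?_, ?_⟩)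
  · rintro (⟨a, ha⟩ | ⟨a, ha⟩) (⟨b, hb⟩ | ⟨b, hb⟩) h
    · simpa using h
    · exfalso
      simp only [Sum.elim_inl, Sum.elim_inr, Subtype.mk.injEq] at h
      induction b using Quotient.inductionOn with
      | h y => exact ha y h.symm
    · exfalso
      simp only [Sum.elim_inl, Sum.elim_inr, Subtype.mk.injEq] at h
      induction a using Quotient.inductionOn with
      | h y => exact hb y h
    · simp only [Sum.elim_inr, Subtype.mk.injEq] at h
      simpa using hι _ _ h
  · rintro ⟨q, hq⟩
    by_cases h : ∃ y, Quotient.mk r (i y) = q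
    · obtain ⟨y, rfl⟩ := h
      exact ⟨Sum.inr ⟨Quotient.mk _ y, fun z hz => hq z (congrArg ι hz)⟩, rfl⟩
    · push Not at h
      exact ⟨Sum.inl ⟨q, h⟩, rfl⟩

theorem map_le_iff {X Y : Type} {r : Setoid X} {f : X → Y} {s : Setoid Y} :
    r.map f ≤ s ↔ r ≤ s.comap f := by
  constructor
  · intro h x y hxy
    exact h (Relation.EqvGen.rel _ _ ⟨x, y, hxy, rfl, rfl⟩)
  · intro h
    refine Setoid.eqvGen_le ?_
    rintro _ _ ⟨x, y, hxy, rfl, rfl⟩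
    exact h hxy

theorem map_sup' {X Y : Type} (r s : Setoid X) (f : X → Y) :
    (r ⊔ s).map f = r.map f ⊔ s.map f :=
  GaloisConnection.l_sup (u := fun t : Setoid Y => t.comap f) (fun _ _ => map_le_iff)

theorem map_map' {X Y Z : Type} (r : Setoid X) (f : X → Y) (g : Y → Z) :
    (r.map f).map g = r.map (g ∘ f) := by
  apply eq_of_forall_ge_iff
  intro c
  rw [map_le_iff, map_le_iff, map_le_iff]
  rfl

/-- Gluing a set partition `s` of `X` with a set partition `t` of `Y` along a common part `Z`:
restricting to `Y` amounts to gluing `t` with the restriction of `s` to `Z`, and the blocks of the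
result that do not meet `Y` are the blocks of `s` that do not meet `Z`. -/
theorem glue_aux {X Y Z W : Type} (s : Setoid X) (t : Setoid Y) (i : Z → X) (j : Z → Y)
    (u : X → W) (v : Y → W) (hu : Function.Injective u) (hv : Function.Injective v)
    (huv : ∀ z, u (i z) = v (j z)) (hcov : ∀ w, (∃ y, v y = w) ∨ ∃ x, u x = w)
    (hint : ∀ x y, u x = v y → ∃ z, x = i z ∧ y = j z) :
    (s.map u ⊔ t.map v).comap v = (s.comap i).map j ⊔ t ∧
      missing (s.map u ⊔ t.map v) v = missing s i := by
  classical
  set J := s.map u ⊔ t.map v with hJ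
  set T := (s.comap i).map j ⊔ t with hT
  have hsJ : s ≤ J.comap u := map_le_iff.1 le_sup_left
  have htJ : t ≤ J.comap v := map_le_iff.1 le_sup_right
  have hTJ : T ≤ J.comap v := by
    refine sup_le (map_le_iff.2 ?_) htJ
    intro z z' h
    have := hsJ h
    change J (v (j z)) (v (j z'))
    rw [← huv, ← huv]
    exact this
  have hsT : s.comap i ≤ T.comap j := map_le_iff.1 le_sup_left
  let ψ : W → Quotient T ⊕ Quotient s := fun w =>
    if h : ∃ y, v y = w then Sum.inl (Quotient.mk T h.choose)
    else if h' : ∃ x, u x = w ∧ ∃ z, s x (i z) then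
      Sum.inl (Quotient.mk T (j h'.choose_spec.2.choose))
    else if h'' : ∃ x, u x = w then Sum.inr (Quotient.mk s h''.choose)
    else Sum.inl (Quotient.mk T ((hcov w).resolve_right h'').choose)
  have ψv : ∀ y, ψ (v y) = Sum.inl (Quotient.mk T y) := by
    intro y
    have h : ∃ y', v y' = v y := ⟨y, rfl⟩
    simp only [ψ, dif_pos h]
    rw [hv h.choose_spec]
  have ψu : ∀ x z, s x (i z) → ψ (u x) = Sum.inl (Quotient.mk T (j z)) := by
    intro x z hxz
    by_cases h : ∃ y, v y = u x
    · obtain ⟨y, hy⟩ := h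
      rw [← hy, ψv]
      obtain ⟨z', rfl, rfl⟩ := hint x y hy.symm
      exact congrArg Sum.inl (Quotient.sound (s := T) (hsT hxz))
    · have h' : ∃ x', u x' = u x ∧ ∃ z, s x' (i z) := ⟨x, rfl, z, hxz⟩
      simp only [ψ, dif_neg h, dif_pos h']
      refine congrArg Sum.inl (Quotient.sound (s := T) ?_)
      have h1 := h'.choose_spec.2.choose_spec
      have h0 : s h'.choose x := by
        rw [hu h'.choose_spec.1]
      exact hsT (s.trans' (s.symm' h1) (s.trans' h0 hxz))
  have ψu' : ∀ x, (∀ z, ¬ s x (i z)) → ψ (u x) = Sum.inr (Quotient.mk s x) := by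
    intro x hx
    have h : ¬ ∃ y, v y = u x := by
      rintro ⟨y, hy⟩
      obtain ⟨z, rfl, -⟩ := hint x y hy.symm
      exact hx z (s.refl' _)
    have h' : ¬ ∃ x', u x' = u x ∧ ∃ z, s x' (i z) := by
      rintro ⟨x', h1, z, hz⟩
      rw [hu h1] at hz
      exact hx z hz
    have h'' : ∃ x', u x' = u x := ⟨x, rfl⟩
    simp only [ψ, dif_neg h, dif_neg h', dif_pos h'']
    rw [hu h''.choose_spec]
  have hJψ : J ≤ Setoid.ker ψ := by
    refine sup_le (map_le_iff.2 ?_) (map_le_iff.2 ?_)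
    · intro x x' h
      change ψ (u x) = ψ (u x')
      by_cases hx : ∃ z, s x (i z)
      · obtain ⟨z, hz⟩ := hx
        rw [ψu x z hz, ψu x' z (s.trans' (s.symm' h) hz)]
      · push Not at hx
        rw [ψu' x hx, ψu' x' (fun z hz => hx z (s.trans' h hz))]
        exact congrArg Sum.inr (Quotient.sound (s := s) h)
    · intro y y' h
      change ψ (v y) = ψ (v y')
      rw [ψv, ψv]
      exact congrArg Sum.inl (Quotient.sound (s := T) ((le_sup_right : t ≤ T) h))
  refine ⟨le_antisymm ?_ hTJ, ?_⟩
  · intro y y' h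
    have := hJψ h
    rw [Setoid.ker_def, ψv, ψv, Sum.inl.injEq] at this
    exact Quotient.exact (s := T) this
  · unfold missing
    symm
    have hkey : ∀ x, (∀ z, ¬ s x (i z)) → ∀ y, ¬ J (v y) (u x) := by
      intro x hx y h
      have := hJψ h
      rw [Setoid.ker_def, ψv, ψu' x hx] at this
      cases this
    let m : Quotient s → Quotient J := Quotient.map' (s₁ := s) (s₂ := J) u (fun _ _ h => hsJ h)
    refine Nat.card_congr (Equiv.ofBijective (fun q => ⟨m q.1, ?_⟩) ⟨?_, ?_⟩)
    · obtain ⟨q, hq⟩ := q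
      induction q using Quotient.inductionOn with
      | h x =>
        intro y h
        exact hkey x (fun z hz => hq z (Quotient.sound (s := s) (s.symm' hz))) y
          (Quotient.exact (s := J) h)
    · rintro ⟨p, hp⟩ ⟨q, hq⟩ h
      induction p using Quotient.inductionOn with
      | h x =>
      induction q using Quotient.inductionOn with
      | h x' =>
      have h1 : J (u x) (u x') := Quotient.exact (s := J) (Subtype.ext_iff.1 h)
      have h2 := hJψ h1
      rw [Setoid.ker_def, ψu' x (fun z hz => hp z (Quotient.sound (s := s) (s.symm' hz))),
        ψu' x' (fun z hz => hq z (Quotient.sound (s := s) (s.symm' hz))), Sum.inr.injEq] at h2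
      exact Subtype.ext h2
    · rintro ⟨q, hq⟩
      induction q using Quotient.inductionOn with
      | h w =>
      obtain ⟨y, rfl⟩ | ⟨x, rfl⟩ := hcov w
      · exact absurd rfl (hq y)
      · refine ⟨⟨Quotient.mk s x, fun z hz => hq (j z) ?_⟩, rfl⟩
        refine Quotient.sound (s := J) ?_
        change J (v (j z)) (u x)
        rw [← huv]
        exact hsJ (Quotient.exact (s := s) hz)

/-- The concatenation of `d` (on top) with `e` (below), on the top, middle and bottom points:
the finest set partition that contains both. -/
def stack {α β γ : Type} (d : Setoid (α ⊕ β)) (e : Setoid (β ⊕ γ)) : Setoid (α ⊕ β ⊕ γ) :=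
  d.map (Sum.map id Sum.inl) ⊔ e.map Sum.inr

/-- The inclusion of the top and bottom points into the top, middle and bottom points. -/
def outer {α β γ : Type} : α ⊕ γ → α ⊕ β ⊕ γ := Sum.map id Sum.inr

/-- The set partition on top and bottom points obtained by concatenating `d` (on top) with `e`
(below) and then forgetting the middle points. -/
def comp {α β γ : Type} (d : Setoid (α ⊕ β)) (e : Setoid (β ⊕ γ)) : Setoid (α ⊕ γ) :=
  (stack d e).comap outer

/-- The number of internal components of the concatenation of `d` (on top) with `e` (below):
those blocks that meet neither the top nor the bottom points. -/
noncomputable def loops {α β γ : Type} (d : Setoid (α ⊕ β)) (e : Setoid (β ⊕ γ)) : ℕ :=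
  missing (stack d e) outer

theorem comp_assoc_aux {α β γ δ : Type} [Finite α] [Finite β] [Finite γ] [Finite δ]
    (d : Setoid (α ⊕ β)) (e : Setoid (β ⊕ γ)) (f : Setoid (γ ⊕ δ)) :
    comp (comp d e) f = comp d (comp e f) ∧
      loops d e + loops (comp d e) f = loops e f + loops d (comp e f) := by
  let u : α ⊕ β ⊕ γ → α ⊕ β ⊕ γ ⊕ δ := Sum.map id (Sum.map id Sum.inl)
  let v : α ⊕ γ ⊕ δ → α ⊕ β ⊕ γ ⊕ δ := Sum.map id Sum.inr
  let u' : β ⊕ γ ⊕ δ → α ⊕ β ⊕ γ ⊕ δ := Sum.inr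
  let v' : α ⊕ β ⊕ δ → α ⊕ β ⊕ γ ⊕ δ := Sum.map id (Sum.map id Sum.inr)
  let J : Setoid (α ⊕ β ⊕ γ ⊕ δ) :=
    d.map (Sum.map id Sum.inl) ⊔ e.map (Sum.inr ∘ Sum.map id Sum.inl) ⊔
      f.map (Sum.inr ∘ Sum.inr)
  have h1 : (stack d e).map u ⊔ (f.map (Sum.inr : γ ⊕ δ → α ⊕ γ ⊕ δ)).map v = J := by
    unfold stack
    rw [map_sup', map_map', map_map', map_map']
    have a1 : u ∘ Sum.map id Sum.inl = Sum.map id Sum.inl := by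
      funext x; rcases x with x | x <;> rfl
    have a2 : u ∘ Sum.inr = Sum.inr ∘ Sum.map id Sum.inl := by
      funext x; rcases x with x | x <;> rfl
    have a3 : v ∘ Sum.inr = Sum.inr ∘ Sum.inr := by
      funext x; rcases x with x | x <;> rfl
    rw [a1, a2, a3]
  have h2 : (stack e f).map u' ⊔ (d.map (Sum.map id Sum.inl : α ⊕ β → α ⊕ β ⊕ δ)).map v' = J := by
    unfold stack
    rw [map_sup', map_map', map_map', map_map']
    have a1 : v' ∘ Sum.map id Sum.inl = Sum.map id Sum.inl := by
      funext x; rcases x with x | x <;> rfl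
    have a2 : u' ∘ Sum.map id Sum.inl = Sum.inr ∘ Sum.map id Sum.inl := by
      funext x; rcases x with x | x <;> rfl
    rw [a1, a2, sup_comm, ← sup_assoc]
  obtain ⟨l1, l2⟩ := glue_aux (stack d e) (f.map (Sum.inr : γ ⊕ δ → α ⊕ γ ⊕ δ))
    outer (Sum.map id Sum.inl) u v
    (Sum.map_injective.2 ⟨Function.injective_id,
      Sum.map_injective.2 ⟨Function.injective_id, Sum.inl_injective⟩⟩)
    (Sum.map_injective.2 ⟨Function.injective_id, Sum.inr_injective⟩)
    (by rintro (x | x) <;> rfl)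
    (by
      rintro (x | x | x | x)
      · exact Or.inl ⟨Sum.inl x, rfl⟩
      · exact Or.inr ⟨Sum.inr (Sum.inl x), rfl⟩
      · exact Or.inl ⟨Sum.inr (Sum.inl x), rfl⟩
      · exact Or.inl ⟨Sum.inr (Sum.inr x), rfl⟩)
    (by
      rintro (x | x | x) (y | y | y) h <;> simp [u, v] at h <;> subst h
      · exact ⟨Sum.inl x, rfl, rfl⟩
      · exact ⟨Sum.inr x, rfl, rfl⟩)
  obtain ⟨r1, r2⟩ := glue_aux (stack e f) (d.map (Sum.map id Sum.inl : α ⊕ β → α ⊕ β ⊕ δ))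
    outer Sum.inr u' v'
    Sum.inr_injective
    (Sum.map_injective.2 ⟨Function.injective_id,
      Sum.map_injective.2 ⟨Function.injective_id, Sum.inr_injective⟩⟩)
    (by rintro (x | x) <;> rfl)
    (by
      rintro (x | x | x | x)
      · exact Or.inl ⟨Sum.inl x, rfl⟩
      · exact Or.inl ⟨Sum.inr (Sum.inl x), rfl⟩
      · exact Or.inr ⟨Sum.inr (Sum.inl x), rfl⟩
      · exact Or.inl ⟨Sum.inr (Sum.inr x), rfl⟩)
    (by
      rintro (x | x | x) (y | y | y) h <;> simp [u', v'] at h <;> subst h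
      · exact ⟨Sum.inl x, rfl, rfl⟩
      · exact ⟨Sum.inr x, rfl, rfl⟩)
  rw [h1] at l1 l2
  rw [h2] at r1 r2
  have e1 : J.comap v = stack (comp d e) f := l1
  have e2 : J.comap v' = stack d (comp e f) := by
    rw [r1, sup_comm]; rfl
  have hvv : v ∘ (outer : α ⊕ δ → _) = v' ∘ outer := by
    funext x; rcases x with x | x <;> rfl
  constructor
  · unfold comp at e1 e2 ⊢
    rw [← e1, ← e2]
    ext x y
    change J ((v ∘ outer) x) ((v ∘ outer) y) ↔ J ((v' ∘ outer) x) ((v' ∘ outer) y)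
    rw [hvv]
  · have m1 := missing_comp J v (outer : α ⊕ δ → _)
    have m2 := missing_comp J v' (outer : α ⊕ δ → _)
    rw [e1, l2] at m1
    rw [e2, r2] at m2
    unfold loops
    rw [← m1, ← m2, hvv]

theorem comp_assoc {α β γ δ : Type} [Finite α] [Finite β] [Finite γ] [Finite δ]
    (d : Setoid (α ⊕ β)) (e : Setoid (β ⊕ γ)) (f : Setoid (γ ⊕ δ)) :
    comp (comp d e) f = comp d (comp e f) := (comp_assoc_aux d e f).1

theorem loops_assoc {α β γ δ : Type} [Finite α] [Finite β] [Finite γ] [Finite δ]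
    (d : Setoid (α ⊕ β)) (e : Setoid (β ⊕ γ)) (f : Setoid (γ ⊕ δ)) :
    loops d e + loops (comp d e) f = loops e f + loops d (comp e f) := (comp_assoc_aux d e f).2

/-- The diagram of the bijection `σ`, whose blocks are the pairs of the top point `σ j` and the
bottom point `j`. -/
def permDiagram {α β : Type} (σ : β ≃ α) : Setoid (α ⊕ β) :=
  Setoid.ker (Sum.elim id σ)

theorem permDiagram_apply {α β : Type} (σ : β ≃ α) (x y : α ⊕ β) :
    permDiagram σ x y ↔ Sum.elim id σ x = Sum.elim id σ y := Iff.rfl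

theorem permDiagram_comp_aux {α β γ : Type} (σ : β ≃ α) (d : Setoid (β ⊕ γ)) :
    stack (permDiagram σ) d = d.comap (Sum.elim (Sum.inl ∘ σ.symm) id) := by
  apply le_antisymm
  · refine sup_le (map_le_iff.2 ?_) (map_le_iff.2 ?_)
    · rintro (x | x) (y | y) h <;> simp [permDiagram_apply] at h <;> subst h <;>
        simp [Setoid.comap_rel]
    · intro x y h
      exact h
  · have h1 : permDiagram σ ≤ (stack (permDiagram σ) d).comap (Sum.map id Sum.inl) :=
      map_le_iff.1 le_sup_left
    have h2 : d ≤ (stack (permDiagram σ) d).comap Sum.inr := map_le_iff.1 le_sup_right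
    have h3 : ∀ x, stack (permDiagram σ) d x (Sum.inr (Sum.elim (Sum.inl ∘ σ.symm) id x)) := by
      rintro (x | x)
      · have : permDiagram σ (Sum.inl x) (Sum.inr (σ.symm x)) := by
          simp [permDiagram_apply]
        exact h1 this
      · exact Setoid.refl' _ _
    intro x y h
    exact Setoid.trans' _ (h3 x) (Setoid.trans' _ (h2 h) (Setoid.symm' _ (h3 y)))

theorem permDiagram_comp {α β γ : Type} (σ : β ≃ α) (d : Setoid (β ⊕ γ)) :
    comp (permDiagram σ) d = d.comap (Sum.map σ.symm id) := by
  unfold comp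
  rw [permDiagram_comp_aux]
  ext x y
  rcases x with x | x <;> rcases y with y | y <;> rfl

theorem loops_permDiagram {α β γ : Type} (σ : β ≃ α) (d : Setoid (β ⊕ γ)) :
    loops (permDiagram σ) d = 0 := by
  unfold loops missing
  rw [permDiagram_comp_aux]
  refine @Nat.card_of_isEmpty _ ⟨?_⟩
  rintro ⟨q, hq⟩
  induction q using Quotient.inductionOn with
  | h x =>
  rcases x with x | x | x
  · exact hq (Sum.inl x) rfl
  · refine hq (Sum.inl (σ x)) (Quotient.sound (s := d.comap _) ?_)
    simp [outer, Setoid.comap_rel]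
  · exact hq (Sum.inr x) rfl

theorem comp_permDiagram_aux {α β γ : Type} (d : Setoid (α ⊕ β)) (σ : γ ≃ β) :
    stack d (permDiagram σ) =
      d.comap (Sum.elim Sum.inl (Sum.elim Sum.inr (Sum.inr ∘ σ))) := by
  apply le_antisymm
  · refine sup_le (map_le_iff.2 ?_) (map_le_iff.2 ?_)
    · rintro (x | x) (y | y) h <;> exact h
    · rintro (x | x) (y | y) h <;> simp [permDiagram_apply] at h <;> subst h <;>
        simp [Setoid.comap_rel]
  · have h1 : d ≤ (stack d (permDiagram σ)).comap (Sum.map id Sum.inl) :=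
      map_le_iff.1 le_sup_left
    have h2 : permDiagram σ ≤ (stack d (permDiagram σ)).comap Sum.inr :=
      map_le_iff.1 le_sup_right
    have h3 : ∀ x, stack d (permDiagram σ) x (Sum.map id Sum.inl
        (Sum.elim Sum.inl (Sum.elim Sum.inr (Sum.inr ∘ σ)) x)) := by
      rintro (x | x | x)
      · exact Setoid.refl' _ _
      · exact Setoid.refl' _ _
      · have : permDiagram σ (Sum.inr x) (Sum.inl (σ x)) := by
          simp [permDiagram_apply]
        exact h2 this
    intro x y h
    exact Setoid.trans' _ (h3 x) (Setoid.trans' _ (h1 h) (Setoid.symm' _ (h3 y)))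

theorem comp_permDiagram {α β γ : Type} (d : Setoid (α ⊕ β)) (σ : γ ≃ β) :
    comp d (permDiagram σ) = d.comap (Sum.map id σ) := by
  unfold comp
  rw [comp_permDiagram_aux]
  ext x y
  rcases x with x | x <;> rcases y with y | y <;> rfl

theorem loops_comp_permDiagram {α β γ : Type} (d : Setoid (α ⊕ β)) (σ : γ ≃ β) :
    loops d (permDiagram σ) = 0 := by
  unfold loops missing
  rw [comp_permDiagram_aux]
  refine @Nat.card_of_isEmpty _ ⟨?_⟩
  rintro ⟨q, hq⟩
  induction q using Quotient.inductionOn with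
  | h x =>
  rcases x with x | x | x
  · exact hq (Sum.inl x) rfl
  · refine hq (Sum.inr (σ.symm x)) (Quotient.sound (s := d.comap _) ?_)
    simp [outer, Setoid.comap_rel]
  · exact hq (Sum.inr x) rfl

theorem permDiagram_mul {α β γ : Type} (σ : β ≃ α) (τ : γ ≃ β) :
    comp (permDiagram σ) (permDiagram τ) = permDiagram (τ.trans σ) := by
  rw [permDiagram_comp]
  ext x y
  rcases x with x | x <;> rcases y with y | y <;>
    simp [permDiagram_apply, Setoid.comap_rel, Equiv.symm_apply_eq, Equiv.eq_symm_apply]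

/-! ## The partition algebra -/

/-- Set partitions of `{1, …, k} ∪ {1', …, k'}`; the top points are in the left summand and the
bottom points are in the right summand. -/
abbrev Diagram (k : ℕ) : Type := Setoid (Fin k ⊕ Fin k)

/-- The partition algebra over `R` with parameter `δ`: the free `R`-module on the diagrams, where
the product of two diagrams `d` and `e` is `δ ^ N` times the diagram obtained by concatenating `d`
(on top) with `e` (below), `N` being the number of internal components.  For `R = ℂ` and `δ = t`
this is the specialization at `x = t` of the partition algebra over `ℂ[x]` with parameter `x`. -/
def PartitionAlgebra (R : Type) [CommRing R] (_δ : R) (k : ℕ) : Type := Diagram k →₀ R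

namespace PartitionAlgebra

section

variable {R : Type} [CommRing R] {δ : R} {k : ℕ}

noncomputable instance instAddCommGroup : AddCommGroup (PartitionAlgebra R δ k) :=
  inferInstanceAs (AddCommGroup (Diagram k →₀ R))

noncomputable instance : Module R (PartitionAlgebra R δ k) :=
  inferInstanceAs (Module R (Diagram k →₀ R))

/-- The scalar multiple `r d` of the diagram `d`. -/
noncomputable def single (d : Diagram k) (r : R) : PartitionAlgebra R δ k := Finsupp.single d r

/-- The linear extension of left multiplication by the diagram `d`. -/
noncomputable def diagramMul (d : Diagram k) :
    PartitionAlgebra R δ k →ₗ[R] PartitionAlgebra R δ k :=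
  Finsupp.linearCombination R fun e : Diagram k =>
    (single (comp d e) (δ ^ loops d e) : PartitionAlgebra R δ k)

/-- The bilinear extension of the product of diagrams. -/
noncomputable def mulHom :
    PartitionAlgebra R δ k →ₗ[R] PartitionAlgebra R δ k →ₗ[R] PartitionAlgebra R δ k :=
  Finsupp.linearCombination R fun d : Diagram k => diagramMul d

theorem diagramMul_single (d e : Diagram k) (s : R) :
    diagramMul d (single e s : PartitionAlgebra R δ k) =
      s • single (comp d e) (δ ^ loops d e) :=
  Finsupp.linearCombination_single R s e

theorem mulHom_single (d : Diagram k) (r : R) :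
    mulHom (single d r : PartitionAlgebra R δ k) = r • diagramMul d :=
  Finsupp.linearCombination_single R r d

noncomputable instance : Mul (PartitionAlgebra R δ k) := ⟨fun a b => mulHom a b⟩

noncomputable instance : One (PartitionAlgebra R δ k) :=
  ⟨single (permDiagram (Equiv.refl (Fin k))) 1⟩

theorem mul_def (a b : PartitionAlgebra R δ k) : a * b = mulHom a b := rfl

theorem one_def : (1 : PartitionAlgebra R δ k) = single (permDiagram (Equiv.refl (Fin k))) 1 := rfl

theorem smul_single (c : R) (d : Diagram k) (r : R) :
    c • (single d r : PartitionAlgebra R δ k) = single d (c * r) :=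
  Finsupp.smul_single' c d r

theorem single_mul_single (d e : Diagram k) (r s : R) :
    (single d r * single e s : PartitionAlgebra R δ k) =
      single (comp d e) (r * s * δ ^ loops d e) := by
  rw [mul_def, mulHom_single, LinearMap.smul_apply, diagramMul_single, smul_single, smul_single,
    mul_assoc]

theorem induction_on {p : PartitionAlgebra R δ k → Prop} (a : PartitionAlgebra R δ k)
    (h0 : p 0) (hadd : ∀ a b, p a → p b → p (a + b)) (hs : ∀ d r, p (single d r)) : p a :=
  Finsupp.induction_linear a h0 hadd hs

noncomputable instance : Ring (PartitionAlgebra R δ k) where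
  __ := instAddCommGroup (R := R) (δ := δ) (k := k)
  left_distrib a b c := by simp [mul_def]
  right_distrib a b c := by simp [mul_def]
  zero_mul a := by simp [mul_def]
  mul_zero a := by simp [mul_def]
  mul_assoc a b c := by
    induction a using induction_on with
    | h0 => simp [mul_def]
    | hadd a a' h h' => simp only [mul_def, map_add, LinearMap.add_apply] at *; rw [h, h']
    | hs d r =>
    induction b using induction_on with
    | h0 => simp [mul_def]
    | hadd a a' h h' => simp only [mul_def, map_add, LinearMap.add_apply] at *; rw [h, h']
    | hs e s =>
    induction c using induction_on with
    | h0 => simp [mul_def]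
    | hadd a a' h h' => simp only [mul_def, map_add] at *; rw [h, h']
    | hs f t =>
      rw [single_mul_single, single_mul_single, single_mul_single, single_mul_single, comp_assoc]
      congr 1
      have h := congrArg (fun n => δ ^ n) (loops_assoc d e f)
      simp only [pow_add] at h
      linear_combination r * s * t * h
  one_mul a := by
    induction a using induction_on with
    | h0 => simp [mul_def]
    | hadd a a' h h' => simp only [mul_def, map_add] at *; rw [h, h']
    | hs d r =>
      rw [one_def, single_mul_single, permDiagram_comp, loops_permDiagram]
      simp [Setoid.comap_id]
  mul_one a := by
    induction a using induction_on with
    | h0 => simp [mul_def]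
    | hadd a a' h h' => simp only [mul_def, map_add, LinearMap.add_apply] at *; rw [h, h']
    | hs d r =>
      rw [one_def, single_mul_single, comp_permDiagram, loops_comp_permDiagram]
      simp

noncomputable instance : Algebra R (PartitionAlgebra R δ k) :=
  Algebra.ofModule (fun r a b => by simp [mul_def]) (fun r a b => by simp [mul_def])

/-- The inclusion of the group algebra of the symmetric group, on group elements. -/
noncomputable def ofPerm : Equiv.Perm (Fin k) →* PartitionAlgebra R δ k where
  toFun σ := single (permDiagram σ) 1
  map_one' := rfl
  map_mul' σ τ := by
    rw [single_mul_single, permDiagram_mul, loops_permDiagram]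
    simp [Equiv.Perm.mul_def]

end

end PartitionAlgebra

/-! ## The spherical partition algebra -/

/-- The symmetrizing idempotent `e_k = (1 / k!) ∑ σ`. -/
noncomputable def symmetrizer (t : ℂ) (k : ℕ) : PartitionAlgebra ℂ t k :=
  (1 / (k.factorial : ℂ)) • ∑ σ : Equiv.Perm (Fin k), PartitionAlgebra.ofPerm σ

theorem symmetrizer_idem (t : ℂ) (k : ℕ) : IsIdempotentElem (symmetrizer t k) := by
  unfold IsIdempotentElem symmetrizer
  have h : ∀ σ : Equiv.Perm (Fin k),
      (PartitionAlgebra.ofPerm σ : PartitionAlgebra ℂ t k) *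
        ∑ τ : Equiv.Perm (Fin k), PartitionAlgebra.ofPerm τ =
      ∑ τ : Equiv.Perm (Fin k), PartitionAlgebra.ofPerm τ := by
    intro σ
    rw [Finset.mul_sum]
    simp_rw [← map_mul]
    exact Fintype.sum_equiv (Equiv.mulLeft σ) _ _ (fun _ => rfl)
  have h0 : (k.factorial : ℂ) ≠ 0 := Nat.cast_ne_zero.2 k.factorial_ne_zero
  rw [smul_mul_smul_comm, Finset.sum_mul, Finset.sum_congr rfl (fun σ _ => h σ), Finset.sum_const,
    Finset.card_univ, Fintype.card_perm, Fintype.card_fin, ← Nat.cast_smul_eq_nsmul ℂ, smul_smul]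
  congr 1
  field_simp

section Corner

variable {𝕜 A : Type} [CommRing 𝕜] [Ring A] [Algebra 𝕜 A] {e : A}

/-- The scalar multiplication on the idempotent truncation `eAe`. -/
instance (he : IsIdempotentElem e) : SMul 𝕜 he.Corner :=
  ⟨fun r a => ⟨r • a.1, by
    have h := (Subsemigroup.mem_corner_iff he).1 a.2
    refine (Subsemigroup.mem_corner_iff he).2 ⟨?_, ?_⟩
    · rw [mul_smul_comm, h.1]
    · rw [smul_mul_assoc, h.2]⟩⟩

instance (he : IsIdempotentElem e) : Module 𝕜 he.Corner where
  one_smul a := Subtype.ext (one_smul 𝕜 a.1)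
  mul_smul r s a := Subtype.ext (mul_smul r s a.1)
  smul_zero r := Subtype.ext (smul_zero r)
  smul_add r a b := Subtype.ext (smul_add r a.1 b.1)
  add_smul r s a := Subtype.ext (add_smul r s a.1)
  zero_smul a := Subtype.ext (zero_smul 𝕜 a.1)

/-- The idempotent truncation `eAe` of a `𝕜`-algebra is a `𝕜`-algebra (with unit `e`). -/
instance (he : IsIdempotentElem e) : Algebra 𝕜 he.Corner :=
  Algebra.ofModule (fun r a b => Subtype.ext (smul_mul_assoc r a.1 b.1))
    (fun r a b => Subtype.ext (mul_smul_comm r a.1 b.1))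

end Corner

section Truncation

variable {A : Type} [Ring A] {e : A}

/-- The truncation `e M = {e m | m ∈ M}` of an `A`-module `M`. -/
def Truncation (_he : IsIdempotentElem e) (M : Type) [AddCommGroup M] [Module A M] : Type :=
  (DistribSMul.toAddMonoidHom M e).range

variable {M : Type} [AddCommGroup M] [Module A M]

instance (he : IsIdempotentElem e) : AddCommGroup (Truncation he M) :=
  inferInstanceAs (AddCommGroup (DistribSMul.toAddMonoidHom M e).range)

/-- `eAe` acts on `e M` by restriction of the action of `A` on `M`. -/
instance (he : IsIdempotentElem e) : SMul he.Corner (Truncation he M) :=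
  ⟨fun a x => ⟨a.1 • x.1, ⟨a.1 • x.1, by
    change e • a.1 • x.1 = a.1 • x.1
    rw [smul_smul, ((Subsemigroup.mem_corner_iff he).1 a.2).1]⟩⟩⟩

instance (he : IsIdempotentElem e) : Module he.Corner (Truncation he M) where
  one_smul x := by
    obtain ⟨_, y, rfl⟩ := x
    refine Subtype.ext ?_
    change e • e • y = e • y
    rw [smul_smul, he.eq]
  mul_smul a b x := Subtype.ext (mul_smul a.1 b.1 x.1)
  smul_zero a := Subtype.ext (smul_zero a.1)
  smul_add a x y := Subtype.ext (smul_add a.1 x.1 y.1)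
  add_smul a b x := Subtype.ext (add_smul a.1 b.1 x.1)
  zero_smul x := Subtype.ext (zero_smul A x.1)

end Truncation

/-- The spherical partition algebra `e_k P_k(t) e_k`. -/
abbrev SphericalPartitionAlgebra (t : ℂ) (k : ℕ) : Type := (symmetrizer_idem t k).Corner

/-! ## Cellular algebras -/

/-- A cell datum for the `𝕜`-algebra `A` on the poset `Λ`. -/
structure CellDatum (𝕜 A Λ : Type) [CommRing 𝕜] [IsDomain 𝕜] [Ring A] [Algebra 𝕜 A]
    [PartialOrder Λ] where
  /-- The index sets; they are finite, and may be empty. -/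
  T : Λ → Type
  [fintypeT : ∀ l, Fintype (T l)]
  /-- The elements `C l s t`. -/
  C : ∀ l, T l → T l → A
  /-- The elements `C l s t`, for `l` in `Λ` and `s`, `t` in `T l`, form a basis of `A`. -/
  basis : Module.Basis (Σ l, T l × T l) 𝕜 A
  basis_apply : ∀ l s t, basis ⟨l, (s, t)⟩ = C l s t
  /-- The linear map that sends `C l s t` to `C l t s` is an anti-automorphism. -/
  star : A ≃ₗ[𝕜] A
  star_C : ∀ l s t, star (C l s t) = C l t s
  star_mul : ∀ a b, star (a * b) = star b * star a
  /-- The coefficients `r l a s u`, which do not depend on `t`. -/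
  r : ∀ l, A → T l → T l → 𝕜
  mul_C : ∀ (l : Λ) (a : A) (s t : T l),
    a * C l s t - ∑ u, r l a s u • C l u t ∈
      Submodule.span 𝕜 {x | ∃ m, l < m ∧ ∃ u v, x = C m u v}

namespace CellDatum

section

variable {𝕜 A Λ : Type} [CommRing 𝕜] [IsDomain 𝕜] [Ring A] [Algebra 𝕜 A] [PartialOrder Λ]

instance (D : CellDatum 𝕜 A Λ) (l : Λ) : Fintype (D.T l) := D.fintypeT l

/-- The span of the elements `C m u v` with `m > l`. -/
def higher (D : CellDatum 𝕜 A Λ) (l : Λ) : Submodule 𝕜 A :=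
  Submodule.span 𝕜 {x | ∃ m, l < m ∧ ∃ u v, x = D.C m u v}

theorem mul_C' (D : CellDatum 𝕜 A Λ) (l : Λ) (a : A) (s t : D.T l) :
    a * D.C l s t - ∑ u, D.r l a s u • D.C l u t ∈ D.higher l := D.mul_C l a s t

theorem higher_mono (D : CellDatum 𝕜 A Λ) {l m : Λ} (h : l < m) : D.higher m ≤ D.higher l := by
  refine Submodule.span_mono ?_
  rintro _ ⟨n, hn, u, v, rfl⟩
  exact ⟨n, h.trans hn, u, v, rfl⟩

theorem mul_higher (D : CellDatum 𝕜 A Λ) (l : Λ) (a x : A) (hx : x ∈ D.higher l) :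
    a * x ∈ D.higher l := by
  induction hx using Submodule.span_induction with
  | mem x hx =>
    obtain ⟨m, hm, u, v, rfl⟩ := hx
    rw [← sub_add_cancel (a * D.C m u v) (∑ w, D.r m a u w • D.C m w v)]
    refine add_mem (D.higher_mono hm (D.mul_C' m a u v)) (sum_mem fun w _ => ?_)
    exact Submodule.smul_mem _ _ (Submodule.subset_span ⟨m, hm, w, v, rfl⟩)
  | zero => simp
  | add x y _ _ hx hy => rw [mul_add]; exact add_mem hx hy
  | smul c x _ hx => rw [mul_smul_comm]; exact Submodule.smul_mem _ _ hx

theorem repr_higher (D : CellDatum 𝕜 A Λ) (l : Λ) (x : A) (hx : x ∈ D.higher l) (u t : D.T l) :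
    D.basis.repr x ⟨l, (u, t)⟩ = 0 := by
  induction hx using Submodule.span_induction with
  | mem x hx =>
    classical
    obtain ⟨m, hm, v, w, rfl⟩ := hx
    rw [← D.basis_apply, Module.Basis.repr_self, Finsupp.single_apply, if_neg]
    intro h
    exact hm.ne (congrArg Sigma.fst h).symm
  | zero => simp
  | add x y _ _ hx hy => simp [hx, hy]
  | smul c x _ hx => simp [hx]

theorem repr_sum (D : CellDatum 𝕜 A Λ) (l : Λ) (c : D.T l → 𝕜) (u t : D.T l) :
    D.basis.repr (∑ v, c v • D.C l v t) ⟨l, (u, t)⟩ = c u := by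
  classical
  simp_rw [← D.basis_apply]
  rw [map_sum, Finsupp.finsetSum_apply, Finset.sum_eq_single u]
  · simp
  · intro v _ hv
    rw [map_smul, Module.Basis.repr_self, Finsupp.smul_apply, Finsupp.single_apply, if_neg, smul_zero]
    intro h
    apply hv
    have := eq_of_heq (Sigma.mk.inj h).2
    exact congrArg Prod.fst this
  · simp

/-- The coefficients are determined by the multiplication. -/
theorem coeff_unique (D : CellDatum 𝕜 A Λ) (l : Λ) (c : D.T l → 𝕜) (x : A) (t : D.T l)
    (h : x - ∑ v, c v • D.C l v t ∈ D.higher l) (u : D.T l) :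
    D.basis.repr x ⟨l, (u, t)⟩ = c u := by
  have := D.repr_higher l _ h u t
  rw [map_sub, Finsupp.sub_apply, repr_sum, sub_eq_zero] at this
  exact this

theorem r_eq (D : CellDatum 𝕜 A Λ) (l : Λ) (a : A) (s u : D.T l) :
    D.r l a s u = D.basis.repr (a * D.C l s s) ⟨l, (u, s)⟩ :=
  (D.coeff_unique l _ _ s (D.mul_C' l a s s) u).symm

theorem r_add (D : CellDatum 𝕜 A Λ) (l : Λ) (a b : A) (s u : D.T l) :
    D.r l (a + b) s u = D.r l a s u + D.r l b s u := by
  simp [r_eq, add_mul]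

theorem r_zero (D : CellDatum 𝕜 A Λ) (l : Λ) (s u : D.T l) : D.r l 0 s u = 0 := by
  simp [r_eq]

theorem r_one (D : CellDatum 𝕜 A Λ) (l : Λ) (f : D.T l → 𝕜) (u : D.T l) :
    ∑ s, f s * D.r l 1 s u = f u := by
  classical
  rw [Finset.sum_eq_single u]
  · rw [r_eq, one_mul, ← D.basis_apply]; simp
  · intro s _ hs
    rw [r_eq, one_mul, ← D.basis_apply, Module.Basis.repr_self, Finsupp.single_apply, if_neg,
      mul_zero]
    intro h
    exact hs (congrArg Prod.fst (eq_of_heq (Sigma.mk.inj h).2))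
  · simp

theorem r_mul (D : CellDatum 𝕜 A Λ) (l : Λ) (a b : A) (s u : D.T l) :
    D.r l (a * b) s u = ∑ v, D.r l b s v * D.r l a v u := by
  rw [r_eq]
  refine D.coeff_unique l (fun u => ∑ v, D.r l b s v * D.r l a v u) _ s ?_ u
  have h1 := D.mul_higher l a _ (D.mul_C' l b s s)
  have h2 : ∑ v, D.r l b s v • (a * D.C l v s - ∑ u, D.r l a v u • D.C l u s) ∈ D.higher l :=
    sum_mem fun v _ => Submodule.smul_mem _ _ (D.mul_C' l a v s)
  have h3 := add_mem h1 h2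
  convert h3 using 1
  simp only [mul_sub, smul_sub, Finset.sum_sub_distrib, Finset.mul_sum, mul_smul_comm, mul_assoc,
    Finset.smul_sum, smul_smul, Finset.sum_smul]
  rw [Finset.sum_comm (s := Finset.univ) (t := Finset.univ)
    (f := fun u v => (D.r l b s v * D.r l a v u) • D.C l u s)]
  abel

/-- The cell module of `l`: the free `𝕜`-module on the symbols `C s`, for `s` in `T l`.
Its elements are written as families of coefficients. -/
def CellModule (D : CellDatum 𝕜 A Λ) (l : Λ) : Type := D.T l → 𝕜

instance (D : CellDatum 𝕜 A Λ) (l : Λ) : AddCommGroup (D.CellModule l) :=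
  inferInstanceAs (AddCommGroup (D.T l → 𝕜))

/-- The action on the cell module, given by `a • C s = ∑ u, r l a s u • C u`. -/
instance (D : CellDatum 𝕜 A Λ) (l : Λ) : SMul A (D.CellModule l) :=
  ⟨fun a f u => ∑ s, f s * D.r l a s u⟩

theorem cellModule_smul_apply (D : CellDatum 𝕜 A Λ) (l : Λ) (a : A) (f : D.CellModule l)
    (u : D.T l) : (a • f) u = ∑ s, f s * D.r l a s u := rfl

theorem cellModule_add_apply (D : CellDatum 𝕜 A Λ) (l : Λ) (f g : D.CellModule l)
    (u : D.T l) : (f + g) u = f u + g u := rfl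

theorem cellModule_zero_apply (D : CellDatum 𝕜 A Λ) (l : Λ) (u : D.T l) :
    (0 : D.CellModule l) u = 0 := rfl

instance (D : CellDatum 𝕜 A Λ) (l : Λ) : Module A (D.CellModule l) where
  one_smul f := by
    funext u
    rw [cellModule_smul_apply]
    exact D.r_one l f u
  mul_smul a b f := by
    funext u
    simp only [cellModule_smul_apply, r_mul, Finset.mul_sum, Finset.sum_mul, mul_assoc]
    exact Finset.sum_comm
  smul_zero a := by
    funext u
    simp [cellModule_smul_apply, cellModule_zero_apply]
  smul_add a f g := by
    funext u
    simp [cellModule_smul_apply, cellModule_add_apply, add_mul, Finset.sum_add_distrib]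
  add_smul a b f := by
    funext u
    simp [cellModule_smul_apply, cellModule_add_apply, r_add, mul_add, Finset.sum_add_distrib]
  zero_smul f := by
    funext u
    simp [cellModule_smul_apply, cellModule_zero_apply, r_zero]

end

end CellDatum

/-! ## Partitions and tableaux -/

/-- Partitions of size at most `k`, written as Young diagrams. -/
@[ext]
structure PartitionUpTo (k : ℕ) where
  shape : YoungDiagram
  card_le : shape.card ≤ k

/-- `Dominated l m` means that `l` is dominated by `m`: the partial sums of the row lengths of `l`
are at most those of `m`. -/
def Dominated (l m : YoungDiagram) : Prop :=
  ∀ i, ∑ j ∈ Finset.range i, l.rowLen j ≤ ∑ j ∈ Finset.range i, m.rowLen j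

theorem Dominated.antisymm {l m : YoungDiagram} (h : Dominated l m) (h' : Dominated m l) :
    l = m := by
  have hs : ∀ i, ∑ j ∈ Finset.range i, l.rowLen j = ∑ j ∈ Finset.range i, m.rowLen j :=
    fun i => le_antisymm (h i) (h' i)
  have hr : ∀ i, l.rowLen i = m.rowLen i := by
    intro i
    have h1 := hs (i + 1)
    rw [Finset.sum_range_succ, Finset.sum_range_succ, hs i] at h1
    exact Nat.add_left_cancel h1
  refine SetLike.ext ?_
  rintro ⟨i, j⟩
  rw [YoungDiagram.mem_iff_lt_rowLen, YoungDiagram.mem_iff_lt_rowLen, hr]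

/-- The order on partitions of size at most `k`: the dominance order on partitions of the same
size, and a partition of larger size is smaller than every partition of smaller size. -/
instance (k : ℕ) : PartialOrder (PartitionUpTo k) where
  le l m := m.shape.card < l.shape.card ∨
    (l.shape.card = m.shape.card ∧ Dominated l.shape m.shape)
  le_refl l := Or.inr ⟨rfl, fun _ => le_rfl⟩
  le_trans l m n h h' := by
    rcases h with h | ⟨h, hd⟩ <;> rcases h' with h' | ⟨h', hd'⟩
    · exact Or.inl (h'.trans h)
    · exact Or.inl (h' ▸ h)
    · exact Or.inl (h ▸ h')
    · exact Or.inr ⟨h.trans h', fun i => (hd i).trans (hd' i)⟩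
  le_antisymm l m h h' := by
    rcases h with h | ⟨h, hd⟩ <;> rcases h' with h' | ⟨h', hd'⟩
    · omega
    · omega
    · omega
    · exact PartitionUpTo.ext (hd.antisymm hd')

/-- Tableaux of shape `l`: the cells of `l` are filled bijectively with the numbers
`0, …, |l| - 1`. -/
abbrev Tableau (l : YoungDiagram) : Type := {c // c ∈ l.cells} ≃ Fin l.card

/-- A tableau is standard if its entries increase along rows and down columns. -/
def Tableau.IsStandard {l : YoungDiagram} (s : Tableau l) : Prop :=
  (∀ c c' : {c // c ∈ l.cells}, c.1.1 = c'.1.1 → c.1.2 < c'.1.2 → s c < s c') ∧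
  (∀ c c' : {c // c ∈ l.cells}, c.1.2 = c'.1.2 → c.1.1 < c'.1.1 → s c < s c')

/-- The cells of `l` with the lexicographic order, which compares rows first. -/
def lexCells (l : YoungDiagram) : Finset (ℕ ×ₗ ℕ) := l.cells.map toLex.toEmbedding

theorem card_lexCells (l : YoungDiagram) : (lexCells l).card = l.card := Finset.card_map _

/-- The row reading tableau, in which the numbers are filled in increasingly along the rows, one
row after the other. -/
def rowReading (l : YoungDiagram) : Tableau l :=
  (toLex.subtypeEquiv (fun c => by simp [lexCells])).trans
    ((lexCells l).orderIsoOfFin (card_lexCells l)).symm.toEquiv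

/-- The permutation `d(s)` with `d(s) t^l = s`, for `t^l` the row reading tableau and the action of
permutations on the entries of tableaux. -/
def Tableau.perm {l : YoungDiagram} (s : Tableau l) : Equiv.Perm (Fin l.card) :=
  (rowReading l).symm.trans s

/-- The row stabilizer of the row reading tableau. -/
def rowStabilizer (l : YoungDiagram) : Finset (Equiv.Perm (Fin l.card)) :=
  Finset.univ.filter fun w =>
    ∀ i, ((rowReading l).symm (w i)).1.1 = ((rowReading l).symm i).1.1

/-- The element `x_{st} = d(s) x d(t)⁻¹` of the group algebra, where `x` is the sum of the elements
of the row stabilizer of the row reading tableau. -/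
noncomputable def murphy {l : YoungDiagram} (s t : Tableau l) :
    MonoidAlgebra ℂ (Equiv.Perm (Fin l.card)) :=
  MonoidAlgebra.of ℂ _ s.perm * (∑ w ∈ rowStabilizer l, MonoidAlgebra.of ℂ _ w) *
    MonoidAlgebra.of ℂ _ (t.perm)⁻¹

/-! ## Half diagrams -/

/-- A set partition of `{1, …, k}` with `l` distinguished blocks. -/
structure HalfDiagram (k l : ℕ) where
  part : Setoid (Fin k)
  marked : Finset (Quotient part)
  card_marked : marked.card = l

open Classical in
/-- The smallest element of a block. -/
noncomputable def blockMin {k : ℕ} (c : Setoid (Fin k)) (q : Quotient c) : Fin k :=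
  (Finset.univ.filter fun i => Quotient.mk c i = q).min' (by
    obtain ⟨i, hi⟩ := Quotient.exists_rep q
    exact ⟨i, by simpa using hi⟩)

theorem mk_blockMin {k : ℕ} (c : Setoid (Fin k)) (q : Quotient c) :
    Quotient.mk c (blockMin c q) = q := by
  classical
  have h := Finset.min'_mem (Finset.univ.filter fun i => Quotient.mk c i = q) (by
    obtain ⟨i, hi⟩ := Quotient.exists_rep q
    exact ⟨i, by simpa using hi⟩)
  have h2 := (Finset.mem_filter.1 h).2
  unfold blockMin
  convert h2

theorem blockMin_injective {k : ℕ} (c : Setoid (Fin k)) : Function.Injective (blockMin c) :=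
  Function.LeftInverse.injective (mk_blockMin c)

namespace HalfDiagram

section

variable {k l : ℕ}

/-- The distinguished blocks are numbered in the order of their smallest elements; `a.rep j` is the
smallest element of the distinguished block with number `j`. -/
noncomputable def rep (a : HalfDiagram k l) : Fin l ↪o Fin k :=
  (a.marked.map ⟨blockMin a.part, blockMin_injective a.part⟩).orderEmbOfFin
    ((Finset.card_map _).trans a.card_marked)

theorem rep_eq_blockMin (a : HalfDiagram k l) (j : Fin l) :
    ∃ q ∈ a.marked, a.rep j = blockMin a.part q := by
  have h := Finset.orderEmbOfFin_mem
    (a.marked.map ⟨blockMin a.part, blockMin_injective a.part⟩)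
    ((Finset.card_map _).trans a.card_marked) j
  obtain ⟨q, hq, h⟩ := Finset.mem_map.1 h
  exact ⟨q, hq, h.symm⟩

theorem rep_inj (a : HalfDiagram k l) {i j : Fin l} (h : a.part (a.rep i) (a.rep j)) : i = j := by
  obtain ⟨p, -, hp⟩ := a.rep_eq_blockMin i
  obtain ⟨q, -, hq⟩ := a.rep_eq_blockMin j
  apply a.rep.injective
  rw [hp, hq] at h ⊢
  have h1 : Quotient.mk a.part (blockMin a.part p) = Quotient.mk a.part (blockMin a.part q) :=
    Quotient.sound (s := a.part) h
  rw [mk_blockMin, mk_blockMin] at h1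
  rw [h1]

/-- The relation defining `HalfDiagram.join`. -/
def joinRel (a : HalfDiagram k l) (w : Equiv.Perm (Fin l)) (b : HalfDiagram k l) :
    Fin k ⊕ Fin k → Fin k ⊕ Fin k → Prop
  | Sum.inl x, Sum.inl y => a.part x y
  | Sum.inr x, Sum.inr y => b.part x y
  | Sum.inl x, Sum.inr y => ∃ j, a.part x (a.rep (w j)) ∧ b.part y (b.rep j)
  | Sum.inr x, Sum.inl y => ∃ j, a.part y (a.rep (w j)) ∧ b.part x (b.rep j)

/-- The diagram whose intersection top blocks are the blocks of `a`, whose intersection bottom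
blocks are the blocks of `b`, and where the distinguished block with number `j` of `b` is connected
with the distinguished block with number `w j` of `a`, these being all the propagating blocks. -/
def join (a : HalfDiagram k l) (w : Equiv.Perm (Fin l)) (b : HalfDiagram k l) : Diagram k where
  r := joinRel a w b
  iseqv := by
    refine ⟨?_, ?_, ?_⟩
    · rintro (x | x)
      · exact a.part.refl' x
      · exact b.part.refl' x
    · rintro (x | x) (y | y) h
      · exact a.part.symm' h
      · exact h
      · exact h
      · exact b.part.symm' h
    · rintro (x | x) (y | y) (z | z) h h'
      · exact a.part.trans' h h'
      · obtain ⟨j, h1, h2⟩ := h'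
        exact ⟨j, a.part.trans' h h1, h2⟩
      · obtain ⟨j, h1, h2⟩ := h
        obtain ⟨j', h1', h2'⟩ := h'
        obtain rfl := b.rep_inj (b.part.trans' (b.part.symm' h2) h2')
        exact a.part.trans' h1 (a.part.symm' h1')
      · obtain ⟨j, h1, h2⟩ := h
        exact ⟨j, h1, b.part.trans' (b.part.symm' h') h2⟩
      · obtain ⟨j, h1, h2⟩ := h
        exact ⟨j, a.part.trans' (a.part.symm' h') h1, h2⟩
      · obtain ⟨j, h1, h2⟩ := h
        obtain ⟨j', h1', h2'⟩ := h'
        obtain rfl := w.injective (a.rep_inj (a.part.trans' (a.part.symm' h1) h1'))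
        exact b.part.trans' h2 (b.part.symm' h2')
      · obtain ⟨j, h1, h2⟩ := h'
        exact ⟨j, h1, b.part.trans' h h2⟩
      · exact b.part.trans' h h'

/-- The linear extension of `w ↦ join a w b` to the group algebra. -/
noncomputable def joinLinear {t : ℂ} (a : HalfDiagram k l)
    (x : MonoidAlgebra ℂ (Equiv.Perm (Fin l))) (b : HalfDiagram k l) : PartitionAlgebra ℂ t k :=
  x.coeff.sum fun w r => PartitionAlgebra.single (join a w b) r

open Classical in
/-- The half diagram with blocks `{1}, …, {l}, {l + 1, …, k}` (the last one only if `l < k`) and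
distinguished blocks `{1}, …, {l}`. -/
noncomputable def initial (h : l ≤ k) : HalfDiagram k l where
  part := Setoid.ker fun i : Fin k => min i.1 l
  marked := Finset.univ.image fun j : Fin l => Quotient.mk _ (Fin.castLE h j)
  card_marked := by
    rw [Finset.card_image_of_injective, Finset.card_univ, Fintype.card_fin]
    intro i j hij
    have h1 : min i.1 l = min j.1 l := Quotient.exact hij
    apply Fin.ext
    omega

end

end HalfDiagram

/-! ## The cell modules of the partition algebra -/

/-- The cellular basis elements `C` of the partition algebra, indexed by the pairs `(s, a)` and
`(u, b)` of a tableau of shape `l` and a half diagram with `|l|` distinguished blocks. -/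
noncomputable def partitionC (t : ℂ) {k : ℕ} {l : YoungDiagram} (s : Tableau l)
    (a : HalfDiagram k l.card) (u : Tableau l) (b : HalfDiagram k l.card) :
    PartitionAlgebra ℂ t k :=
  a.joinLinear (murphy s u) b

/-- The cell ideal of `l`: the left ideal generated by (and in fact the linear span of) the
cellular basis elements of the partition algebra that belong to partitions `m > l`. -/
noncomputable def cellIdeal (t : ℂ) {k : ℕ} (l : PartitionUpTo k) :
    Submodule (PartitionAlgebra ℂ t k) (PartitionAlgebra ℂ t k) :=
  Submodule.span _ {x | ∃ m : PartitionUpTo k, l < m ∧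
    ∃ (s : Tableau m.shape) (a : HalfDiagram k m.shape.card)
      (u : Tableau m.shape) (b : HalfDiagram k m.shape.card),
      s.IsStandard ∧ u.IsStandard ∧ x = partitionC t s a u b}

/-- The cell module `Δ_k(l)` of the partition algebra: the submodule of the quotient by the cell
ideal that is generated by the classes of the elements `C` with row index `(s, a)` arbitrary, for
`s` a standard tableau, and with column index given by the row reading tableau and the half diagram
`HalfDiagram.initial`. -/
noncomputable def Delta (t : ℂ) {k : ℕ} (l : PartitionUpTo k) :
    Submodule (PartitionAlgebra ℂ t k) (PartitionAlgebra ℂ t k ⧸ cellIdeal t l) :=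
  Submodule.span _ {x | ∃ (s : Tableau l.shape) (a : HalfDiagram k l.shape.card), s.IsStandard ∧
    x = (cellIdeal t l).mkQ
      (partitionC t s a (rowReading l.shape) (HalfDiagram.initial l.card_le))}

end SphericalPartition

/-! Two facts combine: the partition algebra is cellular with the modules `Delta` as cell modules,
and cellularity passes to a truncation eAe when the anti-automorphism fixes e. Reflection of
diagrams fixes the symmetrizer because it sends the diagram of σ to that of σ⁻¹.

Truncation (`CellDatum.corner`). Modulo larger indices, the layer of a cellular algebra at λ is V ⊗
V, for V the cell module, and x ↦ exe acts on it as v ⊗ w ↦ ev ⊗ ew. For a basis (b_s) of eV the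
elements e(b_s ⊗ b_t)e form a cellular basis of eAe: they span by descending induction on the finite
poset, and they are independent by a look at a minimal index. The cell module of eAe is then eV; it
may vanish, which is why index sets may be empty.

The partition algebra. A diagram amounts to two half diagrams and a permutation matching their
distinguished blocks. Left multiplication by a diagram either lowers the number of propagating
blocks, or changes the upper half diagram and multiplies the permutation by a fixed σ
(`HalfDiagram.comp_join`). A cellular basis of every symmetric group algebra thus yields one of the
partition algebra (`partitionCellDatum`).

The symmetric group. Elements of the group algebra are treated as functions on permutations. The
Murphy element of s and t becomes the indicator function `tabSum` of the permutations w with row_s ∘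
w = row_t. Standard tableaux suffice for spanning, by Garnir straightening
(`tabSum_mem_of_standard`). Linear independence comes from pairing with signed sums over
permutations that match columns. Such a pairing vanishes unless rows and columns meet in at most one
point, which forces an inequality of counting functions refining dominance (`countLt_le`). For one
shape the pairing is a product of a factor for s and a factor for t (`signedSum_mul`); hence the
straightening coefficients of s do not depend on t (`exists_straightening`), as a cell datum
demands. -/

namespace SphericalPartition

/-! ## Triangular families -/

/-- If the functionals `φ i` are triangular with respect to the family `v`, then a linear
combination of `v` that is killed by `φ i` for `i` in a suitable set `S` does not involve the
indices in `S`. -/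
theorem coeff_eq_zero_of_triangular {𝕜 V ι Q : Type*} [Field 𝕜] [AddCommGroup V] [Module 𝕜 V]
    [PartialOrder Q] (v : ι → V) (φ : ι → V →ₗ[𝕜] 𝕜) (m : ι → Q) (S : Set ι)
    (hdiag : ∀ i, φ i (v i) ≠ 0)
    (hle : ∀ i j, φ i (v j) ≠ 0 → m j ≤ m i)
    (heq : ∀ i j, φ i (v j) ≠ 0 → m j = m i → j = i)
    (hS : ∀ i j, i ∈ S → φ i (v j) ≠ 0 → j ∈ S)
    (s : Finset ι) (c : ι → 𝕜) (h0 : ∀ i ∈ S, φ i (∑ j ∈ s, c j • v j) = 0) :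
    ∀ i ∈ s, i ∈ S → c i = 0 := by
  classical
  intro i his hiS
  by_contra hc
  -- At an index i₀ of S with nonzero coefficient and minimal `m`, any other term surviving `φ i₀`
  -- would also lie in S and have a value of `m` at most `m i₀`. Minimality makes the values equal,
  -- and then the indices.
  obtain ⟨i₀, hi₀⟩ := (s.filter fun i => i ∈ S ∧ c i ≠ 0).exists_minimalFor m
    ⟨i, by simp [his, hiS, hc]⟩
  have hmem := hi₀.1
  simp only [Finset.mem_filter] at hmem
  obtain ⟨h1, h2, h3⟩ := hmem
  have h := h0 i₀ h2
  rw [map_sum, Finset.sum_eq_single i₀] at h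
  · rw [map_smul, smul_eq_mul, mul_eq_zero] at h
    exact h.elim h3 (hdiag i₀)
  · intro j hj hji
    rw [map_smul, smul_eq_mul]
    by_contra hne
    obtain ⟨hcj, hφ⟩ := mul_ne_zero_iff.1 hne
    have hle' := hle _ _ hφ
    have := hi₀.2 (j := j) (by simp [hj, hS _ _ h2 hφ, hcj]) hle'
    exact hji (heq _ _ hφ (le_antisymm hle' this))
  · intro h; exact absurd h1 h

theorem linearIndependent_of_triangular {𝕜 V ι Q : Type*} [Field 𝕜] [AddCommGroup V]
    [Module 𝕜 V] [PartialOrder Q] (v : ι → V) (φ : ι → V →ₗ[𝕜] 𝕜) (m : ι → Q)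
    (hdiag : ∀ i, φ i (v i) ≠ 0)
    (hle : ∀ i j, φ i (v j) ≠ 0 → m j ≤ m i)
    (heq : ∀ i j, φ i (v j) ≠ 0 → m j = m i → j = i) : LinearIndependent 𝕜 v := by
  rw [linearIndependent_iff']
  intro s g hg i hi
  exact coeff_eq_zero_of_triangular v φ m Set.univ hdiag hle heq (fun _ _ _ _ => trivial) s g
    (fun i _ => by rw [hg, map_zero]) i hi trivial

/-! ## Idempotent truncations of cellular algebras -/

namespace CellDatum

section

variable {𝕜 A Λ : Type} [Field 𝕜] [Ring A] [Algebra 𝕜 A] [PartialOrder Λ]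

theorem star_star (D : CellDatum 𝕜 A Λ) (a : A) : D.star (D.star a) = a := by
  have : D.star.toLinearMap ∘ₗ D.star.toLinearMap = LinearMap.id := by
    refine D.basis.ext ?_
    rintro ⟨l, s, t⟩
    simp [D.basis_apply, D.star_C]
  exact LinearMap.congr_fun this a

theorem star_higher (D : CellDatum 𝕜 A Λ) (l : Λ) (x : A) (hx : x ∈ D.higher l) :
    D.star x ∈ D.higher l := by
  induction hx using Submodule.span_induction with
  | mem x hx =>
    obtain ⟨m, hm, u, v, rfl⟩ := hx
    rw [D.star_C]
    exact Submodule.subset_span ⟨m, hm, v, u, rfl⟩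
  | zero => simp
  | add x y _ _ hx hy => rw [map_add]; exact add_mem hx hy
  | smul c x _ hx => rw [map_smul]; exact Submodule.smul_mem _ _ hx

/-- The anti-automorphism preserves the span and exchanges left with right multiplication, so the
span is a two-sided ideal. -/
theorem higher_mul (D : CellDatum 𝕜 A Λ) (l : Λ) (a x : A) (hx : x ∈ D.higher l) :
    x * a ∈ D.higher l := by
  rw [← D.star_star (x * a), D.star_mul]
  exact D.star_higher _ _ (D.mul_higher _ _ _ (D.star_higher _ _ hx))

/-- The action of `a` on the cell module, as a linear map on families of coefficients. -/
def act (D : CellDatum 𝕜 A Λ) (l : Λ) (a : A) : (D.T l → 𝕜) →ₗ[𝕜] (D.T l → 𝕜) where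
  toFun f := fun u => ∑ s, f s * D.r l a s u
  map_add' f g := by funext u; simp [add_mul, Finset.sum_add_distrib]
  map_smul' c f := by funext u; simp [Finset.mul_sum, mul_assoc]

theorem act_mul (D : CellDatum 𝕜 A Λ) (l : Λ) (a b : A) (f : D.T l → 𝕜) :
    D.act l (a * b) f = D.act l a (D.act l b f) :=
  mul_smul a b (show D.CellModule l from f)

/-- The element of `A` with the coefficients `f s * g t` at `C l s t`. -/
def tensor (D : CellDatum 𝕜 A Λ) (l : Λ) :
    (D.T l → 𝕜) →ₗ[𝕜] (D.T l → 𝕜) →ₗ[𝕜] A :=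
  LinearMap.mk₂ 𝕜 (fun f g => ∑ s, ∑ t, (f s * g t) • D.C l s t)
    (fun f f' g => by simp [add_mul, add_smul, Finset.sum_add_distrib])
    (fun c f g => by simp [Finset.smul_sum, smul_smul, mul_assoc])
    (fun f g g' => by simp [mul_add, add_smul, Finset.sum_add_distrib])
    (fun c f g => by simp [Finset.smul_sum, smul_smul, mul_left_comm])

theorem tensor_apply (D : CellDatum 𝕜 A Λ) (l : Λ) (f g : D.T l → 𝕜) :
    D.tensor l f g = ∑ s, ∑ t, (f s * g t) • D.C l s t := rfl

theorem tensor_single (D : CellDatum 𝕜 A Λ) (l : Λ) [DecidableEq (D.T l)] (s t : D.T l) :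
    D.tensor l (Pi.single s 1) (Pi.single t 1) = D.C l s t := by
  rw [tensor_apply, Finset.sum_eq_single s, Finset.sum_eq_single t] <;>
    simp +contextual [Pi.single_apply]

theorem star_tensor (D : CellDatum 𝕜 A Λ) (l : Λ) (f g : D.T l → 𝕜) :
    D.star (D.tensor l f g) = D.tensor l g f := by
  simp only [tensor_apply, map_sum, map_smul, D.star_C]
  rw [Finset.sum_comm]
  simp only [mul_comm]

theorem mul_tensor (D : CellDatum 𝕜 A Λ) (l : Λ) (a : A) (f g : D.T l → 𝕜) :
    a * D.tensor l f g - D.tensor l (D.act l a f) g ∈ D.higher l := by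
  have h : ∑ s, ∑ t, (f s * g t) • (a * D.C l s t - ∑ u, D.r l a s u • D.C l u t) ∈ D.higher l :=
    sum_mem fun s _ => sum_mem fun t _ => Submodule.smul_mem _ _ (D.mul_C' l a s t)
  convert h using 1
  simp only [tensor_apply, smul_sub, Finset.sum_sub_distrib, Finset.mul_sum, mul_smul_comm, act,
    LinearMap.coe_mk, AddHom.coe_mk, Finset.smul_sum, smul_smul, Finset.sum_mul, Finset.sum_smul]
  congr 1
  rw [Finset.sum_comm]
  conv_rhs => rw [Finset.sum_comm]
  refine Finset.sum_congr rfl fun t _ => ?_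
  rw [Finset.sum_comm]
  refine Finset.sum_congr rfl fun s _ => Finset.sum_congr rfl fun u _ => ?_
  ring_nf

theorem tensor_mul (D : CellDatum 𝕜 A Λ) (l : Λ) (a : A) (f g : D.T l → 𝕜) :
    D.tensor l f g * a - D.tensor l f (D.act l (D.star a) g) ∈ D.higher l := by
  have h := D.star_higher _ _ (D.mul_tensor l (D.star a) g f)
  rwa [map_sub, D.star_mul, D.star_star, D.star_tensor, D.star_tensor] at h

theorem repr_tensor (D : CellDatum 𝕜 A Λ) (l : Λ) (f g : D.T l → 𝕜) (u v : D.T l) :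
    D.basis.repr (D.tensor l f g) ⟨l, (u, v)⟩ = f u * g v := by
  classical
  simp only [tensor_apply, map_sum, map_smul, ← D.basis_apply, Module.Basis.repr_self,
    Finsupp.finsetSum_apply, Finsupp.smul_apply, smul_eq_mul]
  rw [Finset.sum_eq_single u, Finset.sum_eq_single v]
  · simp
  · intro t _ ht
    rw [Finsupp.single_eq_of_ne, mul_zero]
    simpa using ht.symm
  · simp
  · intro s _ hs
    refine Finset.sum_eq_zero fun t _ => ?_
    rw [Finsupp.single_eq_of_ne, mul_zero]
    simp [hs.symm]
  · simp

theorem repr_C_of_not_le (D : CellDatum 𝕜 A Λ) {l m : Λ} (h : ¬ l ≤ m) (x : A)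
    (hx : x ∈ Submodule.span 𝕜 {x | ∃ n, l ≤ n ∧ ∃ u v, x = D.C n u v}) (p : D.T m × D.T m) :
    D.basis.repr x ⟨m, p⟩ = 0 := by
  induction hx using Submodule.span_induction with
  | mem x hx =>
    obtain ⟨n, hn, u, v, rfl⟩ := hx
    rw [← D.basis_apply, Module.Basis.repr_self, Finsupp.single_eq_of_ne]
    rintro ⟨rfl⟩
    exact h hn
  | zero => simp
  | add x y _ _ hx hy => simp [hx, hy]
  | smul c x _ hx => simp [hx]

end

end CellDatum

section Corner

variable {𝕜 A : Type} [Field 𝕜] [Ring A] [Algebra 𝕜 A] {e : A}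

/-- The projection `a ↦ e a e` onto the idempotent truncation. -/
def toCorner (𝕜 : Type) {A : Type} [Field 𝕜] [Ring A] [Algebra 𝕜 A] {e : A}
    (he : IsIdempotentElem e) : A →ₗ[𝕜] he.Corner where
  toFun a := ⟨e * a * e, (Subsemigroup.mem_corner_iff he).2
    ⟨by rw [← mul_assoc, ← mul_assoc, he.eq], by rw [mul_assoc, he.eq]⟩⟩
  map_add' a b := Subtype.ext (by
    change e * (a + b) * e = e * a * e + e * b * e
    rw [mul_add, add_mul])
  map_smul' c a := Subtype.ext (by
    change e * (c • a) * e = c • (e * a * e)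
    rw [mul_smul_comm, smul_mul_assoc])

/-- The inclusion of the idempotent truncation. -/
def ofCorner (𝕜 : Type) {A : Type} [Field 𝕜] [Ring A] [Algebra 𝕜 A] {e : A}
    (he : IsIdempotentElem e) : he.Corner →ₗ[𝕜] A where
  toFun a := a.1
  map_add' _ _ := rfl
  map_smul' _ _ := rfl

theorem toCorner_ofCorner (he : IsIdempotentElem e) (a : he.Corner) :
    toCorner 𝕜 he (ofCorner 𝕜 he a) = a := by
  refine Subtype.ext ?_
  have h := (Subsemigroup.mem_corner_iff he).1 a.2
  change e * a.1 * e = a.1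
  rw [h.1, h.2]

theorem toCorner_mul_mul (he : IsIdempotentElem e) (a : A) :
    toCorner 𝕜 he (e * a * e) = toCorner 𝕜 he a := toCorner_ofCorner he (toCorner 𝕜 he a)

theorem mul_toCorner (he : IsIdempotentElem e) (x : he.Corner) (a : A) :
    x * toCorner 𝕜 he a = toCorner 𝕜 he (x.1 * a) := by
  refine Subtype.ext ?_
  have h := (Subsemigroup.mem_corner_iff he).1 x.2
  change x.1 * (e * a * e) = e * (x.1 * a) * e
  rw [← mul_assoc, ← mul_assoc, h.2, ← mul_assoc, h.1]

end Corner

/-! ### The cellular basis of a truncated algebra -/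

namespace CellDatum

section

variable {𝕜 A Λ : Type} [Field 𝕜] [Ring A] [Algebra 𝕜 A] [PartialOrder Λ] {e : A}

/-- The truncation of a cell module, as a space of families of coefficients. -/
def truncSpace (D : CellDatum 𝕜 A Λ) (e : A) (l : Λ) : Submodule 𝕜 (D.T l → 𝕜) :=
  LinearMap.range (D.act l e)

theorem act_truncSpace (D : CellDatum 𝕜 A Λ) (he : IsIdempotentElem e) (l : Λ)
    (f : D.T l → 𝕜) (hf : f ∈ D.truncSpace e l) : D.act l e f = f := by
  obtain ⟨g, rfl⟩ := hf
  rw [← act_mul, he.eq]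

/-- A basis of the truncation of a cell module. -/
noncomputable def truncBasis (D : CellDatum 𝕜 A Λ) (e : A) (l : Λ) :
    Module.Basis (Fin (Module.finrank 𝕜 (D.truncSpace e l))) 𝕜 (D.truncSpace e l) :=
  Module.finBasis 𝕜 _

/-- The elements of the idempotent truncation that form its cellular basis. -/
noncomputable def cornerC (D : CellDatum 𝕜 A Λ) (he : IsIdempotentElem e) (l : Λ)
    (s t : Fin (Module.finrank 𝕜 (D.truncSpace e l))) : he.Corner :=
  toCorner 𝕜 he (D.tensor l (D.truncBasis e l s) (D.truncBasis e l t))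

theorem toCorner_tensor_mem (D : CellDatum 𝕜 A Λ) (he : IsIdempotentElem e) (l : Λ)
    (f g : D.T l → 𝕜) (hf : f ∈ D.truncSpace e l) (hg : g ∈ D.truncSpace e l) :
    toCorner 𝕜 he (D.tensor l f g) ∈
      Submodule.span 𝕜 {x | ∃ u v, x = D.cornerC he l u v} := by
  have h1 := congrArg Subtype.val ((D.truncBasis e l).sum_repr ⟨f, hf⟩)
  have h2 := congrArg Subtype.val ((D.truncBasis e l).sum_repr ⟨g, hg⟩)
  simp only [Submodule.coe_sum, Submodule.coe_smul] at h1 h2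
  rw [← h1, ← h2]
  simp only [map_sum, map_smul, LinearMap.sum_apply, LinearMap.smul_apply]
  refine sum_mem fun u _ => Submodule.smul_mem _ _ (sum_mem fun v _ => Submodule.smul_mem _ _ ?_)
  exact Submodule.subset_span ⟨_, _, rfl⟩

/-- Left multiplication by e acts on the first factor, and right multiplication acts through the
image of e under the anti-automorphism, which is e again, on the second. The error of the first step
stays in the ideal when multiplied by e on the right. -/
theorem mul_tensor_mul (D : CellDatum 𝕜 A Λ) (hs : D.star e = e) (l : Λ) (f g : D.T l → 𝕜) :
    e * D.tensor l f g * e - D.tensor l (D.act l e f) (D.act l e g) ∈ D.higher l := by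
  have h1 := D.higher_mul l e _ (D.mul_tensor l e f g)
  have h2 := D.tensor_mul l e (D.act l e f) g
  rw [hs] at h2
  have := add_mem h1 h2
  rwa [sub_mul, sub_add_sub_cancel] at this

/-- Descending induction on the index: modulo larger indices eCe is a tensor of two vectors of eV,
which expands in the chosen basis of eV. -/
theorem toCorner_C_mem [WellFoundedGT Λ] (D : CellDatum 𝕜 A Λ) (he : IsIdempotentElem e)
    (hs : D.star e = e) (l : Λ) (s t : D.T l) :
    toCorner 𝕜 he (D.C l s t) ∈
      Submodule.span 𝕜 {x | ∃ m, l ≤ m ∧ ∃ u v, x = D.cornerC he m u v} := by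
  classical
  induction l using WellFoundedGT.induction with
  | ind l ih =>
  rw [← D.tensor_single, ← toCorner_mul_mul, ← sub_add_cancel (e * D.tensor l _ _ * e)
    (D.tensor l (D.act l e (Pi.single s 1)) (D.act l e (Pi.single t 1))), map_add]
  refine add_mem ?_ ?_
  · have := D.mul_tensor_mul hs l (Pi.single s 1) (Pi.single t 1)
    revert this
    generalize e * D.tensor l _ _ * e - _ = x
    intro hx
    induction hx using Submodule.span_induction with
    | mem x hx =>
      obtain ⟨m, hm, u, v, rfl⟩ := hx
      refine Submodule.span_mono ?_ (ih m hm u v)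
      rintro _ ⟨n, hn, u, v, rfl⟩
      exact ⟨n, hm.le.trans hn, u, v, rfl⟩
    | zero => simp
    | add x y _ _ hx hy => rw [map_add]; exact add_mem hx hy
    | smul c x _ hx => rw [map_smul]; exact Submodule.smul_mem _ _ hx
  · refine Submodule.span_mono ?_ (D.toCorner_tensor_mem he l _ _
      (LinearMap.mem_range_self _ _) (LinearMap.mem_range_self _ _))
    rintro _ ⟨u, v, rfl⟩
    exact ⟨l, le_rfl, u, v, rfl⟩

theorem toCorner_higher_mem [WellFoundedGT Λ] (D : CellDatum 𝕜 A Λ) (he : IsIdempotentElem e)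
    (hs : D.star e = e) (l : Λ) (x : A) (hx : x ∈ D.higher l) :
    toCorner 𝕜 he x ∈
      Submodule.span 𝕜 {x | ∃ m, l < m ∧ ∃ u v, x = D.cornerC he m u v} := by
  induction hx using Submodule.span_induction with
  | mem x hx =>
    obtain ⟨m, hm, u, v, rfl⟩ := hx
    refine Submodule.span_mono ?_ (D.toCorner_C_mem he hs m u v)
    rintro _ ⟨n, hn, u, v, rfl⟩
    exact ⟨n, hm.trans_le hn, u, v, rfl⟩
  | zero => simp
  | add x y _ _ hx hy => rw [map_add]; exact add_mem hx hy
  | smul c x _ hx => rw [map_smul]; exact Submodule.smul_mem _ _ hx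

theorem mem_span_cornerC [WellFoundedGT Λ] (D : CellDatum 𝕜 A Λ) (he : IsIdempotentElem e)
    (hs : D.star e = e) (x : he.Corner) :
    x ∈ Submodule.span 𝕜 (Set.range fun i : Σ l, Fin (Module.finrank 𝕜 (D.truncSpace e l)) ×
      Fin (Module.finrank 𝕜 (D.truncSpace e l)) => D.cornerC he i.1 i.2.1 i.2.2) := by
  rw [← toCorner_ofCorner (𝕜 := 𝕜) he x]
  generalize ofCorner 𝕜 he x = a
  have ha := D.basis.mem_span a
  induction ha using Submodule.span_induction with
  | mem x hx =>
    obtain ⟨⟨l, s, t⟩, rfl⟩ := hx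
    rw [D.basis_apply]
    refine Submodule.span_mono ?_ (D.toCorner_C_mem he hs l s t)
    rintro _ ⟨m, -, u, v, rfl⟩
    exact ⟨⟨m, u, v⟩, rfl⟩
  | zero => simp
  | add x y _ _ hx hy => rw [map_add]; exact add_mem hx hy
  | smul c x _ hx => rw [map_smul]; exact Submodule.smul_mem _ _ hx

theorem higher_le_span (D : CellDatum 𝕜 A Λ) (l : Λ) :
    D.higher l ≤ Submodule.span 𝕜 {x | ∃ n, l ≤ n ∧ ∃ u v, x = D.C n u v} := by
  refine Submodule.span_mono ?_
  rintro _ ⟨n, hn, u, v, rfl⟩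
  exact ⟨n, hn.le, u, v, rfl⟩

theorem tensor_mem_span (D : CellDatum 𝕜 A Λ) (l : Λ) (f g : D.T l → 𝕜) :
    D.tensor l f g ∈ Submodule.span 𝕜 {x | ∃ n, l ≤ n ∧ ∃ u v, x = D.C n u v} :=
  sum_mem fun s _ => sum_mem fun t _ => Submodule.smul_mem _ _
    (Submodule.subset_span ⟨l, le_rfl, s, t, rfl⟩)

theorem cornerC_sub_mem (D : CellDatum 𝕜 A Λ) (he : IsIdempotentElem e) (hs : D.star e = e)
    (l : Λ) (s t : Fin (Module.finrank 𝕜 (D.truncSpace e l))) :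
    (D.cornerC he l s t).1 - D.tensor l (D.truncBasis e l s) (D.truncBasis e l t) ∈
      D.higher l := by
  have h := D.mul_tensor_mul hs l (D.truncBasis e l s) (D.truncBasis e l t)
  rwa [D.act_truncSpace he l _ (D.truncBasis e l s).2,
    D.act_truncSpace he l _ (D.truncBasis e l t).2] at h

/-- In a relation, take an index l minimal among those that occur. The coefficients at the original
basis elements of index l see only the terms with this l, and there each element agrees with the
tensor b_s ⊗ b_t. -/
theorem linearIndependent_cornerC (D : CellDatum 𝕜 A Λ) (he : IsIdempotentElem e)
    (hs : D.star e = e) :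
    LinearIndependent 𝕜 fun i : Σ l, Fin (Module.finrank 𝕜 (D.truncSpace e l)) ×
      Fin (Module.finrank 𝕜 (D.truncSpace e l)) => D.cornerC he i.1 i.2.1 i.2.2 := by
  classical
  rw [linearIndependent_iff']
  intro S c hc i hi
  by_contra hci
  obtain ⟨i₀, hi₀⟩ := (S.filter fun i => c i ≠ 0).exists_minimalFor Sigma.fst
    ⟨i, by simp [hi, hci]⟩
  obtain ⟨h1, h2⟩ := Finset.mem_filter.1 hi₀.1
  obtain ⟨l, s₀, t₀⟩ := i₀
  have hc' : ∑ i ∈ S, c i • (D.cornerC he i.1 i.2.1 i.2.2).1 = 0 := by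
    have := congrArg (ofCorner 𝕜 he) hc
    rw [map_sum, map_zero] at this
    simp only [map_smul] at this
    exact this
  have hrepr : ∀ u v : D.T l, ∑ i ∈ S, c i * D.basis.repr (D.cornerC he i.1 i.2.1 i.2.2).1
      ⟨l, (u, v)⟩ = 0 := by
    intro u v
    have := congrArg (fun x => D.basis.repr x ⟨l, (u, v)⟩) hc'
    simpa [map_sum, Finsupp.finsetSum_apply] using this
  set b := D.truncBasis e l with hb
  -- The sum over p selects the tensor when i has index l and is zero otherwise. A term of another
  -- index m contributes nothing, since it lives in indices at least m and minimality excludes m ≤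
  -- l.
  have hterm : ∀ i ∈ S, ∀ u v : D.T l,
      c i * D.basis.repr (D.cornerC he i.1 i.2.1 i.2.2).1 ⟨l, (u, v)⟩ =
      ∑ p : Fin (Module.finrank 𝕜 (D.truncSpace e l)) ×
        Fin (Module.finrank 𝕜 (D.truncSpace e l)),
        if i = ⟨l, p⟩ then c i * ((b p.1).1 u * (b p.2).1 v) else 0 := by
    rintro ⟨m, s, t⟩ hiS u v
    by_cases hml : m = l
    · subst hml
      rw [Finset.sum_eq_single (s, t)]
      · have h := D.repr_higher m _ (D.cornerC_sub_mem he hs m s t) u v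
        rw [map_sub, Finsupp.sub_apply, D.repr_tensor, sub_eq_zero] at h
        simp [h, hb]
      · intro p _ hp
        rw [if_neg]
        rintro ⟨⟩
        exact hp rfl
      · simp
    · rw [Finset.sum_eq_zero]
      · by_cases hci : c ⟨m, s, t⟩ = 0
        · rw [hci, zero_mul]
        · rw [D.repr_C_of_not_le (l := m), mul_zero]
          · intro hle
            exact hml (le_antisymm hle (hi₀.2 (j := ⟨m, s, t⟩) (by simp [hiS, hci]) hle))
          · rw [← sub_add_cancel (D.cornerC he m s t).1
              (D.tensor m (D.truncBasis e m s) (D.truncBasis e m t))]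
            exact add_mem (D.higher_le_span m (D.cornerC_sub_mem he hs m s t))
              (D.tensor_mem_span m _ _)
      · intro p _
        rw [if_neg]
        rintro ⟨⟩
        exact hml rfl
  have hsum : ∀ u v : D.T l, ∑ p : Fin (Module.finrank 𝕜 (D.truncSpace e l)) ×
        Fin (Module.finrank 𝕜 (D.truncSpace e l)),
        (if (⟨l, p⟩ : Σ l, Fin (Module.finrank 𝕜 (D.truncSpace e l)) ×
          Fin (Module.finrank 𝕜 (D.truncSpace e l))) ∈ S then c ⟨l, p⟩ else 0) * ((b p.1).1 u * (b p.2).1 v) = 0 := by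
    intro u v
    refine Eq.trans ?_ (hrepr u v)
    rw [Finset.sum_congr rfl fun i hi => hterm i hi u v, Finset.sum_comm]
    refine Finset.sum_congr rfl fun p _ => ?_
    rw [Finset.sum_ite_eq' S _ (fun i => c i * ((b p.1).1 u * (b p.2).1 v))]
    split_ifs <;> simp
  set d : Fin (Module.finrank 𝕜 (D.truncSpace e l)) →
    Fin (Module.finrank 𝕜 (D.truncSpace e l)) → 𝕜 :=
    fun s t => if (⟨l, (s, t)⟩ : Σ l, Fin (Module.finrank 𝕜 (D.truncSpace e l)) ×
      Fin (Module.finrank 𝕜 (D.truncSpace e l))) ∈ S then c ⟨l, (s, t)⟩ else 0 with hd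
  -- Independence of the b_s ⊗ b_t is reduced to that of the b_s, used once in each tensor factor.
  have hli := Fintype.linearIndependent_iff.1 b.linearIndependent
  have h3 : ∀ v : D.T l, ∀ s, ∑ t, d s t * (b t).1 v = 0 := by
    intro v
    refine hli (fun s => ∑ t, d s t * (b t).1 v) ?_
    refine Subtype.ext (funext fun u => ?_)
    have := hsum u v
    rw [Fintype.sum_prod_type] at this
    simp only [Submodule.coe_sum, Submodule.coe_smul, Finset.sum_apply, Pi.smul_apply,
      smul_eq_mul, ZeroMemClass.coe_zero, Pi.zero_apply]
    rw [← this]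
    refine Finset.sum_congr rfl fun s _ => ?_
    rw [Finset.sum_mul]
    refine Finset.sum_congr rfl fun t _ => ?_
    simp only [hd]
    ring
  have h4 := hli (d s₀) (by
    refine Subtype.ext (funext fun v => ?_)
    simpa using h3 v s₀) t₀
  simp only [hd, if_pos h1] at h4
  exact h2 h4

/-- The action of the truncation on the coefficients with respect to the truncated basis. -/
noncomputable def cornerR (D : CellDatum 𝕜 A Λ) (he : IsIdempotentElem e) (l : Λ)
    (x : he.Corner) (s u : Fin (Module.finrank 𝕜 (D.truncSpace e l))) : 𝕜 :=
  (D.truncBasis e l).repr ⟨D.act l x.1 (D.truncBasis e l s), by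
    refine ⟨D.act l x.1 (D.truncBasis e l s), ?_⟩
    rw [← act_mul, ((Subsemigroup.mem_corner_iff he).1 x.2).1]⟩ u

theorem sum_cornerR (D : CellDatum 𝕜 A Λ) (he : IsIdempotentElem e) (l : Λ)
    (x : he.Corner) (s : Fin (Module.finrank 𝕜 (D.truncSpace e l))) :
    ∑ u, D.cornerR he l x s u • (D.truncBasis e l u).1 = D.act l x.1 (D.truncBasis e l s) := by
  have h := congrArg Subtype.val ((D.truncBasis e l).sum_repr
    ⟨D.act l x.1 (D.truncBasis e l s), by
      refine ⟨D.act l x.1 (D.truncBasis e l s), ?_⟩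
      rw [← act_mul, ((Subsemigroup.mem_corner_iff he).1 x.2).1]⟩)
  rw [Submodule.coe_sum] at h
  exact h

/-- The cell datum of the idempotent truncation of a cellular algebra at an idempotent that is
fixed by the anti-automorphism. -/
noncomputable def corner [WellFoundedGT Λ] (D : CellDatum 𝕜 A Λ) (he : IsIdempotentElem e)
    (hs : D.star e = e) : CellDatum 𝕜 he.Corner Λ where
  T l := Fin (Module.finrank 𝕜 (D.truncSpace e l))
  C l s t := D.cornerC he l s t
  basis := Module.Basis.mk (D.linearIndependent_cornerC he hs)
    (fun x _ => D.mem_span_cornerC he hs x)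
  basis_apply l s t := by simp
  star := LinearEquiv.ofInvolutive
    { toFun := fun x => ⟨D.star x.1, by
        have h := (Subsemigroup.mem_corner_iff he).1 x.2
        refine (Subsemigroup.mem_corner_iff he).2 ⟨?_, ?_⟩
        · have h2 := D.star_mul x.1 e
          rw [hs, h.2] at h2
          exact h2.symm
        · have h1 := D.star_mul e x.1
          rw [hs, h.1] at h1
          exact h1.symm⟩
      map_add' := fun x y => Subtype.ext (map_add D.star x.1 y.1)
      map_smul' := fun c x => Subtype.ext (map_smul D.star c x.1) }
    (fun x => Subtype.ext (D.star_star x.1))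
  star_C l s t := Subtype.ext (by
    change D.star (e * D.tensor l _ _ * e) = e * D.tensor l _ _ * e
    rw [D.star_mul, D.star_mul, hs, D.star_tensor, mul_assoc])
  star_mul a b := Subtype.ext (D.star_mul a.1 b.1)
  r l x s u := D.cornerR he l x s u
  mul_C l x s t := by
    have h : x * D.cornerC he l s t - ∑ u, D.cornerR he l x s u • D.cornerC he l u t =
        toCorner 𝕜 he (x.1 * D.tensor l (D.truncBasis e l s) (D.truncBasis e l t) -
          D.tensor l (D.act l x.1 (D.truncBasis e l s)) (D.truncBasis e l t)) := by
      rw [map_sub, ← mul_toCorner, ← D.sum_cornerR]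
      simp only [map_sum, map_smul, LinearMap.sum_apply, LinearMap.smul_apply]
      rfl
    rw [h]
    exact D.toCorner_higher_mem he hs l _ (D.mul_tensor l _ _ _)

/-- The cell modules of the idempotent truncation are the truncations of the cell modules. -/
theorem nonempty_cellModule_corner [WellFoundedGT Λ] (D : CellDatum 𝕜 A Λ)
    (he : IsIdempotentElem e) (hs : D.star e = e) (l : Λ) :
    Nonempty ((D.corner he hs).CellModule l ≃ₗ[he.Corner] Truncation he (D.CellModule l)) := by
  let b := D.truncBasis e l
  let φ : (D.corner he hs).CellModule l →ₗ[he.Corner] Truncation he (D.CellModule l) :=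
    { toFun := fun f => ⟨(b.equivFun.symm f).1, (b.equivFun.symm f).2⟩
      map_add' := fun f g => Subtype.ext (congrArg Subtype.val (map_add b.equivFun.symm f g))
      map_smul' := fun x f => by
        refine Subtype.ext ?_
        change (b.equivFun.symm (x • f)).1 = D.act l x.1 (b.equivFun.symm f).1
        have hb : ∀ g : Fin (Module.finrank 𝕜 (D.truncSpace e l)) → 𝕜,
            (b.equivFun.symm g).1 = ∑ u, g u • (b u).1 := by
          intro g
          rw [Module.Basis.equivFun_symm_apply, Submodule.coe_sum]
          rfl
        refine (hb _).trans (Eq.trans ?_ (congrArg (D.act l x.1) (hb _).symm))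
        rw [map_sum]
        simp only [map_smul]
        change ∑ u, (∑ s, f s * D.cornerR he l x s u) • (b u).1 = _
        simp only [Finset.sum_smul, mul_smul]
        rw [Finset.sum_comm]
        refine Finset.sum_congr rfl fun s _ => ?_
        rw [← Finset.smul_sum]
        exact congrArg _ (D.sum_cornerR he l x s) }
  refine ⟨LinearEquiv.ofBijective φ ⟨?_, ?_⟩⟩
  · intro f g h
    refine b.equivFun.symm.injective (Subtype.ext ?_)
    exact congrArg Subtype.val h
  · rintro ⟨x, hx⟩
    refine ⟨b.equivFun ⟨x, hx⟩, Subtype.ext ?_⟩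
    change (b.equivFun.symm (b.equivFun ⟨x, hx⟩)).1 = x
    rw [LinearEquiv.symm_apply_apply]

end

end CellDatum

/-! ### Transport of truncations, and cell modules as columns of the algebra -/

section Truncation

variable {A M N : Type} [Ring A] {e : A} [AddCommGroup M] [Module A M] [AddCommGroup N]
  [Module A N]

/-- Isomorphic modules have isomorphic truncations. -/
theorem Truncation.nonempty_congr (he : IsIdempotentElem e) (f : M ≃ₗ[A] N) :
    Nonempty (Truncation he M ≃ₗ[he.Corner] Truncation he N) := by
  let φ : Truncation he M →ₗ[he.Corner] Truncation he N :=
    { toFun := fun x => ⟨f x.1, by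
        obtain ⟨_, y, rfl⟩ := x
        exact ⟨f y, (map_smul f e y).symm⟩⟩
      map_add' := fun x y => Subtype.ext (map_add f x.1 y.1)
      map_smul' := fun a x => Subtype.ext (map_smul f a.1 x.1) }
  refine ⟨LinearEquiv.ofBijective φ ⟨?_, ?_⟩⟩
  · intro x y h
    exact Subtype.ext (f.injective (congrArg Subtype.val h))
  · rintro ⟨_, y, rfl⟩
    refine ⟨⟨e • f.symm y, f.symm y, rfl⟩, Subtype.ext ?_⟩
    change f (e • f.symm y) = e • y
    rw [map_smul, f.apply_symm_apply]

end Truncation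

namespace CellDatum

variable {𝕜 A Λ : Type} [Field 𝕜] [Ring A] [Algebra 𝕜 A] [PartialOrder Λ]

/-- The cell module is the submodule of a quotient of the algebra that is generated by a column of
the cellular basis. -/
theorem nonempty_cellModule_equiv (D : CellDatum 𝕜 A Λ) (l : Λ) (t : D.T l)
    (I : Submodule A A) (hI : ∀ x, x ∈ I ↔ x ∈ D.higher l) :
    Nonempty (D.CellModule l ≃ₗ[A]
      (Submodule.span A {x | ∃ s, x = I.mkQ (D.C l s t)} : Submodule A (A ⧸ I))) := by
  classical
  let φ : D.CellModule l →ₗ[A] A ⧸ I :=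
    { toFun := fun f => I.mkQ (D.tensor l f (Pi.single t 1))
      map_add' := fun f g => by
        rw [show D.tensor l (f + g) = D.tensor l f + D.tensor l g from map_add _ _ _,
          LinearMap.add_apply, map_add]
      map_smul' := fun a f => by
        rw [RingHom.id_apply, ← map_smul, smul_eq_mul]
        refine ((Submodule.Quotient.eq I).2 ?_).symm
        rw [hI]
        exact D.mul_tensor l a f _ }
  have hsingle : ∀ s, φ (Pi.single s 1 : D.T l → 𝕜) = I.mkQ (D.C l s t) := by
    intro s
    change I.mkQ (D.tensor l _ _) = _
    rw [D.tensor_single]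
  have hrange : LinearMap.range φ = Submodule.span A {x | ∃ s, x = I.mkQ (D.C l s t)} := by
    apply le_antisymm
    · rintro _ ⟨f, rfl⟩
      change I.mkQ (D.tensor l f (Pi.single t 1)) ∈ _
      have : D.tensor l f (Pi.single t 1) = ∑ s, algebraMap 𝕜 A (f s) • D.C l s t := by
        refine (D.tensor_apply l _ _).trans (Finset.sum_congr rfl fun s _ => ?_)
        rw [Finset.sum_eq_single t] <;> simp +contextual [Algebra.smul_def]
      rw [this, map_sum]
      refine sum_mem fun s _ => ?_
      rw [map_smul]
      exact Submodule.smul_mem _ _ (Submodule.subset_span ⟨s, rfl⟩)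
    · refine Submodule.span_le.2 ?_
      rintro _ ⟨s, rfl⟩
      exact ⟨_, hsingle s⟩
  -- The value of f at u is the coefficient at `C l u t`, and elements of the ideal have no such
  -- coefficient.
  have hinj : Function.Injective φ := by
    rw [← LinearMap.ker_eq_bot, LinearMap.ker_eq_bot']
    intro f hf
    have h : D.tensor l f (Pi.single t 1) ∈ D.higher l :=
      (hI _).1 ((Submodule.Quotient.mk_eq_zero I).1 hf)
    funext u
    have := (D.repr_tensor l f (Pi.single t 1) u t).symm.trans (D.repr_higher l _ h u t)
    rwa [Pi.single_eq_same, mul_one] at this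
  exact ⟨(LinearEquiv.ofInjective φ hinj).trans (LinearEquiv.ofEq _ _ hrange)⟩

end CellDatum

open Equiv (Perm)

/-! ## Fillings of Young diagrams -/

/-- Bijective fillings of the Young diagram `l` with the elements of `Fin n`. -/
abbrev Filling (l : YoungDiagram) (n : ℕ) : Type := {c // c ∈ l.cells} ≃ Fin n

namespace Filling

variable {l : YoungDiagram} {n : ℕ}

/-- The row of the cell that contains an entry. -/
def row (s : Filling l n) (x : Fin n) : ℕ := (s.symm x).1.1

/-- The column of the cell that contains an entry. -/
def col (s : Filling l n) (x : Fin n) : ℕ := (s.symm x).1.2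

/-- The entries increase along the rows. -/
def RowIncreasing (s : Filling l n) : Prop :=
  ∀ c c' : {c // c ∈ l.cells}, c.1.1 = c'.1.1 → c.1.2 < c'.1.2 → s c < s c'

/-- The entries increase along the rows and down the columns. -/
def IsStd (s : Filling l n) : Prop :=
  s.RowIncreasing ∧
  (∀ c c' : {c // c ∈ l.cells}, c.1.2 = c'.1.2 → c.1.1 < c'.1.1 → s c < s c')

theorem mem (s : Filling l n) (x : Fin n) : (s.row x, s.col x) ∈ l := (s.symm x).2

theorem row_apply (s : Filling l n) (c : {c // c ∈ l.cells}) : s.row (s c) = c.1.1 := by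
  simp [row]

theorem col_apply (s : Filling l n) (c : {c // c ∈ l.cells}) : s.col (s c) = c.1.2 := by
  simp [col]

theorem ext_row_col (s : Filling l n) {x y : Fin n} (h : s.row x = s.row y)
    (h' : s.col x = s.col y) : x = y :=
  s.symm.injective (Subtype.ext (Prod.ext h h'))

theorem exists_of_mem (s : Filling l n) {i j : ℕ} (h : (i, j) ∈ l) :
    ∃ x, s.row x = i ∧ s.col x = j :=
  ⟨s ⟨(i, j), h⟩, s.row_apply _, s.col_apply _⟩

theorem lt_of_row_eq {s : Filling l n} (hs : s.RowIncreasing) {x y : Fin n}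
    (h : s.row x = s.row y) (h' : s.col x < s.col y) : x < y := by
  have := hs (s.symm x) (s.symm y) h h'
  simpa using this

theorem lt_of_col_eq {s : Filling l n} (hs : s.IsStd) {x y : Fin n}
    (h : s.col x = s.col y) (h' : s.row x < s.row y) : x < y := by
  have := hs.2 (s.symm x) (s.symm y) h h'
  simpa using this

theorem card_row_eq (s : Filling l n) (i : ℕ) :
    (Finset.univ.filter fun x => s.row x = i).card = l.rowLen i := by
  rw [← Finset.card_range (l.rowLen i)]
  refine Finset.card_bij (fun x _ => s.col x) ?_ ?_ ?_
  · intro x hx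
    have := s.mem x
    rw [(Finset.mem_filter.1 hx).2, YoungDiagram.mem_iff_lt_rowLen] at this
    simpa using this
  · intro x hx y hy h
    exact s.ext_row_col ((Finset.mem_filter.1 hx).2.trans (Finset.mem_filter.1 hy).2.symm) h
  · intro j hj
    rw [Finset.mem_range, ← YoungDiagram.mem_iff_lt_rowLen] at hj
    obtain ⟨x, h1, h2⟩ := s.exists_of_mem hj
    exact ⟨x, by simp [h1], h2⟩

theorem card_row_lt (s : Filling l n) (i : ℕ) :
    (Finset.univ.filter fun x => s.row x < i).card = ∑ j ∈ Finset.range i, l.rowLen j := by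
  rw [Finset.card_eq_sum_card_fiberwise (f := s.row) (t := Finset.range i)]
  · refine Finset.sum_congr rfl fun j hj => ?_
    rw [← s.card_row_eq j, Finset.filter_filter]
    congr 1
    ext x
    simp only [Finset.mem_filter, Finset.mem_univ, true_and]
    rw [Finset.mem_range] at hj
    constructor
    · exact fun h => h.2
    · intro h; exact ⟨h ▸ hj, h⟩
  · intro x hx
    simpa using hx

/-- Rows are left-justified, so the cells to the left of x hold exactly the smaller entries of its
row. Hence a row-increasing filling is determined by its function `row`. -/
theorem col_eq_card {s : Filling l n} (hs : s.RowIncreasing) (x : Fin n) :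
    s.col x = (Finset.univ.filter fun y => y < x ∧ s.row y = s.row x).card := by
  rw [← Finset.card_range (s.col x)]
  symm
  refine Finset.card_bij (fun y _ => s.col y) ?_ ?_ ?_
  · intro y hy
    simp only [Finset.mem_filter, Finset.mem_univ, true_and] at hy
    rw [Finset.mem_range]
    by_contra h
    rcases (not_lt.1 h).lt_or_eq with h | h
    · exact lt_asymm hy.1 (lt_of_row_eq hs hy.2.symm h)
    · exact hy.1.ne (s.ext_row_col hy.2 h.symm)
  · intro y hy z hz h
    simp only [Finset.mem_filter, Finset.mem_univ, true_and] at hy hz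
    exact s.ext_row_col (hy.2.trans hz.2.symm) h
  · intro j hj
    rw [Finset.mem_range] at hj
    obtain ⟨y, h1, h2⟩ := s.exists_of_mem (l.up_left_mem le_rfl hj.le (s.mem x))
    refine ⟨y, ?_, h2⟩
    simp only [Finset.mem_filter, Finset.mem_univ, true_and]
    exact ⟨lt_of_row_eq hs h1 (h2 ▸ hj), h1⟩

theorem shape_eq_of_row_eq {m : YoungDiagram} {s : Filling l n} {s' : Filling m n}
    (h : s.row = s'.row) : l = m := by
  refine SetLike.ext ?_
  rintro ⟨i, j⟩
  rw [YoungDiagram.mem_iff_lt_rowLen, YoungDiagram.mem_iff_lt_rowLen, ← s.card_row_eq,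
    ← s'.card_row_eq, h]

theorem eq_of_row_eq {s s' : Filling l n} (hs : s.RowIncreasing) (hs' : s'.RowIncreasing)
    (h : s.row = s'.row) : s = s' := by
  rw [← Equiv.symm_bijective.injective.eq_iff]
  ext x : 2
  refine Prod.ext (congrFun h x) ?_
  change s.col x = s'.col x
  rw [col_eq_card hs, col_eq_card hs', h]

/-- A filling whose rows are the fibres of a given function, and which increases along rows. -/
theorem exists_row_eq (f : Fin n → ℕ)
    (hf : ∀ i, (Finset.univ.filter fun x => f x = i).card = l.rowLen i) :
    ∃ s : Filling l n, s.row = f ∧ s.RowIncreasing := by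
  -- The column of x must be its rank within its fibre, as in `col_eq_card`.
  let g : Fin n → ℕ := fun x => (Finset.univ.filter fun y => y < x ∧ f y = f x).card
  have hmono : ∀ x y, f x = f y → x < y → g x < g y := by
    intro x y h hxy
    refine Finset.card_lt_card (Finset.ssubset_iff_of_subset ?_ |>.2 ⟨x, ?_, ?_⟩)
    · intro z hz
      simp only [Finset.mem_filter, Finset.mem_univ, true_and] at hz ⊢
      exact ⟨hz.1.trans hxy, hz.2.trans h⟩
    · simp [hxy, h]
    · simp
  have hmem : ∀ x, (f x, g x) ∈ l.cells := by
    intro x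
    rw [YoungDiagram.mem_cells, YoungDiagram.mem_iff_lt_rowLen, ← hf]
    refine Finset.card_lt_card (Finset.ssubset_iff_of_subset ?_ |>.2 ⟨x, ?_, ?_⟩)
    · intro z hz
      simp only [Finset.mem_filter, Finset.mem_univ, true_and] at hz ⊢
      exact hz.2
    · simp
    · simp
  let F : Fin n → {c // c ∈ l.cells} := fun x => ⟨(f x, g x), hmem x⟩
  have hinj : Function.Injective F := by
    intro x y h
    have h1 : f x = f y := congrArg (fun c => c.1.1) h
    have h2 : g x = g y := congrArg (fun c => c.1.2) h
    rcases lt_trichotomy x y with hxy | hxy | hxy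
    · exact absurd h2 (hmono x y h1 hxy).ne
    · exact hxy
    · exact absurd h2.symm (hmono y x h1.symm hxy).ne
  -- Counting fibres against rows shows that there are exactly n cells, so the injection into the
  -- cells is a bijection.
  have hcard : Fintype.card (Fin n) = Fintype.card {c // c ∈ l.cells} := by
    obtain ⟨N, hN⟩ : ∃ N, ∀ x, f x < N :=
      ⟨∑ x, f x + 1, fun x => Nat.lt_succ_of_le
        (Finset.single_le_sum (f := f) (fun _ _ => Nat.zero_le _) (Finset.mem_univ x))⟩
    obtain ⟨N', hN'⟩ : ∃ N', ∀ c ∈ l.cells, c.1 < N' :=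
      ⟨∑ c ∈ l.cells, c.1 + 1, fun c hc => Nat.lt_succ_of_le
        (Finset.single_le_sum (f := Prod.fst) (fun _ _ => Nat.zero_le _) hc)⟩
    rw [Fintype.card_coe, ← Finset.card_univ,
      Finset.card_eq_sum_card_fiberwise (f := f) (t := Finset.range (N + N')),
      Finset.card_eq_sum_card_fiberwise (s := l.cells) (f := Prod.fst)
        (t := Finset.range (N + N'))]
    · refine Finset.sum_congr rfl fun i _ => ?_
      rw [hf, YoungDiagram.rowLen_eq_card]
      rfl
    · intro c hc
      have := hN' c hc
      simp only [Finset.coe_range, Set.mem_Iio]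
      omega
    · intro x _
      have := hN x
      simp only [Finset.coe_range, Set.mem_Iio]
      omega
  let E := Equiv.ofBijective F ((Fintype.bijective_iff_injective_and_card F).2 ⟨hinj, hcard⟩)
  refine ⟨E.symm, rfl, ?_⟩
  intro c c' h h'
  have hE : ∀ c, (f (E.symm c), g (E.symm c)) = c.1 := fun c =>
    congrArg Subtype.val (E.apply_symm_apply c)
  have h1 : ∀ c, f (E.symm c) = c.1.1 := fun c => congrArg Prod.fst (hE c)
  have h2 : ∀ c, g (E.symm c) = c.1.2 := fun c => congrArg Prod.snd (hE c)
  by_contra hlt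
  rcases (not_lt.1 hlt).lt_or_eq with hlt | hlt
  · have := hmono _ _ (by rw [h1, h1, h]) hlt
    rw [h2, h2] at this
    omega
  · have := E.symm.injective hlt
    rw [this] at h'
    exact lt_irrefl _ h'

/-- Within S, column c is an initial segment of a column of u. If it reaches row i, it has all i
cells above that row, and f, being injective on columns, takes at most i values below i. Otherwise
all its points are counted on the right. -/
theorem card_filter_le (u : Filling l n) (S : Finset (Fin n))
    (hS : ∀ x ∈ S, ∀ y, u.col y = u.col x → u.row y < u.row x → y ∈ S) (f : Fin n → ℕ)
    (hf : ∀ x y, f x = f y → u.col x = u.col y → x = y) (i c : ℕ) :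
    (S.filter fun x => f x < i ∧ u.col x = c).card ≤
      (S.filter fun x => u.row x < i ∧ u.col x = c).card := by
  classical
  by_cases h : ∃ x ∈ S, u.col x = c ∧ i ≤ u.row x
  · obtain ⟨x, hx, rfl, hi⟩ := h
    calc _ ≤ (Finset.range i).card := by
          refine Finset.card_le_card_of_injOn f ?_ ?_
          · intro y hy
            have := (Finset.mem_filter.1 hy).2.1
            simpa using this
          · intro y hy z hz hyz
            exact hf y z hyz ((Finset.mem_filter.1 hy).2.2.trans
              (Finset.mem_filter.1 hz).2.2.symm)
      _ ≤ ((S.filter fun y => u.row y < i ∧ u.col y = u.col x).image u.row).card := by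
          refine Finset.card_le_card fun r hr => ?_
          rw [Finset.mem_range] at hr
          obtain ⟨y, h1, h2⟩ := u.exists_of_mem (l.up_left_mem (hr.le.trans hi) le_rfl (u.mem x))
          refine Finset.mem_image.2 ⟨y, ?_, h1⟩
          rw [Finset.mem_filter]
          exact ⟨hS x hx y h2 (by omega), by omega, h2⟩
      _ ≤ _ := Finset.card_image_le
  · push Not at h
    refine Finset.card_le_card fun x hx => ?_
    rw [Finset.mem_filter] at hx ⊢
    exact ⟨hx.1, h x hx.1 hx.2.2, hx.2.2⟩

theorem card_filter_lt_eq_sum (u : Filling l n) (S : Finset (Fin n)) (f : Fin n → ℕ) (i : ℕ) :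
    (S.filter fun x => f x < i).card = ∑ c ∈ S.image u.col,
      (S.filter fun x => f x < i ∧ u.col x = c).card := by
  rw [Finset.card_eq_sum_card_fiberwise (f := u.col) (t := S.image u.col)]
  · simp only [Finset.filter_filter]
  · intro x hx
    exact Finset.mem_image_of_mem _ (Finset.mem_filter.1 hx).1

/-- If the fibres of `f` and the columns of `s` meet in at most one point, then the cells `x` with
`(f x, col x)` are the cells of the Young diagram. -/
theorem mem_of_injective (s u : Filling l n)
    (h : ∀ x y, s.row x = s.row y → u.col x = u.col y → x = y) (x : Fin n) :
    (s.row x, u.col x) ∈ l := by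
  by_contra hx
  have hle := fun c => u.card_filter_le Finset.univ (fun _ _ _ _ _ => Finset.mem_univ _) s.row h
    (s.row x) c
  -- Both totals count the cells in the rows above `s.row x`. The inequality in every column is
  -- therefore an equality. If the cell in question were outside the diagram, the whole column of x
  -- would lie above that row, and equality would put x strictly above its own row.
  have hsum := (s.card_row_lt (s.row x)).trans (u.card_row_lt (s.row x)).symm
  rw [u.card_filter_lt_eq_sum, u.card_filter_lt_eq_sum,
    Finset.sum_eq_sum_iff_of_le (fun c _ => hle c)] at hsum
  have h1 := hsum (u.col x) (Finset.mem_image_of_mem _ (Finset.mem_univ x))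
  have h2 : (Finset.univ.filter fun y => u.row y < s.row x ∧ u.col y = u.col x) =
      Finset.univ.filter fun y => u.col y = u.col x := by
    ext y
    simp only [Finset.mem_filter, Finset.mem_univ, true_and, and_iff_right_iff_imp]
    intro hy
    by_contra hlt
    exact hx (l.up_left_mem (not_lt.1 hlt) le_rfl (hy ▸ u.mem y))
  rw [h2] at h1
  have h3 := Finset.eq_of_subset_of_card_le (s := Finset.univ.filter fun y =>
    s.row y < s.row x ∧ u.col y = u.col x) (t := Finset.univ.filter fun y => u.col y = u.col x)
    (fun y hy => by
      rw [Finset.mem_filter] at hy ⊢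
      exact ⟨hy.1, hy.2.2⟩) h1.ge
  have h4 : x ∈ Finset.univ.filter fun y => u.col y = u.col x := by simp
  rw [← h3, Finset.mem_filter] at h4
  exact lt_irrefl _ h4.2.1

end Filling

/-! ### Counting functions and dominance -/

/-- The number of `x < m` with `f x < i`. -/
def countLt {n : ℕ} (f : Fin n → ℕ) : ℕ → ℕ → ℕ :=
  fun m i => (Finset.univ.filter fun x : Fin n => x.1 < m ∧ f x < i).card

/-- The count jumps between x and x + 1 exactly for those i with f x < i, so it determines f x. -/
theorem countLt_injective {n : ℕ} : Function.Injective (countLt (n := n)) := by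
  intro f g h
  have key : ∀ f : Fin n → ℕ, ∀ x i, f x < i ↔ countLt f x.1 i < countLt f (x.1 + 1) i := by
    intro f x i
    constructor
    · intro hx
      refine Finset.card_lt_card (Finset.ssubset_iff_of_subset ?_ |>.2 ⟨x, ?_, ?_⟩)
      · intro y hy
        simp only [Finset.mem_filter, Finset.mem_univ, true_and] at hy ⊢
        exact ⟨by omega, hy.2⟩
      · simp [hx]
      · simp
    · intro hlt
      by_contra hx
      refine hlt.not_ge (Finset.card_le_card fun y hy => ?_)
      simp only [Finset.mem_filter, Finset.mem_univ, true_and] at hy ⊢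
      refine ⟨?_, hy.2⟩
      have : y.1 ≠ x.1 := fun h => hx (Fin.ext h ▸ hy.2)
      omega
  funext x
  refine le_antisymm ?_ ?_
  · have := (key g x (g x + 1)).1 (Nat.lt_succ_self _)
    rw [← h] at this
    exact Nat.lt_succ_iff.1 ((key f x _).2 this)
  · have := (key f x (f x + 1)).1 (Nat.lt_succ_self _)
    rw [h] at this
    exact Nat.lt_succ_iff.1 ((key g x _).2 this)

/-- This is `card_filter_le` for S the set of entries below m, summed over the columns. Standardness
enters because entries above an element of S in its column are smaller and so lie in S. -/
theorem countLt_le {l : YoungDiagram} {n : ℕ} (u : Filling l n) (hu : u.IsStd) (f : Fin n → ℕ)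
    (hf : ∀ x y, f x = f y → u.col x = u.col y → x = y) : countLt f ≤ countLt u.row := by
  intro m i
  unfold countLt
  rw [← Finset.filter_filter, ← Finset.filter_filter, u.card_filter_lt_eq_sum,
    u.card_filter_lt_eq_sum]
  refine Finset.sum_le_sum fun c _ => u.card_filter_le _ ?_ f hf i c
  intro x hx y h1 h2
  simp only [Finset.mem_filter, Finset.mem_univ, true_and] at hx ⊢
  have : y.1 < x.1 := Filling.lt_of_col_eq hu h1 h2
  omega

/-- For m = n the counts are the partial sums of the row lengths. -/
theorem dominated_of_countLt_le {l m : YoungDiagram} {n : ℕ} (s : Filling l n) (u : Filling m n)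
    (h : countLt s.row ≤ countLt u.row) : Dominated l m := by
  intro i
  rw [← s.card_row_lt, ← u.card_row_lt]
  simpa [countLt] using h n i

/-! ## Sums of the permutations that map the rows of one filling to those of another -/

/-- The indicator function of the permutations `w` with `f ∘ w = g`. -/
def tabSum {n : ℕ} (f g : Fin n → ℕ) : Perm (Fin n) → ℂ := fun w => if f ∘ w = g then 1 else 0

/-- The signed sum of the values at the permutations `w` with `p ∘ w = q`. -/
def signedSum {n : ℕ} (p q : Fin n → ℕ) : (Perm (Fin n) → ℂ) →ₗ[ℂ] ℂ where
  toFun F := ∑ w : Perm (Fin n), (if p ∘ w = q then ((Perm.sign w : ℤ) : ℂ) else 0) * F w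
  map_add' F G := by simp [mul_add, Finset.sum_add_distrib]
  map_smul' c F := by simp [Finset.mul_sum, mul_left_comm]

theorem signedSum_apply {n : ℕ} (p q : Fin n → ℕ) (F : Perm (Fin n) → ℂ) :
    signedSum p q F = ∑ w : Perm (Fin n), (if p ∘ w = q then ((Perm.sign w : ℤ) : ℂ) else 0) * F w := rfl

theorem comp_inv_eq_iff {n : ℕ} (f g : Fin n → ℕ) (w : Perm (Fin n)) :
    f ∘ ⇑(w⁻¹) = g ↔ g ∘ w = f := by
  constructor
  · rintro rfl
    funext x
    simp
  · rintro rfl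
    funext x
    simp

theorem signedSum_tabSum_symm {n : ℕ} (p q f g : Fin n → ℕ) :
    signedSum p q (tabSum f g) = signedSum q p (tabSum g f) := by
  rw [signedSum_apply, signedSum_apply]
  refine Fintype.sum_equiv (Equiv.inv _) _ _ fun w => ?_
  simp only [Equiv.inv_apply, tabSum, comp_inv_eq_iff, Perm.sign_inv]

/-- If distinct x and y agreed under both f and p, left multiplication by their transposition would
preserve both conditions on w and reverse the sign, making the sum its own negative. -/
theorem injective_of_signedSum_ne_zero {n : ℕ} {p q f g : Fin n → ℕ}
    (h : signedSum p q (tabSum f g) ≠ 0) (x y : Fin n) (h1 : f x = f y) (h2 : p x = p y) :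
    x = y := by
  by_contra hxy
  apply h
  have hswap : ∀ f : Fin n → ℕ, f x = f y → ∀ w : Perm (Fin n),
      f ∘ ⇑(Equiv.swap x y * w) = f ∘ w := by
    intro f hf w
    funext z
    simp only [Function.comp_apply, Perm.mul_apply, Equiv.swap_apply_def]
    split_ifs with h h'
    · rw [h, hf]
    · rw [h', hf]
    · rfl
  have hneg : signedSum p q (tabSum f g) = - signedSum p q (tabSum f g) := by
    conv_lhs => rw [signedSum_apply]
    rw [signedSum_apply, ← Finset.sum_neg_distrib]
    refine Fintype.sum_equiv (Equiv.mulLeft (Equiv.swap x y)) _ _ fun w => ?_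
    simp only [Equiv.coe_mulLeft, tabSum, hswap f h1, hswap p h2, Perm.sign_mul,
      Perm.sign_swap hxy]
    split_ifs <;> simp
  exact self_eq_neg.1 hneg

theorem injective_of_signedSum_ne_zero' {n : ℕ} {p q f g : Fin n → ℕ}
    (h : signedSum p q (tabSum f g) ≠ 0) (x y : Fin n) (h1 : g x = g y) (h2 : q x = q y) :
    x = y := by
  rw [signedSum_tabSum_symm] at h
  exact injective_of_signedSum_ne_zero h x y h1 h2

theorem signedSum_tabSum_eq {n : ℕ} {p q f g : Fin n → ℕ} (w : Perm (Fin n))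
    (hf : f ∘ w = g) (hp : p ∘ w = q) (hinj : ∀ x y, f x = f y → p x = p y → x = y) :
    signedSum p q (tabSum f g) = ((Perm.sign w : ℤ) : ℂ) := by
  rw [signedSum_apply, Finset.sum_eq_single w]
  · simp [tabSum, hf, hp]
  · intro v _ hv
    by_contra hne
    obtain ⟨h1, h2⟩ := mul_ne_zero_iff.1 hne
    simp only [ne_eq, ite_eq_right_iff, not_forall, tabSum] at h1 h2
    refine hv (Equiv.ext fun x => hinj _ _ ?_ ?_)
    · exact congrFun (h2.1.trans hf.symm) x
    · exact congrFun (h1.1.trans hp.symm) x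
  · simp

section

variable {l : YoungDiagram} {n : ℕ}

/-- By `mem_of_injective` the row of x in s and its column in u describe a cell of the diagram; the
permutation sends x to the entry of t₀ in that cell. -/
theorem exists_perm_of_injective (t₀ s u : Filling l n)
    (h : ∀ x y, s.row x = s.row y → u.col x = u.col y → x = y) :
    ∃ w : Perm (Fin n), t₀.row ∘ w = s.row ∧ t₀.col ∘ w = u.col := by
  let F : Fin n → Fin n := fun x => t₀ ⟨(s.row x, u.col x), s.mem_of_injective u h x⟩
  have hF : Function.Injective F := by
    intro x y hxy
    have := congrArg Subtype.val (t₀.injective hxy)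
    exact h x y (Prod.mk.inj this).1 (Prod.mk.inj this).2
  refine ⟨Equiv.ofBijective F (Finite.injective_iff_bijective.1 hF), ?_, ?_⟩
  · funext x
    exact t₀.row_apply _
  · funext x
    exact t₀.col_apply _

/-- If rows and columns meet twice on either side, both members vanish. Otherwise each of the three
sums has a single term: with w₁ from s, u to t₀ and w₂ from t, v to t₀, the term on the left is
w₁⁻¹w₂, and signs are multiplicative. -/
theorem signedSum_mul (t₀ s t u v : Filling l n) :
    signedSum u.col v.col (tabSum s.row t.row) =
      signedSum t₀.col u.col (tabSum t₀.row s.row) *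
        signedSum t₀.col v.col (tabSum t₀.row t.row) := by
  have h0 : ∀ x y, t₀.row x = t₀.row y → t₀.col x = t₀.col y → x = y :=
    fun x y h h' => t₀.ext_row_col h h'
  by_cases h1 : ∀ x y, s.row x = s.row y → u.col x = u.col y → x = y
  swap
  · rw [show signedSum u.col v.col (tabSum s.row t.row) = 0 by
      by_contra h; exact h1 (injective_of_signedSum_ne_zero h),
      show signedSum t₀.col u.col (tabSum t₀.row s.row) = 0 by
      by_contra h; exact h1 (injective_of_signedSum_ne_zero' h), zero_mul]
  by_cases h2 : ∀ x y, t.row x = t.row y → v.col x = v.col y → x = y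
  swap
  · rw [show signedSum u.col v.col (tabSum s.row t.row) = 0 by
      by_contra h; exact h2 (injective_of_signedSum_ne_zero' h),
      show signedSum t₀.col v.col (tabSum t₀.row t.row) = 0 by
      by_contra h; exact h2 (injective_of_signedSum_ne_zero' h), mul_zero]
  obtain ⟨w₁, hr₁, hc₁⟩ := exists_perm_of_injective t₀ s u h1
  obtain ⟨w₂, hr₂, hc₂⟩ := exists_perm_of_injective t₀ t v h2
  have hr : s.row ∘ ⇑(w₁⁻¹ * w₂) = t.row := by
    rw [← hr₁, ← hr₂]
    funext x
    simp
  have hc : u.col ∘ ⇑(w₁⁻¹ * w₂) = v.col := by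
    rw [← hc₁, ← hc₂]
    funext x
    simp
  rw [signedSum_tabSum_eq _ hr hc h1, signedSum_tabSum_eq _ hr₁ hc₁ h0,
    signedSum_tabSum_eq _ hr₂ hc₂ h0]
  simp

theorem signedSum_self (s t : Filling l n) : signedSum s.col t.col (tabSum s.row t.row) ≠ 0 := by
  rw [signedSum_tabSum_eq (s.symm.trans t)⁻¹]
  · simp
  · rw [comp_inv_eq_iff]
    funext x
    simp [Filling.row]
  · rw [comp_inv_eq_iff]
    funext x
    simp [Filling.col]
  · exact fun x y h h' => s.ext_row_col h h'

end

/-! ## The Garnir relations -/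

/-- Functions on permutations that only depend on `h ∘ w` are combinations of the indicator
functions with first argument `h`. -/
theorem mem_of_factors {n : ℕ} (W : Submodule ℂ (Perm (Fin n) → ℂ)) (h : Fin n → ℕ)
    (hW : ∀ h', tabSum h h' ∈ W) (F : Perm (Fin n) → ℂ)
    (hF : ∀ w w' : Perm (Fin n), h ∘ w = h ∘ w' → F w = F w') : F ∈ W := by
  classical
  let c := Function.extend (fun w : Perm (Fin n) => h ∘ w) F 0
  have hc : ∀ w : Perm (Fin n), c (h ∘ w) = F w :=
    fun w => Function.FactorsThrough.extend_apply (fun w w' hw => hF w w' hw) 0 w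
  have : F = ∑ h' ∈ Finset.univ.image (fun w : Perm (Fin n) => h ∘ w), c h' • tabSum h h' := by
    funext w
    rw [Finset.sum_apply, Finset.sum_eq_single (h ∘ w)]
    · simp [tabSum, hc]
    · intro h' _ hne
      simp [tabSum, hne.symm]
    · intro hn
      exact absurd (Finset.mem_image_of_mem _ (Finset.mem_univ w)) hn
  rw [this]
  exact sum_mem fun h' _ => Submodule.smul_mem _ _ (hW h')

/-- If the translates `f ∘ v ≠ f` by elements `v` of the stabilizer of `h` give elements of `W`, then
so does `f`, because the sum over all translates is a combination of elements `tabSum h h'`. -/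
theorem tabSum_mem_of_translates {n : ℕ} (W : Submodule ℂ (Perm (Fin n) → ℂ)) (h f g : Fin n → ℕ)
    (hW : ∀ h', tabSum h h' ∈ W)
    (hf : ∀ v : Perm (Fin n), h ∘ v = h → f ∘ v ≠ f → tabSum (f ∘ v) g ∈ W) :
    tabSum f g ∈ W := by
  classical
  set V := Finset.univ.filter fun v : Perm (Fin n) => h ∘ v = h with hV
  -- At w this sum counts the v in the stabilizer of h with f ∘ v ∘ w = g. If h ∘ w = h ∘ w', then w
  -- w'⁻¹ lies in the stabilizer, and translation by it identifies the counts at w and w'.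
  have h1 : ∑ v ∈ V, tabSum (f ∘ v) g ∈ W := by
    refine mem_of_factors W h hW _ fun w w' hw => ?_
    rw [Finset.sum_apply, Finset.sum_apply, hV, Finset.sum_filter, Finset.sum_filter]
    refine Fintype.sum_equiv (Equiv.mulRight (w * w'⁻¹)) _ _ fun v => ?_
    have e1 : h ∘ ⇑(v * (w * w'⁻¹)) = h ↔ h ∘ v = h := by
      have e0 : h ∘ ⇑(w * w'⁻¹) = h := by
        funext x
        have := congrFun hw (w'⁻¹ x)
        simpa using this
      generalize w * w'⁻¹ = u at e0
      constructor
      · intro e2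
        funext x
        have a1 := congrFun e2 (u⁻¹ x)
        have a2 := congrFun e0 (u⁻¹ x)
        simp only [Function.comp_apply, Perm.mul_apply, Perm.coe_inv,
          Equiv.apply_symm_apply] at a1 a2
        exact a1.trans a2.symm
      · intro e2
        funext x
        exact (congrFun e2 _).trans (congrFun e0 x)
    have e3 : (f ∘ ⇑(v * (w * w'⁻¹))) ∘ ⇑w' = (f ∘ v) ∘ ⇑w := by
      funext x
      simp
    simp only [Equiv.coe_mulRight, e1, tabSum, e3]
  rw [← Finset.sum_filter_add_sum_filter_not V fun v : Perm (Fin n) => f ∘ ⇑v = f] at h1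
  have h2 : ∑ v ∈ V.filter (fun v : Perm (Fin n) => ¬ f ∘ ⇑v = f), tabSum (f ∘ v) g ∈ W := by
    refine sum_mem fun v hv => ?_
    simp only [hV, Finset.mem_filter, Finset.mem_univ, true_and] at hv
    exact hf v hv.1 hv.2
  -- What remains is a multiple of `tabSum f g`, by the number of v fixing both h and f. It is
  -- nonzero because v = 1 occurs.
  have h3 := (Submodule.add_mem_iff_left _ h2).1 h1
  rw [Finset.sum_congr rfl (g := fun _ => tabSum f g) (fun v hv => by
    rw [(Finset.mem_filter.1 hv).2]), Finset.sum_const, ← Nat.cast_smul_eq_nsmul ℂ] at h3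
  refine (Submodule.smul_mem_iff _ ?_).1 h3
  rw [Nat.cast_ne_zero]
  refine (Finset.card_pos.2 ⟨1, ?_⟩).ne'
  simp [hV]

/-- The sum of `3 ^ c` over all points, for `c` the size of the fibre of the point. -/
def fibreWeight {n : ℕ} (f : Fin n → ℕ) : ℕ :=
  ∑ x, 3 ^ (Finset.univ.filter fun y => f y = f x).card

theorem sum_lt_sum_of_initial {n : ℕ} {B B' : Finset (Fin n)} (hc : B.card = B'.card)
    (hne : B ≠ B') (hB : ∀ x ∈ B, ∀ y ∈ B', y ∉ B → x < y) :
    ∑ x ∈ B, x.1 < ∑ x ∈ B', x.1 := by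
  classical
  have hcard : (B \ B').card = (B' \ B).card := Finset.card_sdiff_comm hc
  have hne' : (B' \ B).Nonempty := by
    rw [Finset.sdiff_nonempty]
    intro h
    exact hne (Finset.eq_of_subset_of_card_le h hc.le).symm
  obtain ⟨m, hm, hmin⟩ := (B' \ B).exists_min_image (fun x => x.1) hne'
  rw [← Finset.sum_sdiff_lt_sum_sdiff]
  rw [Finset.mem_sdiff] at hm
  calc ∑ x ∈ B \ B', x.1 < ∑ x ∈ B \ B', m.1 := by
        refine Finset.sum_lt_sum_of_nonempty (Finset.card_pos.1 ?_) fun x hx => ?_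
        · rw [hcard]; exact Finset.card_pos.2 hne'
        · exact hB x (Finset.mem_sdiff.1 hx).1 m hm.1 hm.2
    _ = ∑ x ∈ B' \ B, m.1 := by simp [hcard]
    _ ≤ _ := Finset.sum_le_sum hmin

section

variable {l : YoungDiagram} {n : ℕ}

theorem exists_rowIncreasing (s : Filling l n) : ∃ a : Filling l n, a.row = s.row ∧
    a.RowIncreasing := Filling.exists_row_eq s.row s.card_row_eq

/-- The Garnir set: the upper row from x₀ on and the lower row up to y₀. The two pieces together
meet all columns of the upper row, and the common column of x₀ and y₀ twice. -/
theorem card_garnir (a : Filling l n) (ha : a.RowIncreasing) {x₀ y₀ : Fin n}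
    (hcol : a.col x₀ = a.col y₀) (hlt : y₀ < x₀) :
    l.rowLen (a.row x₀) + 1 ≤ (Finset.univ.filter fun x =>
      (a.row x = a.row x₀ ∧ x₀ ≤ x) ∨ (a.row x = a.row y₀ ∧ x ≤ y₀)).card := by
  classical
  set G := Finset.univ.filter fun x =>
      (a.row x = a.row x₀ ∧ x₀ ≤ x) ∨ (a.row x = a.row y₀ ∧ x ≤ y₀) with hG
  have hy : y₀ ∈ G := by simp [hG]
  have hrow : a.row x₀ ≠ a.row y₀ := fun h => hlt.ne' (a.ext_row_col h hcol)
  rw [← Nat.sub_add_cancel (Finset.card_pos.2 ⟨y₀, hy⟩), ← Finset.card_erase_of_mem hy]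
  refine Nat.succ_le_succ ?_
  refine le_trans ?_ (Finset.card_image_le (f := a.col))
  rw [← Finset.card_range (l.rowLen (a.row x₀))]
  refine Finset.card_le_card fun j hj => ?_
  rw [Finset.mem_range, ← YoungDiagram.mem_iff_lt_rowLen] at hj
  rw [Finset.mem_image]
  rcases lt_or_ge j (a.col x₀) with h | h
  · obtain ⟨x, h1, h2⟩ := a.exists_of_mem (l.up_left_mem le_rfl (hcol ▸ h.le) (a.mem y₀))
    have hx : x < y₀ := Filling.lt_of_row_eq ha h1 (by omega)
    exact ⟨x, by simp [hG, h1, hx.le, hx.ne], h2⟩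
  · obtain ⟨x, h1, h2⟩ := a.exists_of_mem hj
    have hx : x₀ ≤ x := by
      rcases h.lt_or_eq with h | h
      · exact (Filling.lt_of_row_eq ha h1.symm (by omega)).le
      · exact (a.ext_row_col h1.symm (by omega)).le
    refine ⟨x, ?_, h2⟩
    rw [Finset.mem_erase]
    refine ⟨?_, by simp [hG, h1, hx]⟩
    rintro rfl
    exact hrow h1.symm

/-- Garnir straightening: the sums for arbitrary fillings are combinations of those for standard
ones and of those for functions with larger fibres. -/
theorem tabSum_mem_of_standard (W : Submodule ℂ (Perm (Fin n) → ℂ)) (g : Fin n → ℕ)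
    (hstd : ∀ a : Filling l n, a.IsStd → tabSum a.row g ∈ W) (s : Filling l n)
    (hW : ∀ h h' : Fin n → ℕ, fibreWeight s.row < fibreWeight h → tabSum h h' ∈ W) :
    tabSum s.row g ∈ W := by
  classical
  -- M grows when larger entries move to lower rows. It is bounded on the finitely many fillings,
  -- which allows a descending induction.
  let M : Filling l n → ℕ := fun s => ∑ x, x.1 * s.row x
  have hM : ∀ s, M s ≤ ∑ s, M s :=
    fun s => Finset.single_le_sum (f := M) (fun _ _ => Nat.zero_le _) (Finset.mem_univ s)
  induction hk : ∑ s, M s - M s using Nat.strong_induction_on generalizing s with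
  | _ k ih =>
  obtain ⟨a, has, ha⟩ := exists_rowIncreasing s
  by_cases hcol : a.IsStd
  · rw [← has]
    exact hstd a hcol
  rw [Filling.IsStd, not_and] at hcol
  have hcol := hcol ha
  push Not at hcol
  obtain ⟨c, c', hcc, hr, hle⟩ := hcol
  set x₀ := a c with hx₀
  set y₀ := a c' with hy₀
  have hcol : a.col x₀ = a.col y₀ := by rw [a.col_apply, a.col_apply, hcc]
  have hrow : a.row x₀ < a.row y₀ := by rwa [a.row_apply, a.row_apply]
  have hlt : y₀ < x₀ := lt_of_le_of_ne hle fun h => hrow.ne (by rw [h])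
  have hG₀ := card_garnir a ha hcol hlt
  rw [has] at hG₀ hrow
  set f := s.row with hf
  set r := f x₀ with hr
  set r' := f y₀ with hr'
  set G := Finset.univ.filter fun x => (f x = r ∧ x₀ ≤ x) ∨ (f x = r' ∧ x ≤ y₀) with hG
  have hGmem : ∀ x, x ∈ G ↔ (f x = r ∧ x₀ ≤ x) ∨ (f x = r' ∧ x ≤ y₀) := fun x => by simp [hG]
  obtain ⟨N, hN⟩ : ∃ N, ∀ x, f x < N :=
    ⟨∑ x, f x + 1, fun x => Nat.lt_succ_of_le
      (Finset.single_le_sum (f := f) (fun _ _ => Nat.zero_le _) (Finset.mem_univ x))⟩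
  have hNr := hN x₀
  have hNr' := hN y₀
  -- The fibres of h are G, the two remainders of the rows meeting G, and the other rows; N is a
  -- value not taken by f. So a permutation preserving h can change f only inside G.
  let h : Fin n → ℕ := fun x => if x ∈ G then r else if f x = r then r' else
    if f x = r' then N else f x
  have hh : ∀ x, h x = if x ∈ G then r else if f x = r then r' else
    if f x = r' then N else f x := fun x => rfl
  have hhG : ∀ x, h x = r ↔ x ∈ G := by
    intro x
    rw [hh]
    split_ifs with h1 h2 h3
    · simp [h1]
    · simp [h1, hrow.ne']
    · simp only [h1, iff_false]; omega
    · simp [h1, h2]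
  have hhf : ∀ x y, h x = h y → x ∉ G → f x = f y := by
    intro x y hxy hx
    have hy : y ∉ G := by rwa [← hhG, ← hxy, hhG]
    rw [hh, hh, if_neg hx, if_neg hy] at hxy
    have h1 := hN x
    have h2 := hN y
    split_ifs at hxy <;> omega
  refine tabSum_mem_of_translates W h f g (fun h' => hW _ _ ?_) ?_
  · -- the weight increases
    unfold fibreWeight
    rw [← Finset.sum_filter_add_sum_filter_not Finset.univ (fun x => f x = r ∨ f x = r'),
      ← Finset.sum_filter_add_sum_filter_not Finset.univ (fun x => f x = r ∨ f x = r')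
        (fun x => 3 ^ (Finset.univ.filter fun y => h y = h x).card)]
    refine add_lt_add_of_lt_of_le ?_ ?_
    · have hfr : (Finset.univ.filter fun x => f x = r).card = l.rowLen r := s.card_row_eq r
      have hfr' : (Finset.univ.filter fun x => f x = r').card ≤ l.rowLen r :=
        (s.card_row_eq r').trans_le (l.rowLen_anti _ _ hrow.le)
      set ρ := l.rowLen r with hρ
      -- The two rows contain at most 2ρ points, in fibres of f of size at most ρ. The at least ρ +
      -- 1 points of G lie in a fibre of h of size at least ρ + 1 and already outweigh them.
      calc ∑ x ∈ Finset.univ.filter (fun x => f x = r ∨ f x = r'),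
            3 ^ (Finset.univ.filter fun y => f y = f x).card
          ≤ ∑ x ∈ Finset.univ.filter (fun x => f x = r ∨ f x = r'), 3 ^ ρ := by
            refine Finset.sum_le_sum fun x hx => Nat.pow_le_pow_right (by norm_num) ?_
            rcases (Finset.mem_filter.1 hx).2 with h1 | h1
            · rw [h1, hfr]
            · rw [h1]; exact hfr'
        _ ≤ (ρ + ρ) * 3 ^ ρ := by
            rw [Finset.sum_const, smul_eq_mul]
            refine Nat.mul_le_mul_right _ ?_
            rw [Finset.filter_or]
            refine (Finset.card_union_le _ _).trans ?_
            omega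
        _ < (ρ + 1) * 3 ^ (ρ + 1) := by
            rw [pow_succ]
            have : 0 < 3 ^ ρ := by positivity
            nlinarith
        _ ≤ ∑ x ∈ G, 3 ^ (ρ + 1) := by
            rw [Finset.sum_const, smul_eq_mul]
            exact Nat.mul_le_mul_right _ hG₀
        _ ≤ ∑ x ∈ G, 3 ^ (Finset.univ.filter fun y => h y = h x).card := by
            refine Finset.sum_le_sum fun x hx => Nat.pow_le_pow_right (by norm_num) ?_
            refine hG₀.trans (Finset.card_le_card fun y hy => ?_)
            rw [Finset.mem_filter, (hhG x).2 hx, (hhG y).2 hy]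
            exact ⟨Finset.mem_univ _, rfl⟩
        _ ≤ _ := by
            refine Finset.sum_le_sum_of_subset fun x hx => ?_
            rw [Finset.mem_filter]
            rcases (hGmem x).1 hx with h1 | h1
            · exact ⟨Finset.mem_univ _, Or.inl h1.1⟩
            · exact ⟨Finset.mem_univ _, Or.inr h1.1⟩
    · refine Finset.sum_le_sum fun x hx => Nat.pow_le_pow_right (by norm_num) ?_
      refine Finset.card_le_card fun y hy => ?_
      have hx := (Finset.mem_filter.1 hx).2
      push Not at hx
      have hval : ∀ z, f z ≠ r → f z ≠ r' → h z = f z := by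
        intro z h1 h2
        rw [hh, if_neg, if_neg h1, if_neg h2]
        rw [hGmem]
        tauto
      have hy := (Finset.mem_filter.1 hy).2
      rw [Finset.mem_filter, hval x hx.1 hx.2, hval y (hy ▸ hx.1) (hy ▸ hx.2)]
      exact ⟨Finset.mem_univ _, hy⟩
  · intro v hv hne
    let s' : Filling l n := s.trans v.symm
    have hs' : s'.row = f ∘ v := by
      funext x
      simp [s', Filling.row, hf]
    have hvG : ∀ x, v x ∈ G ↔ x ∈ G := by
      intro x
      rw [← hhG, ← hhG]
      exact iff_of_eq (congrArg (· = r) (congrFun hv x))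
    -- Inside G the entries of the lower row are at most y₀, and those of the upper row are at least
    -- x₀ > y₀. So B, the part of G in the lower row, consists of the smallest entries of G, and
    -- exchanging it for another subset B' of the same size raises M.
    have hMlt : M s < M s' := by
      let B := G.filter fun x => f x = r'
      let B' := G.filter fun x => f (v x) = r'
      let base : Fin n → ℕ := fun x => if x ∈ G then r else f x
      have hfG : ∀ x ∈ G, f x ≠ r' → f x = r := by
        intro x hx hx'
        rcases (hGmem x).1 hx with h1 | h1
        · exact h1.1
        · exact absurd h1.1 hx'
      have e1 : ∀ x, f x = base x + if x ∈ B then r' - r else 0 := by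
        intro x
        by_cases hx : x ∈ G
        · by_cases hx' : f x = r'
          · simp only [base, B, Finset.mem_filter, hx, hx', if_true, and_self]; omega
          · rw [if_neg (by simp [B, hx']), hfG x hx hx']
            simp [base, hx]
        · simp [base, B, hx]
      have e2 : ∀ x, f (v x) = base x + if x ∈ B' then r' - r else 0 := by
        intro x
        by_cases hx : x ∈ G
        · by_cases hx' : f (v x) = r'
          · simp only [base, B', Finset.mem_filter, hx, hx', if_true, and_self]; omega
          · rw [if_neg (by simp [B', hx']), hfG (v x) ((hvG x).2 hx) hx']
            simp [base, hx]
        · simp only [base, B', Finset.mem_filter, hx, if_false, false_and]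
          exact (hhf x (v x) (congrFun hv x).symm hx).symm
      have e3 : M s = ∑ x, x.1 * base x + (r' - r) * ∑ x ∈ B, x.1 := by
        change ∑ x, x.1 * f x = _
        rw [Finset.sum_congr rfl fun x _ => by rw [e1 x, mul_add], Finset.sum_add_distrib]
        simp [Finset.mul_sum, mul_comm]
      have e4 : M s' = ∑ x, x.1 * base x + (r' - r) * ∑ x ∈ B', x.1 := by
        change ∑ x, x.1 * s'.row x = _
        rw [hs', Finset.sum_congr rfl fun x _ => by rw [Function.comp_apply, e2 x, mul_add],
          Finset.sum_add_distrib]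
        simp [Finset.mul_sum, mul_comm]
      rw [e3, e4]
      refine Nat.add_lt_add_left (Nat.mul_lt_mul_of_pos_left ?_ (by omega)) _
      refine sum_lt_sum_of_initial ?_ ?_ ?_
      · symm
        refine Finset.card_bij (fun x _ => v x) ?_ (fun _ _ _ _ h => v.injective h) ?_
        · intro x hx
          rw [Finset.mem_filter] at hx ⊢
          exact ⟨(hvG x).2 hx.1, hx.2⟩
        · intro x hx
          rw [Finset.mem_filter] at hx
          refine ⟨v⁻¹ x, ?_, by simp⟩
          rw [Finset.mem_filter, ← hvG]
          simpa using hx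
      · intro hBB
        refine hne (funext fun x => ?_)
        rw [Function.comp_apply, e2, ← hBB, ← e1]
      · intro x hx y hy hyB
        rw [Finset.mem_filter] at hx hy hyB
        have hy' : f y ≠ r' := fun h => hyB ⟨hy.1, h⟩
        rcases (hGmem x).1 hx.1 with h1 | h1
        · omega
        rcases (hGmem y).1 hy.1 with h2 | h2
        · exact h1.2.trans_lt (hlt.trans_le h2.2)
        · exact absurd h2.1 hy'
    rw [← hs']
    refine ih (∑ s, M s - M s') ?_ s' ?_ rfl
    · have := hM s'
      omega
    · intro h₁ h₂ hlt'
      refine hW h₁ h₂ (lt_of_le_of_lt (le_of_eq ?_) hlt')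
      rw [hs']
      unfold fibreWeight
      have hc : ∀ y, (Finset.univ.filter fun x => f x = y).card =
          (Finset.univ.filter fun x => (f ∘ v) x = y).card := by
        intro y
        symm
        refine Finset.card_bij (fun x _ => v x) ?_ (fun _ _ _ _ h => v.injective h) ?_
        · intro x hx
          simpa using hx
        · intro x hx
          exact ⟨v⁻¹ x, by simpa using hx, by simp⟩
      symm
      refine Fintype.sum_equiv v _ _ fun x => ?_
      rw [hc]
      rfl

end

/-! ## The Murphy basis of the symmetric group -/

/-- The fillings of `l` that are standard. -/
abbrev StdFilling (l : YoungDiagram) (n : ℕ) : Type := {s : Filling l n // s.IsStd}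

noncomputable instance (l : YoungDiagram) (n : ℕ) : Fintype (StdFilling l n) :=
  Fintype.ofFinite _

/-- The elements of the Murphy basis, as functions on the symmetric group. -/
def murphyFun (n : ℕ) (i : Σ l : YoungDiagram, StdFilling l n × StdFilling l n) :
    Perm (Fin n) → ℂ := tabSum i.2.1.1.row i.2.2.1.row

/-! ### The Murphy elements span -/

theorem exists_perm_card_antitone {n : ℕ} (f : Fin n → ℕ) :
    ∃ π : Perm ℕ, Antitone fun i => (Finset.univ.filter fun x => π (f x) = i).card := by
  obtain ⟨N, hN⟩ : ∃ N, ∀ x, f x < N :=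
    ⟨∑ x, f x + 1, fun x => Nat.lt_succ_of_le
      (Finset.single_le_sum (f := f) (fun _ _ => Nat.zero_le _) (Finset.mem_univ x))⟩
  let c : ℕ → ℕ := fun i => (Finset.univ.filter fun x => f x = i).card
  -- The order dual makes the sorting decreasing. Only values below N are permuted; the other fibres
  -- are empty.
  let c' : Fin N → ℕᵒᵈ := fun i => OrderDual.toDual (c i)
  have hsort := Tuple.monotone_sort c'
  set σ := Tuple.sort c' with hσ
  let τ : Perm ℕ := σ.extendDomain Fin.equivSubtype
  have hτ : ∀ i (hi : i < N), τ i = (σ ⟨i, hi⟩).1 := by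
    intro i hi
    exact Equiv.Perm.extendDomain_apply_subtype σ Fin.equivSubtype hi
  have hτ' : ∀ i, N ≤ i → τ i = i := by
    intro i hi
    exact Equiv.Perm.extendDomain_apply_not_subtype σ Fin.equivSubtype (by simpa using hi)
  have hcount : ∀ i, (Finset.univ.filter fun x => τ.symm (f x) = i).card = c (τ i) := by
    intro i
    simp only [c, Equiv.symm_apply_eq]
  refine ⟨τ.symm, fun i j hij => ?_⟩
  change (Finset.univ.filter fun x => τ.symm (f x) = j).card ≤
    (Finset.univ.filter fun x => τ.symm (f x) = i).card
  rw [hcount, hcount]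
  rcases lt_or_ge j N with hj | hj
  · rw [hτ i (hij.trans_lt hj), hτ j hj]
    exact hsort (show (⟨i, hij.trans_lt hj⟩ : Fin N) ≤ ⟨j, hj⟩ from hij)
  · rw [hτ' j hj]
    have : c j = 0 := by
      refine Finset.card_eq_zero.2 (Finset.filter_eq_empty_iff.2 fun x _ h => ?_)
      have := hN x
      omega
    rw [this]
    exact Nat.zero_le _

theorem exists_youngDiagram {n : ℕ} (f : Fin n → ℕ)
    (hf : Antitone fun i => (Finset.univ.filter fun x => f x = i).card) :
    ∃ l : YoungDiagram, ∀ i, (Finset.univ.filter fun x => f x = i).card = l.rowLen i := by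
  obtain ⟨N, hN⟩ : ∃ N, ∀ x, f x < N :=
    ⟨∑ x, f x + 1, fun x => Nat.lt_succ_of_le
      (Finset.single_le_sum (f := f) (fun _ _ => Nat.zero_le _) (Finset.mem_univ x))⟩
  set c : ℕ → ℕ := fun i => (Finset.univ.filter fun x => f x = i).card with hc
  have hmem : ∀ i j, (i, j) ∈ ((Finset.range N ×ˢ Finset.range n).filter fun p => p.2 < c p.1) ↔
      j < c i := by
    intro i j
    simp only [Finset.mem_filter, Finset.mem_product, Finset.mem_range, and_iff_right_iff_imp]
    intro h
    obtain ⟨x, hx⟩ := Finset.card_pos.1 ((Nat.zero_le j).trans_lt h)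
    have hx := (Finset.mem_filter.1 hx).2
    refine ⟨hx ▸ hN x, h.trans_le ?_⟩
    exact (Finset.card_le_univ _).trans (by simp)
  let l : YoungDiagram := ⟨(Finset.range N ×ˢ Finset.range n).filter fun p => p.2 < c p.1, by
    rintro ⟨i, j⟩ ⟨i', j'⟩ ⟨h1, h2⟩ h
    rw [Finset.mem_coe, hmem] at h ⊢
    exact lt_of_le_of_lt h2 (h.trans_le (hf h1))⟩
  refine ⟨l, fun i => ?_⟩
  change c i = _
  have : ∀ j, j < c i ↔ j < l.rowLen i := by
    intro j
    rw [← YoungDiagram.mem_iff_lt_rowLen, ← hmem]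
    rfl
  exact le_antisymm (le_of_forall_lt fun j hj => (this j).1 hj)
    (le_of_forall_lt fun j hj => (this j).2 hj)

theorem card_filter_comp_perm {n : ℕ} (f : Fin n → ℕ) (w : Perm (Fin n)) (i : ℕ) :
    (Finset.univ.filter fun x => (f ∘ w) x = i).card =
      (Finset.univ.filter fun x => f x = i).card := by
  refine Finset.card_bij (fun x _ => w x) ?_ (fun _ _ _ _ h => w.injective h) ?_
  · intro x hx
    simpa using hx
  · intro x hx
    exact ⟨w.symm x, by simpa using hx, by simp⟩

/-- The linear map induced by the inverse. -/
def compInv (n : ℕ) : (Perm (Fin n) → ℂ) →ₗ[ℂ] (Perm (Fin n) → ℂ) :=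
  LinearMap.funLeft ℂ ℂ fun w : Perm (Fin n) => w⁻¹

theorem compInv_tabSum {n : ℕ} (f g : Fin n → ℕ) : compInv n (tabSum f g) = tabSum g f := by
  funext w
  simp only [compInv, LinearMap.funLeft_apply, tabSum, comp_inv_eq_iff]

theorem compInv_mem_span {n : ℕ} {F : Perm (Fin n) → ℂ}
    (hF : F ∈ Submodule.span ℂ (Set.range (murphyFun n))) :
    compInv n F ∈ Submodule.span ℂ (Set.range (murphyFun n)) := by
  induction hF using Submodule.span_induction with
  | mem x hx =>
    obtain ⟨⟨l, s, t⟩, rfl⟩ := hx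
    unfold murphyFun
    rw [compInv_tabSum]
    exact Submodule.subset_span ⟨⟨l, t, s⟩, rfl⟩
  | zero => simp
  | add x y _ _ hx hy => rw [map_add]; exact add_mem hx hy
  | smul c x _ hx => rw [map_smul]; exact Submodule.smul_mem _ _ hx

theorem fibreWeight_le {n : ℕ} (f : Fin n → ℕ) : fibreWeight f ≤ n * 3 ^ n := by
  unfold fibreWeight
  calc _ ≤ ∑ x : Fin n, 3 ^ n := by
        refine Finset.sum_le_sum fun x _ => Nat.pow_le_pow_right (by norm_num) ?_
        exact (Finset.card_le_univ _).trans (by simp)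
    _ = _ := by simp

/-- Descending induction on the fibre weight. Renaming the common values of f and g does not change
`tabSum f g`, so the fibres can be arranged as the rows of a Young diagram; straightening both
arguments then leaves standard fillings and terms of larger weight. -/
theorem tabSum_mem_span {n : ℕ} (f g : Fin n → ℕ) :
    tabSum f g ∈ Submodule.span ℂ (Set.range (murphyFun n)) := by
  induction hk : n * 3 ^ n - fibreWeight f using Nat.strong_induction_on generalizing f g with
  | _ k ih =>
  by_cases hfg : ∃ w : Perm (Fin n), f ∘ w = g
  swap
  · have : tabSum f g = 0 := by
      funext w
      simp only [tabSum, Pi.zero_apply, ite_eq_right_iff, one_ne_zero, imp_false]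
      exact fun h => hfg ⟨w, h⟩
    rw [this]
    exact zero_mem _
  obtain ⟨w, rfl⟩ := hfg
  obtain ⟨π, hπ⟩ := exists_perm_card_antitone f
  obtain ⟨l, hl⟩ := exists_youngDiagram (π ∘ f) hπ
  obtain ⟨s, hs, -⟩ := Filling.exists_row_eq (π ∘ f) hl
  obtain ⟨t, ht, -⟩ := Filling.exists_row_eq (l := l) ((π ∘ f) ∘ w) (fun i => by
    rw [card_filter_comp_perm, hl])
  have hst : tabSum f (f ∘ w) = tabSum s.row t.row := by
    funext v
    unfold tabSum
    congr 1
    rw [hs, ht, eq_iff_iff]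
    constructor
    · intro h
      rw [Function.comp_assoc, h, Function.comp_assoc]
    · intro h
      exact π.injective.comp_left h
  have hweight : ∀ u : Filling l n, fibreWeight u.row = fibreWeight f := by
    intro u
    have h1 : ∀ u : Filling l n, fibreWeight u.row = ∑ c : {c // c ∈ l.cells},
        3 ^ l.rowLen c.1.1 := by
      intro u
      refine Fintype.sum_equiv u.symm _ _ fun x => ?_
      rw [u.card_row_eq]
      rfl
    rw [h1, ← h1 s, hs]
    simp [fibreWeight]
  have hW : ∀ u : Filling l n, ∀ h h' : Fin n → ℕ, fibreWeight u.row < fibreWeight h →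
      tabSum h h' ∈ Submodule.span ℂ (Set.range (murphyFun n)) := by
    intro u h h' hlt
    refine ih _ ?_ h h' rfl
    rw [hweight] at hlt
    have := fibreWeight_le h
    omega
  rw [hst]
  refine tabSum_mem_of_standard _ _ (fun a ha => ?_) s (hW s)
  -- Inversion of permutations exchanges the arguments, so straightening applies to the second one
  -- as well.
  rw [← compInv_tabSum]
  refine compInv_mem_span (tabSum_mem_of_standard _ _ (fun b hb => ?_) t (hW t))
  exact Submodule.subset_span ⟨⟨l, ⟨b, hb⟩, ⟨a, ha⟩⟩, rfl⟩

theorem mem_span_murphyFun {n : ℕ} (F : Perm (Fin n) → ℂ) :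
    F ∈ Submodule.span ℂ (Set.range (murphyFun n)) := by
  -- For injective arguments `tabSum` is the indicator function of a single permutation.
  have : F = ∑ w : Perm (Fin n), F w • tabSum (fun x : Fin n => x.1) (fun x => (w x).1) := by
    funext v
    rw [Finset.sum_apply, Finset.sum_eq_single v]
    · simp [tabSum, Function.comp_def]
    · intro w _ hw
      simp only [Pi.smul_apply, tabSum, smul_eq_mul, mul_ite, mul_one, mul_zero,
        ite_eq_right_iff]
      intro h
      exact absurd (Equiv.ext fun x => Fin.ext (congrFun h x).symm) hw
    · simp
  rw [this]
  exact sum_mem fun w _ => Submodule.smul_mem _ _ (tabSum_mem_span _ _)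

/-! ### Triangularity of the Murphy basis and straightening coefficients -/

/-- The functionals that are triangular with respect to the Murphy basis. -/
noncomputable def murphyDual (n : ℕ) (i : Σ l : YoungDiagram, StdFilling l n × StdFilling l n) :
    (Perm (Fin n) → ℂ) →ₗ[ℂ] ℂ := signedSum i.2.1.1.col i.2.2.1.col

/-- The order with respect to which the functionals are triangular. -/
def murphyOrder (n : ℕ) (i : Σ l : YoungDiagram, StdFilling l n × StdFilling l n) :
    (ℕ → ℕ → ℕ) × (ℕ → ℕ → ℕ) := (countLt i.2.1.1.row, countLt i.2.2.1.row)

theorem murphyOrder_injective (n : ℕ) : Function.Injective (murphyOrder n) := by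
  rintro ⟨l, s, t⟩ ⟨m, u, v⟩ h
  have h1 := countLt_injective (congrArg Prod.fst h)
  have h2 := countLt_injective (congrArg Prod.snd h)
  obtain rfl := Filling.shape_eq_of_row_eq h1
  have h3 := Subtype.ext (Filling.eq_of_row_eq s.2.1 u.2.1 h1)
  have h4 := Subtype.ext (Filling.eq_of_row_eq t.2.1 v.2.1 h2)
  rw [h3, h4]

theorem murphyDual_self (n : ℕ) (i) : murphyDual n i (murphyFun n i) ≠ 0 :=
  signedSum_self _ _

theorem murphyOrder_le {n : ℕ} {i j} (h : murphyDual n i (murphyFun n j) ≠ 0) :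
    murphyOrder n j ≤ murphyOrder n i :=
  ⟨countLt_le _ i.2.1.2 _ (injective_of_signedSum_ne_zero h),
    countLt_le _ i.2.2.2 _ (injective_of_signedSum_ne_zero' h)⟩

/-- The sums for a filling of shape `l` are, modulo larger shapes, combinations of those for the
standard fillings of shape `l`, with coefficients that do not depend on the second filling. -/
theorem exists_straightening {l : YoungDiagram} {n : ℕ} (s : Filling l n) :
    ∃ q : StdFilling l n → ℂ, ∀ t : Filling l n,
      tabSum s.row t.row - ∑ a, q a • tabSum a.1.row t.row ∈
        Submodule.span ℂ {F | ∃ i, (Dominated l i.1 ∧ l ≠ i.1) ∧ F = murphyFun n i} := by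
  classical
  -- By `signedSum_mul` with t₀ = s, this is the factor that the first filling a contributes to a
  -- pairing with columns u, whatever the second filling is.
  let P : Filling l n → StdFilling l n → ℂ :=
    fun a u => signedSum s.col u.1.col (tabSum s.row a.row)
  have hdiag : ∀ a : StdFilling l n, P a.1 a ≠ 0 := by
    intro a ha
    -- The nonzero pairing of a with itself is the square of `P a a`.
    exact signedSum_self a.1 a.1 (by rw [signedSum_mul s a.1 a.1 a.1 a.1]; simp only [P] at ha; simp [ha])
  have hle : ∀ a u : StdFilling l n, P a.1 u ≠ 0 → countLt a.1.row ≤ countLt u.1.row :=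
    fun a u h => countLt_le u.1 u.2 _ (injective_of_signedSum_ne_zero' h)
  have hli : LinearIndependent ℂ fun a : StdFilling l n => P a.1 := by
    refine linearIndependent_of_triangular _ (fun u => LinearMap.proj u)
      (fun u => countLt u.1.row) hdiag (fun u a h => hle a u h) ?_
    intro u a _ h
    exact Subtype.ext (Filling.eq_of_row_eq a.2.1 u.2.1 (countLt_injective h))
  -- There are as many independent vectors `P a` as the dimension, so `P s` expands in them; the
  -- coefficients q are fixed before t is chosen.
  have hspan := hli.span_eq_top_of_card_eq_finrank' (by simp)
  have hmem : P s ∈ Submodule.span ℂ (Set.range fun a : StdFilling l n => P a.1) := by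
    rw [hspan]; trivial
  obtain ⟨q, hq⟩ := (Submodule.mem_span_range_iff_exists_fun ℂ).1 hmem
  refine ⟨q, fun t => ?_⟩
  set Z := tabSum s.row t.row - ∑ a, q a • tabSum a.1.row t.row with hZ
  obtain ⟨c, hc⟩ := (Finsupp.mem_span_range_iff_exists_finsupp).1 (mem_span_murphyFun Z)
  have hZ0 : ∀ i : Σ l : YoungDiagram, StdFilling l n × StdFilling l n,
      ¬ (Dominated l i.1 ∧ l ≠ i.1) → murphyDual n i Z = 0 := by
    rintro ⟨m, u, v⟩ hi
    by_cases hlm : l = m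
    · subst hlm
      simp only [murphyDual, hZ, map_sub, map_sum, map_smul]
      rw [signedSum_mul s s t u.1 v.1]
      simp_rw [signedSum_mul s _ t u.1 v.1]
      have := congrFun hq u
      simp only [Finset.sum_apply, Pi.smul_apply, smul_eq_mul, P] at this
      rw [← this, Finset.sum_mul]
      simp [mul_assoc]
    · have h0 : ∀ a : Filling l n, murphyDual n ⟨m, u, v⟩ (tabSum a.row t.row) = 0 := by
        intro a
        by_contra hne
        refine hi ⟨?_, hlm⟩
        exact dominated_of_countLt_le a u.1
          (countLt_le _ u.2 _ (injective_of_signedSum_ne_zero hne))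
      simp [hZ, h0]
  -- Shapes that do not strictly dominate l can be treated alone: a nonzero value of the functional
  -- i on the element j forces the shape of j to be dominated by that of i.
  have hcz := coeff_eq_zero_of_triangular (murphyFun n) (murphyDual n) (murphyOrder n)
    {i | ¬ (Dominated l i.1 ∧ l ≠ i.1)} (murphyDual_self n) (fun i j h => murphyOrder_le h)
    (fun i j _ h => murphyOrder_injective n h) (by
      intro i j hi hij hj
      refine hi ?_
      have hd : Dominated j.1 i.1 := dominated_of_countLt_le j.2.1.1 i.2.1.1 (murphyOrder_le hij).1
      refine ⟨fun k => (hj.1 k).trans (hd k), ?_⟩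
      intro h
      exact hj.2 (hj.1.antisymm (h ▸ hd))) c.support c (by
      intro i hi
      change murphyDual n i (c.sum fun i a => a • murphyFun n i) = 0
      rw [hc]
      exact hZ0 i hi)
  rw [← hc]
  refine sum_mem fun i hi => Submodule.smul_mem _ _ (Submodule.subset_span ⟨i, ?_, rfl⟩)
  by_contra hbad
  exact (Finsupp.mem_support_iff.1 hi) (hcz i hi hbad)

/-! ## Composition of diagrams -/

section

variable {α β γ : Type}

theorem stack_left {d : Setoid (α ⊕ β)} {e : Setoid (β ⊕ γ)} {x y : α ⊕ β} (h : d x y) :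
    stack d e (Sum.map id Sum.inl x) (Sum.map id Sum.inl y) :=
  (map_le_iff.1 (le_sup_left : d.map _ ≤ stack d e)) h

theorem stack_right {d : Setoid (α ⊕ β)} {e : Setoid (β ⊕ γ)} {x y : β ⊕ γ} (h : e x y) :
    stack d e (Sum.inr x) (Sum.inr y) :=
  (map_le_iff.1 (le_sup_right : e.map _ ≤ stack d e)) h

theorem stack_le {d : Setoid (α ⊕ β)} {e : Setoid (β ⊕ γ)} {r : Setoid (α ⊕ β ⊕ γ)}
    (h : ∀ x y, d x y → r (Sum.map id Sum.inl x) (Sum.map id Sum.inl y))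
    (h' : ∀ x y, e x y → r (Sum.inr x) (Sum.inr y)) {x y : α ⊕ β ⊕ γ} (hxy : stack d e x y) :
    r x y :=
  (sup_le (map_le_iff.2 fun {x y} hh => h x y hh) (map_le_iff.2 fun {x y} hh => h' x y hh) :
    stack d e ≤ r) hxy

theorem comp_left {d : Setoid (α ⊕ β)} {e : Setoid (β ⊕ γ)} {x y : α}
    (h : d (Sum.inl x) (Sum.inl y)) : comp d e (Sum.inl x) (Sum.inl y) :=
  stack_left (e := e) h

theorem comp_right {d : Setoid (α ⊕ β)} {e : Setoid (β ⊕ γ)} {x y : γ}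
    (h : e (Sum.inr x) (Sum.inr y)) : comp d e (Sum.inr x) (Sum.inr y) :=
  stack_right (d := d) h

/-- A connection between top and bottom passes through the middle. -/
theorem exists_middle {d : Setoid (α ⊕ β)} {e : Setoid (β ⊕ γ)} {x : α} {z : γ}
    (h : comp d e (Sum.inl x) (Sum.inr z)) :
    ∃ x' y, d (Sum.inl x') (Sum.inr y) ∧ comp d e (Sum.inl x) (Sum.inl x') := by
  by_contra hcon
  push Not at hcon
  let S : α ⊕ β ⊕ γ → Prop := Sum.elim (fun x' => comp d e (Sum.inl x) (Sum.inl x'))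
    (fun _ => False)
  -- If no top point joined to x reached the middle, these top points would be closed under all
  -- connections, so no bottom point could be joined to x.
  have key : Setoid.ker S (outer (Sum.inl x)) (outer (Sum.inr z)) := by
    refine stack_le (d := d) (e := e) ?_ ?_ h
    · rintro (a | a) (b | b) hab <;> rw [Setoid.ker_def, eq_iff_iff]
      · exact ⟨fun h1 => Setoid.trans' _ h1 (comp_left hab),
          fun h1 => Setoid.trans' _ h1 (comp_left (d.symm' hab))⟩
      · exact ⟨fun h1 => hcon a b hab h1, False.elim⟩
      · exact ⟨False.elim, fun h1 => hcon b a (d.symm' hab) h1⟩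
      · exact Iff.rfl
    · intro a b _
      rfl
  have h1 : S (outer (Sum.inl x)) := Setoid.refl' (comp d e) _
  rw [Setoid.ker_def] at key
  rw [key] at h1
  exact h1

theorem missing_eq_zero {X Y : Type} (r : Setoid X) (i : Y → X) (h : ∀ x, ∃ y, r (i y) x) :
    missing r i = 0 := by
  unfold missing
  refine @Nat.card_of_isEmpty _ ⟨?_⟩
  rintro ⟨q, hq⟩
  induction q using Quotient.inductionOn with
  | h x =>
  obtain ⟨y, hy⟩ := h x
  exact hq y (Quotient.sound (s := r) hy)

theorem loops_eq_zero {d : Setoid (α ⊕ β)} {e : Setoid (β ⊕ γ)}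
    (h : ∀ y, ∃ x, d (Sum.inl x) (Sum.inr y)) : loops d e = 0 := by
  refine missing_eq_zero _ _ ?_
  rintro (x | y | z)
  · exact ⟨Sum.inl x, Setoid.refl' _ _⟩
  · obtain ⟨x, hx⟩ := h y
    exact ⟨Sum.inl x, stack_left hx⟩
  · exact ⟨Sum.inr z, Setoid.refl' _ _⟩

/-- The reflection of a diagram. -/
def flip (d : Setoid (α ⊕ β)) : Setoid (β ⊕ α) := d.comap Sum.swap

theorem flip_flip (d : Setoid (α ⊕ β)) : flip (flip d) = d := by
  ext x y
  rcases x with x | x <;> rcases y with y | y <;> exact Iff.rfl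

/-- The reflection of the top, middle and bottom points. -/
def reverse : γ ⊕ β ⊕ α → α ⊕ β ⊕ γ :=
  Sum.elim (Sum.inr ∘ Sum.inr) (Sum.elim (Sum.inr ∘ Sum.inl) Sum.inl)

theorem reverse_reverse (x : γ ⊕ β ⊕ α) : reverse (reverse x) = x := by
  rcases x with x | x | x <;> rfl

theorem stack_flip_le (d : Setoid (α ⊕ β)) (e : Setoid (β ⊕ γ)) :
    stack (flip e) (flip d) ≤ (stack d e).comap reverse := by
  intro x y h
  refine stack_le ?_ ?_ h
  · intro x y h
    have := stack_right (d := d) (e := e) (show e (Sum.swap x) (Sum.swap y) from h)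
    rcases x with x | x <;> rcases y with y | y <;> exact this
  · intro x y h
    have := stack_left (d := d) (e := e) (show d (Sum.swap x) (Sum.swap y) from h)
    rcases x with x | x <;> rcases y with y | y <;> exact this

theorem stack_flip (d : Setoid (α ⊕ β)) (e : Setoid (β ⊕ γ)) :
    stack (flip e) (flip d) = (stack d e).comap reverse := by
  refine le_antisymm (stack_flip_le d e) fun x y h => ?_
  have h1 := stack_flip_le (flip e) (flip d)
  rw [flip_flip, flip_flip] at h1
  have h2 := h1 (show stack d e (reverse x) (reverse y) from h)
  rw [Setoid.comap_rel, reverse_reverse, reverse_reverse] at h2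
  exact h2

theorem reverse_comp_outer :
    (reverse ∘ outer : γ ⊕ α → α ⊕ β ⊕ γ) = outer ∘ Sum.swap := by
  funext x
  rcases x with x | x <;> rfl

theorem comp_flip (d : Setoid (α ⊕ β)) (e : Setoid (β ⊕ γ)) :
    comp (flip e) (flip d) = flip (comp d e) := by
  unfold comp
  rw [stack_flip]
  ext x y
  change stack d e ((reverse ∘ outer) x) ((reverse ∘ outer) y) ↔ _
  rw [reverse_comp_outer]
  rfl

theorem loops_flip [Finite α] [Finite β] [Finite γ] (d : Setoid (α ⊕ β)) (e : Setoid (β ⊕ γ)) :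
    loops (flip e) (flip d) = loops d e := by
  unfold loops
  rw [stack_flip]
  -- Both numbers count the blocks of `stack d e` without outer points, since the two reflections
  -- are bijections and miss no block.
  have h1 := missing_comp (stack d e) reverse (outer : γ ⊕ α → γ ⊕ β ⊕ α)
  have h2 := missing_comp (stack d e) outer (Sum.swap : γ ⊕ α → α ⊕ γ)
  rw [missing_eq_zero _ reverse fun x => ⟨reverse x, by
    rw [reverse_reverse]⟩] at h1
  rw [missing_eq_zero _ Sum.swap fun x => ⟨x.swap, by
    rw [Sum.swap_swap]⟩] at h2
  rw [← reverse_comp_outer] at h2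
  omega

end

/-! ### Half diagrams and propagating blocks -/

namespace HalfDiagram

variable {k l : ℕ}

theorem le_of_halfDiagram (a : HalfDiagram k l) : l ≤ k := by
  simpa using Fintype.card_le_of_embedding a.rep.toEmbedding

theorem mk_rep_mem (a : HalfDiagram k l) (j : Fin l) : Quotient.mk a.part (a.rep j) ∈ a.marked := by
  obtain ⟨q, hq, h⟩ := a.rep_eq_blockMin j
  rw [h, mk_blockMin]
  exact hq

theorem exists_rep_of_mem (a : HalfDiagram k l) {x : Fin k}
    (h : Quotient.mk a.part x ∈ a.marked) : ∃ j, a.part x (a.rep j) := by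
  have h1 : blockMin a.part (Quotient.mk a.part x) ∈
      a.marked.map ⟨blockMin a.part, blockMin_injective a.part⟩ :=
    Finset.mem_map.2 ⟨_, h, rfl⟩
  have h2 := Finset.range_orderEmbOfFin
    (a.marked.map ⟨blockMin a.part, blockMin_injective a.part⟩)
    ((Finset.card_map _).trans a.card_marked)
  rw [← Finset.mem_coe, ← h2] at h1
  obtain ⟨j, hj⟩ := h1
  refine ⟨j, Quotient.exact (s := a.part) ?_⟩
  have : a.rep j = blockMin a.part (Quotient.mk a.part x) := hj
  rw [this, mk_blockMin]

theorem mem_marked_iff (a : HalfDiagram k l) (x : Fin k) :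
    Quotient.mk a.part x ∈ a.marked ↔ ∃ j, a.part x (a.rep j) := by
  refine ⟨a.exists_rep_of_mem, ?_⟩
  rintro ⟨j, hj⟩
  rw [Quotient.sound (s := a.part) hj]
  exact a.mk_rep_mem j

/-- Half diagrams with given distinguished blocks. -/
theorem exists_of_transversal (c : Setoid (Fin k)) (f : Fin l → Fin k)
    (hf : ∀ i j, c (f i) (f j) → i = j) :
    ∃ (a : HalfDiagram k l) (σ : Perm (Fin l)), a.part = c ∧ ∀ j, c (f j) (a.rep (σ j)) := by
  classical
  let a : HalfDiagram k l := ⟨c, Finset.univ.image fun j => Quotient.mk c (f j), by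
    rw [Finset.card_image_of_injective, Finset.card_univ, Fintype.card_fin]
    intro i j h
    exact hf i j (Quotient.exact (s := c) h)⟩
  have h1 : ∀ j, ∃ i, c (f j) (a.rep i) := fun j =>
    a.exists_rep_of_mem (Finset.mem_image.2 ⟨j, Finset.mem_univ _, rfl⟩)
  choose σ hσ using h1
  have hinj : Function.Injective σ := by
    intro i j h
    refine hf i j (c.trans' (hσ i) ?_)
    rw [h]
    exact c.symm' (hσ j)
  exact ⟨a, Equiv.ofBijective σ (Finite.injective_iff_bijective.1 hinj), rfl, hσ⟩

theorem ext_of_rep {a a' : HalfDiagram k l} (h : a.part = a'.part)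
    (h' : ∀ x, (∃ j, a.part x (a.rep j)) ↔ ∃ j, a'.part x (a'.rep j)) : a = a' := by
  simp only [← mem_marked_iff] at h'
  obtain ⟨c, S, hS⟩ := a
  obtain ⟨c', S', hS'⟩ := a'
  obtain rfl : c = c' := h
  obtain rfl : S = S' := by
    ext q
    induction q using Quotient.inductionOn with
    | h x => exact h' x
  rfl

theorem join_rep (a : HalfDiagram k l) (w : Perm (Fin l)) (b : HalfDiagram k l) (j : Fin l) :
    join a w b (Sum.inl (a.rep (w j))) (Sum.inr (b.rep j)) :=
  ⟨j, a.part.refl' _, b.part.refl' _⟩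

theorem le_of_join_eq {m : ℕ} {a : HalfDiagram k l} {w : Perm (Fin l)} {b : HalfDiagram k l}
    {a' : HalfDiagram k m} {w' : Perm (Fin m)} {b' : HalfDiagram k m}
    (h : join a w b = join a' w' b') : l ≤ m := by
  have hpart : ∀ x y, a.part x y ↔ a'.part x y := by
    intro x y
    change join a w b (Sum.inl x) (Sum.inl y) ↔ join a' w' b' (Sum.inl x) (Sum.inl y)
    rw [h]
  have h1 : ∀ j, ∃ j', a'.part (a.rep (w j)) (a'.rep (w' j')) := by
    intro j
    have := a.join_rep w b j
    rw [h] at this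
    obtain ⟨j', h1, -⟩ := this
    exact ⟨j', h1⟩
  choose f hf using h1
  have hinj : Function.Injective f := by
    intro i j hij
    refine w.injective (a.rep_inj ((hpart _ _).2 (a'.part.trans' (hf i) ?_)))
    rw [hij]
    exact a'.part.symm' (hf j)
  simpa using Fintype.card_le_of_injective f hinj

theorem join_injective {a a' b b' : HalfDiagram k l} {w w' : Perm (Fin l)}
    (h : join a w b = join a' w' b') : a = a' ∧ w = w' ∧ b = b' := by
  have hrel : ∀ x y, join a w b x y ↔ join a' w' b' x y := fun x y => by rw [h]
  have ha : a.part = a'.part := by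
    ext x y
    exact hrel (Sum.inl x) (Sum.inl y)
  have hb : b.part = b'.part := by
    ext x y
    exact hrel (Sum.inr x) (Sum.inr y)
  have haj : ∀ (a b : HalfDiagram k l) (w : Perm (Fin l)) (x : Fin k),
      (∃ j, a.part x (a.rep j)) ↔ ∃ y, join a w b (Sum.inl x) (Sum.inr y) := by
    intro a b w x
    constructor
    · rintro ⟨j, hj⟩
      exact ⟨b.rep (w.symm j), w.symm j, by simpa using hj, b.part.refl' _⟩
    · rintro ⟨y, j, hj, -⟩
      exact ⟨_, hj⟩
  have hbj : ∀ (a b : HalfDiagram k l) (w : Perm (Fin l)) (y : Fin k),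
      (∃ j, b.part y (b.rep j)) ↔ ∃ x, join a w b (Sum.inl x) (Sum.inr y) := by
    intro a b w x
    constructor
    · rintro ⟨j, hj⟩
      exact ⟨a.rep (w j), j, a.part.refl' _, hj⟩
    · rintro ⟨y, j, -, hj⟩
      exact ⟨_, hj⟩
  obtain rfl := ext_of_rep ha fun x => by rw [haj a b w, haj a' b' w', h]
  obtain rfl := ext_of_rep hb fun x => by rw [hbj a b w, hbj a b' w', h]
  refine ⟨rfl, Equiv.ext fun j => ?_, rfl⟩
  obtain ⟨j', h1, h2⟩ := (hrel _ _).1 (a.join_rep w b j)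
  obtain rfl := b.rep_inj h2
  exact a.rep_inj h1

/-- Every diagram is the join of two half diagrams. -/
theorem exists_join (d : Diagram k) :
    ∃ (l : ℕ) (a : HalfDiagram k l) (w : Perm (Fin l)) (b : HalfDiagram k l), d = join a w b := by
  classical
  let c : Setoid (Fin k) := d.comap Sum.inl
  let S : Finset (Quotient c) :=
    -- S consists of the upper parts of the propagating blocks. They are first numbered arbitrarily;
    -- σ and τ translate to the numberings by smallest elements at the top and at the bottom.
    Finset.univ.filter fun q => ∃ x y, Quotient.mk c x = q ∧ d (Sum.inl x) (Sum.inr y)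
  have hS : ∀ j : Fin S.card, ∃ x y, Quotient.mk c x = (S.equivFin.symm j).1 ∧
      d (Sum.inl x) (Sum.inr y) := fun j => (Finset.mem_filter.1 (S.equivFin.symm j).2).2
  choose f g hfg hd using hS
  have hf : ∀ i j, c (f i) (f j) → i = j := by
    intro i j h
    have h1 := Quotient.sound (s := c) h
    rw [hfg, hfg] at h1
    exact S.equivFin.symm.injective (Subtype.ext h1)
  have hg : ∀ i j, d.comap Sum.inr (g i) (g j) → i = j := by
    intro i j h
    exact hf i j (d.trans' (hd i) (d.trans' h (d.symm' (hd j))))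
  obtain ⟨a, σ, ha, hσ⟩ := exists_of_transversal c f hf
  obtain ⟨b, τ, hb, hτ⟩ := exists_of_transversal (d.comap Sum.inr) g hg
  have hax : ∀ x y, a.part x y ↔ d (Sum.inl x) (Sum.inl y) := fun x y => by rw [ha]; rfl
  have hbx : ∀ x y, b.part x y ↔ d (Sum.inr x) (Sum.inr y) := fun x y => by rw [hb]; rfl
  have hab : ∀ j, d (Sum.inl (a.rep (σ j))) (Sum.inr (b.rep (τ j))) := fun j =>
    d.trans' (d.symm' (hσ j)) (d.trans' (hd j) (hτ j))
  have key : ∀ x y, d (Sum.inl x) (Sum.inr y) ↔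
      join a (τ⁻¹.trans σ) b (Sum.inl x) (Sum.inr y) := by
    intro x y
    constructor
    · intro h
      have hq : Quotient.mk c x ∈ S := Finset.mem_filter.2 ⟨Finset.mem_univ _, x, y, rfl, h⟩
      obtain ⟨j, hj⟩ := S.equivFin.symm.surjective ⟨_, hq⟩
      have h1 := hfg j
      rw [hj] at h1
      have h2 : c (f j) x := Quotient.exact (s := c) h1
      have h3 : d (Sum.inl x) (Sum.inl (a.rep (σ j))) := d.trans' (d.symm' h2) (hσ j)
      refine ⟨τ j, ?_, ?_⟩
      · rw [hax]
        simpa using h3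
      · rw [hbx]
        exact d.trans' (d.symm' h) (d.trans' h3 (hab j))
    · rintro ⟨j, h1, h2⟩
      rw [hax] at h1
      rw [hbx] at h2
      have := hab (τ⁻¹ j)
      rw [Perm.coe_inv, Equiv.apply_symm_apply] at this
      exact d.trans' h1 (d.trans' this (d.symm' h2))
  refine ⟨S.card, a, τ⁻¹.trans σ, b, ?_⟩
  ext x y
  rcases x with x | x <;> rcases y with y | y
  · exact (hax x y).symm
  · exact key x y
  · exact ⟨fun h => Setoid.symm' _ ((key y x).1 (d.symm' h)),
      fun h => d.symm' ((key y x).2 (Setoid.symm' _ h))⟩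
  · exact (hbx x y).symm

/-- The diagram in which the point `j` at the bottom is connected to the distinguished block with
number `j` of a half diagram at the top. -/
noncomputable def openTop (a : HalfDiagram k l) : Setoid (Fin k ⊕ Fin l) :=
  Setoid.ker (Sum.elim (Quotient.mk a.part) fun j => Quotient.mk a.part (a.rep j))

/-- The diagram in which the point `w j` at the top is connected to the distinguished block with
number `j` of a half diagram at the bottom. -/
noncomputable def openBottom (w : Perm (Fin l)) (b : HalfDiagram k l) : Setoid (Fin l ⊕ Fin k) :=
  Setoid.ker (Sum.elim (fun j => Quotient.mk b.part (b.rep (w.symm j))) (Quotient.mk b.part))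

theorem openTop_inl_inl (a : HalfDiagram k l) (x y : Fin k) :
    openTop a (Sum.inl x) (Sum.inl y) ↔ a.part x y := Quotient.eq (r := a.part)

theorem openTop_inl_inr (a : HalfDiagram k l) (x : Fin k) (j : Fin l) :
    openTop a (Sum.inl x) (Sum.inr j) ↔ a.part x (a.rep j) := Quotient.eq (r := a.part)

theorem openTop_inr_inr (a : HalfDiagram k l) (i j : Fin l) :
    openTop a (Sum.inr i) (Sum.inr j) ↔ i = j :=
  ⟨fun h => a.rep_inj (Quotient.exact (s := a.part) h), fun h => h ▸ Setoid.refl' _ _⟩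

theorem openBottom_inl_inr (w : Perm (Fin l)) (b : HalfDiagram k l) (j : Fin l) (x : Fin k) :
    openBottom w b (Sum.inl j) (Sum.inr x) ↔ b.part (b.rep (w.symm j)) x :=
  Quotient.eq (r := b.part)

theorem openBottom_inr_inr (w : Perm (Fin l)) (b : HalfDiagram k l) (x y : Fin k) :
    openBottom w b (Sum.inr x) (Sum.inr y) ↔ b.part x y := Quotient.eq (r := b.part)

theorem openBottom_inl_inl (w : Perm (Fin l)) (b : HalfDiagram k l) (i j : Fin l) :
    openBottom w b (Sum.inl i) (Sum.inl j) ↔ i = j :=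
  ⟨fun h => w.symm.injective (b.rep_inj (Quotient.exact (s := b.part) h)),
    fun h => h ▸ Setoid.refl' _ _⟩

theorem comp_openTop_openBottom (a : HalfDiagram k l) (w : Perm (Fin l)) (b : HalfDiagram k l) :
    comp (openTop a) (openBottom w b) = join a w b := by
  -- Each middle point is moved to the representative of the distinguished upper block to which it
  -- is attached.
  let ρ : Fin k ⊕ Fin l ⊕ Fin k → Fin k ⊕ Fin k :=
    Sum.elim Sum.inl (Sum.elim (Sum.inl ∘ a.rep) Sum.inr)
  have hmid : ∀ (i : Fin l) (x : Fin k), openBottom w b (Sum.inl i) (Sum.inr x) →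
      join a w b (Sum.inl (a.rep i)) (Sum.inr x) := by
    intro i x h
    rw [openBottom_inl_inr] at h
    exact ⟨w.symm i, by simp, b.part.symm' h⟩
  have hle : ∀ x y, stack (openTop a) (openBottom w b) x y → (join a w b).comap ρ x y := by
    intro x y h
    refine stack_le ?_ ?_ h
    · rintro (x | x) (y | y) h
      · exact (a.openTop_inl_inl x y).1 h
      · exact (a.openTop_inl_inr x y).1 h
      · exact a.part.symm' ((a.openTop_inl_inr y x).1 (Setoid.symm' _ h))
      · rw [openTop_inr_inr] at h
        exact h ▸ Setoid.refl' _ _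
    · rintro (x | x) (y | y) h
      · rw [openBottom_inl_inl] at h
        exact h ▸ Setoid.refl' _ _
      · exact hmid x y h
      · exact Setoid.symm' _ (hmid y x (Setoid.symm' _ h))
      · exact (openBottom_inr_inr w b x y).1 h
  have hcross : ∀ x y, join a w b (Sum.inl x) (Sum.inr y) →
      comp (openTop a) (openBottom w b) (Sum.inl x) (Sum.inr y) := by
    rintro x y ⟨j, h1, h2⟩
    have e1 := stack_left (e := openBottom w b) ((a.openTop_inl_inr x (w j)).2 h1)
    have e2 := stack_right (d := openTop a) ((openBottom_inl_inr w b (w j) y).2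
      (by simpa using b.part.symm' h2))
    exact Setoid.trans' (stack (openTop a) (openBottom w b)) e1 e2
  ext x y
  constructor
  · intro h
    have := hle _ _ h
    rcases x with x | x <;> rcases y with y | y <;> exact this
  · rcases x with x | x <;> rcases y with y | y
    · intro h
      exact comp_left ((a.openTop_inl_inl x y).2 h)
    · exact hcross x y
    · exact fun h => Setoid.symm' _ (hcross y x (Setoid.symm' _ h))
    · intro h
      exact comp_right ((openBottom_inr_inr w b x y).2 h)

theorem permDiagram_comp_openBottom (σ w : Perm (Fin l)) (b : HalfDiagram k l) :
    comp (permDiagram σ) (openBottom w b) = openBottom (σ * w) b := by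
  rw [permDiagram_comp]
  ext x y
  rcases x with x | x <;> rcases y with y | y <;> rfl

/-- Multiplication by a diagram either lowers the number of propagating blocks, or acts on the
upper half diagram and the permutation only. -/
theorem comp_join (d : Diagram k) (a : HalfDiagram k l) :
    (∃ (a' : HalfDiagram k l) (σ : Perm (Fin l)) (N : ℕ), ∀ w b,
      comp d (join a w b) = join a' (σ * w) b ∧ loops d (join a w b) = N) ∨
    (∀ w b, ∃ m < l, ∃ (a' : HalfDiagram k m) (w' : Perm (Fin m)) (b' : HalfDiagram k m),
      comp d (join a w b) = join a' w' b') := by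
  set E := comp d (openTop a) with hE
  have hcomp : ∀ w b, comp d (join a w b) = comp E (openBottom w b) := by
    intro w b
    rw [hE, comp_assoc, comp_openTop_openBottom]
  -- In the good case all l lower points of E are joined to the top, in different blocks. The
  -- condition involves neither w nor b.
  by_cases hgood : (∀ j, ∃ x, E (Sum.inl x) (Sum.inr j)) ∧
      ∀ i j, E (Sum.inr i) (Sum.inr j) → i = j
  · left
    obtain ⟨h1, h2⟩ := hgood
    choose f hf using h1
    obtain ⟨a', σ, ha', hσ⟩ := exists_of_transversal (E.comap Sum.inl) f (by
      intro i j h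
      exact h2 i j (E.trans' (E.symm' (hf i)) (E.trans' h (hf j))))
    have hpart : ∀ x y, a'.part x y ↔ E (Sum.inl x) (Sum.inl y) := fun x y => by rw [ha']; rfl
    have hlink : ∀ j, E (Sum.inl (a'.rep (σ j))) (Sum.inr j) := fun j =>
      E.trans' (E.symm' (hσ j)) (hf j)
    have hcross : ∀ x j, E (Sum.inl x) (Sum.inr j) ↔ openTop a' (Sum.inl x) (Sum.inr (σ j)) := by
      intro x j
      rw [openTop_inl_inr, hpart]
      exact ⟨fun h => E.trans' h (E.symm' (hlink j)), fun h => E.trans' h (hlink j)⟩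
    have hEa : E = comp (openTop a') (permDiagram σ) := by
      rw [comp_permDiagram]
      ext x y
      rcases x with x | x <;> rcases y with y | y
      · exact (hpart x y).symm.trans (a'.openTop_inl_inl x y).symm
      · exact hcross x y
      · exact ⟨fun h => Setoid.symm' _ ((hcross y x).1 (E.symm' h)),
          fun h => E.symm' ((hcross y x).2 (Setoid.symm' _ h))⟩
      · refine Iff.trans ?_ (a'.openTop_inr_inr (σ x) (σ y)).symm
        rw [σ.injective.eq_iff]
        exact ⟨h2 x y, fun h => h ▸ E.refl' _⟩
    refine ⟨a', σ, loops d (openTop a), fun w b => ⟨?_, ?_⟩⟩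
    · rw [hcomp, hEa, comp_assoc, permDiagram_comp_openBottom, comp_openTop_openBottom]
    -- When the product is factored through the l points, these are all joined to the top and create
    -- no loops. The loops come from d and `openTop a` alone, so their number is independent of w
    -- and b.
    · have := loops_assoc d (openTop a) (openBottom w b)
      rw [comp_openTop_openBottom, ← hE, loops_eq_zero (d := E) fun j => ⟨f j, hf j⟩,
        loops_eq_zero (d := openTop a) fun j => ⟨a.rep j, (a.openTop_inl_inr _ _).2
          (a.part.refl' _)⟩] at this
      omega
  · right
    intro w b
    obtain ⟨m, a', w', b', h⟩ := exists_join (comp d (join a w b))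
    refine ⟨m, ?_, a', w', b', h⟩
    by_contra hlt
    apply hgood
    rw [hcomp] at h
    have hex : ∀ i : Fin m, ∃ x j, E (Sum.inl x) (Sum.inr j) ∧
        a'.part (a'.rep (w' i)) x := by
      intro i
      have h1 := join_rep a' w' b' i
      rw [← h] at h1
      obtain ⟨x, j, hx, hj⟩ := exists_middle h1
      rw [h] at hj
      exact ⟨x, j, hx, hj⟩
    -- Every propagating block of the product passes through some lower point `j i` of E, and
    -- different ones use different blocks of E. If there are at least l of them, j is a bijection
    -- and the good case holds.
    choose x j hxj hx using hex
    have hinj : ∀ i i', E (Sum.inr (j i)) (Sum.inr (j i')) → i = i' := by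
      intro i i' hii
      have h1 : E (Sum.inl (x i)) (Sum.inl (x i')) :=
        E.trans' (hxj i) (E.trans' hii (E.symm' (hxj i')))
      have h2 := comp_left (e := openBottom w b) h1
      rw [h] at h2
      exact w'.injective (a'.rep_inj (a'.part.trans' (hx i)
        (a'.part.trans' h2 (a'.part.symm' (hx i')))))
    have hj : Function.Injective j := fun i i' hii => hinj i i' (hii ▸ E.refl' _)
    have hsurj : Function.Surjective j := by
      refine ((Fintype.bijective_iff_injective_and_card j).2 ⟨hj, ?_⟩).2
      refine le_antisymm (Fintype.card_le_of_injective j hj) ?_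
      simpa using hlt
    constructor
    · intro i
      obtain ⟨i, rfl⟩ := hsurj i
      exact ⟨_, hxj i⟩
    · intro i i' hii
      obtain ⟨i, rfl⟩ := hsurj i
      obtain ⟨i', rfl⟩ := hsurj i'
      rw [hinj i i' hii]

theorem flip_join (a : HalfDiagram k l) (w : Perm (Fin l)) (b : HalfDiagram k l) :
    flip (join a w b) = join b w⁻¹ a := by
  ext x y
  rcases x with x | x <;> rcases y with y | y
  · exact Iff.rfl
  · constructor
    · rintro ⟨j, h1, h2⟩
      exact ⟨w j, by simpa using h2, h1⟩
    · rintro ⟨j, h1, h2⟩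
      exact ⟨w⁻¹ j, by simpa using h2, h1⟩
  · constructor
    · rintro ⟨j, h1, h2⟩
      exact ⟨w j, by simpa using h2, h1⟩
    · rintro ⟨j, h1, h2⟩
      exact ⟨w⁻¹ j, by simpa using h2, h1⟩
  · exact Iff.rfl

instance : Finite (HalfDiagram k l) := by
  classical
  let F : HalfDiagram k l → Set (Fin k × Fin k) × Set (Fin k) :=
    fun a => ({p | a.part p.1 p.2}, {x | ∃ j, a.part x (a.rep j)})
  refine Finite.of_injective F fun a b h => ?_
  have h1 : ∀ x y, a.part x y ↔ b.part x y := fun x y =>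
    iff_of_eq (congrFun (congrArg Prod.fst h) (x, y))
  have h2 : ∀ x, (∃ j, a.part x (a.rep j)) ↔ ∃ j, b.part x (b.rep j) := fun x =>
    iff_of_eq (congrFun (congrArg Prod.snd h) x)
  exact ext_of_rep (Setoid.ext h1) h2

end HalfDiagram

/-! ## The cell datum of the partition algebra -/

section

variable {t : ℂ} {k : ℕ}

/-- The linear extension of `w ↦ join a w b` to functions on the symmetric group. -/
noncomputable def joinMap (t : ℂ) {k n : ℕ} (a b : HalfDiagram k n) :
    (Perm (Fin n) → ℂ) →ₗ[ℂ] PartitionAlgebra ℂ t k where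
  toFun F := ∑ w : Perm (Fin n), F w • PartitionAlgebra.single (HalfDiagram.join a w b) 1
  map_add' F G := by simp [add_smul, Finset.sum_add_distrib]
  map_smul' c F := by simp [Finset.smul_sum, smul_smul]

theorem joinMap_apply {n : ℕ} (a b : HalfDiagram k n) (F : Perm (Fin n) → ℂ) :
    joinMap t a b F = ∑ w : Perm (Fin n), F w • PartitionAlgebra.single (HalfDiagram.join a w b) 1 :=
  rfl

theorem joinLinear_eq {n : ℕ} (a b : HalfDiagram k n)
    (x : MonoidAlgebra ℂ (Perm (Fin n))) :
    (a.joinLinear x b : PartitionAlgebra ℂ t k) = joinMap t a b x.coeff := by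
  unfold HalfDiagram.joinLinear
  rw [Finsupp.sum_fintype, joinMap_apply]
  · refine Finset.sum_congr rfl fun w _ => ?_
    rw [PartitionAlgebra.smul_single, mul_one]
  · intro w
    exact Finsupp.single_zero _

/-- The products of d(s), a row stabilizing permutation and d(u)⁻¹ are exactly the permutations that
carry each row of u to the same row of s. -/
theorem coeff_murphy {l : YoungDiagram} (s u : Tableau l) :
    ⇑(murphy s u).coeff = tabSum (Filling.row s) (Filling.row u) := by
  classical
  have h : murphy s u = ∑ w ∈ rowStabilizer l,
      MonoidAlgebra.single (s.perm * w * u.perm⁻¹) (1 : ℂ) := by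
    simp only [murphy, Finset.mul_sum, Finset.sum_mul, MonoidAlgebra.of_apply,
      MonoidAlgebra.single_mul_single, mul_one]
  funext v
  have hp : ∀ (s : Tableau l) x, Filling.row s (s.perm x) = ((rowReading l).symm x).1.1 := by
    intro s x
    simp [Filling.row, Tableau.perm]
  have hmem : s.perm⁻¹ * v * u.perm ∈ rowStabilizer l ↔
      Filling.row s ∘ v = Filling.row u := by
    simp only [rowStabilizer, Finset.mem_filter, Finset.mem_univ, true_and]
    simp_rw [← hp s]
    constructor
    · intro h
      funext x
      have := h (u.perm⁻¹ x)
      rw [hp s (u.perm⁻¹ x), ← hp u] at this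
      simpa using this
    · intro h i
      rw [hp s i, ← hp u, ← h]
      simp
  rw [h, MonoidAlgebra.coeff_sum, Finsupp.finsetSum_apply]
  simp only [MonoidAlgebra.coeff_single, Finsupp.single_apply]
  have heq : ∀ w, s.perm * w * u.perm⁻¹ = v ↔ s.perm⁻¹ * v * u.perm = w := by
    intro w
    constructor
    · rintro rfl; group
    · rintro rfl; group
  simp_rw [heq]
  rw [Finset.sum_ite_eq]
  simp only [hmem, tabSum]

theorem partitionC_eq {l : YoungDiagram} (s : Tableau l) (a : HalfDiagram k l.card)
    (u : Tableau l) (b : HalfDiagram k l.card) :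
    partitionC t s a u b = joinMap t a b (tabSum (Filling.row s) (Filling.row u)) := by
  unfold partitionC
  rw [joinLinear_eq, coeff_murphy]

/-- The coefficient of a diagram. -/
noncomputable def diagramCoeff (t : ℂ) {k : ℕ} (d : Diagram k) : PartitionAlgebra ℂ t k →ₗ[ℂ] ℂ :=
  Finsupp.lapply (M := ℂ) (R := ℂ) d

theorem diagramCoeff_single (d e : Diagram k) (r : ℂ) [Decidable (e = d)] :
    diagramCoeff t d (PartitionAlgebra.single e r) = if e = d then r else 0 := by
  classical
  refine (Finsupp.single_apply (a := e) (a' := d) (b := r)).trans ?_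
  congr

/-- The coefficients of the diagrams `join a w b`. -/
noncomputable def joinCoeff (t : ℂ) {k n : ℕ} (a b : HalfDiagram k n) :
    PartitionAlgebra ℂ t k →ₗ[ℂ] (Perm (Fin n) → ℂ) :=
  LinearMap.pi fun w => diagramCoeff t (HalfDiagram.join a w b)

theorem joinCoeff_joinMap {n : ℕ} (a b : HalfDiagram k n) (F : Perm (Fin n) → ℂ) :
    joinCoeff t a b (joinMap t a b F) = F := by
  classical
  funext w
  simp only [joinCoeff, LinearMap.pi_apply, joinMap_apply, map_sum, map_smul,
    diagramCoeff_single, smul_eq_mul]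
  rw [Finset.sum_eq_single w]
  · simp
  · intro v _ hv
    rw [if_neg, mul_zero]
    exact fun h => hv (HalfDiagram.join_injective h).2.1
  · simp

theorem exists_join_eq_of_joinCoeff_ne_zero {n m : ℕ} {a b : HalfDiagram k n}
    {a' b' : HalfDiagram k m} {F : Perm (Fin m) → ℂ}
    (h : joinCoeff t a b (joinMap t a' b' F) ≠ 0) :
    ∃ w w', HalfDiagram.join a' w' b' = HalfDiagram.join a w b := by
  classical
  by_contra hcon
  push Not at hcon
  apply h
  funext w
  simp only [joinCoeff, LinearMap.pi_apply, joinMap_apply, map_sum, map_smul,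
    diagramCoeff_single, smul_eq_mul]
  refine Finset.sum_eq_zero fun w' _ => ?_
  rw [if_neg (hcon w w'), mul_zero]

/-- Indices for the cellular basis of the partition algebra, sorted by the number of propagating
blocks. -/
abbrev JoinIndex (k : ℕ) : Type :=
  Σ n : ℕ, (HalfDiagram k n × HalfDiagram k n) ×
    (Σ l : YoungDiagram, StdFilling l n × StdFilling l n)

/-- The elements of the cellular basis of the partition algebra. -/
noncomputable def joinMurphy (t : ℂ) (k : ℕ) (i : JoinIndex k) : PartitionAlgebra ℂ t k :=
  joinMap t i.2.1.1 i.2.1.2 (murphyFun i.1 i.2.2)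

/-- Reading off the coefficients at the diagrams with two given half diagrams kills the elements
built from other half diagrams, so triangularity in each symmetric group suffices. -/
theorem linearIndependent_joinMurphy (t : ℂ) (k : ℕ) :
    LinearIndependent ℂ (joinMurphy t k) := by
  have key : ∀ i j : JoinIndex k,
      (murphyDual i.1 i.2.2 ∘ₗ joinCoeff t i.2.1.1 i.2.1.2) (joinMurphy t k j) ≠ 0 →
      murphyOrder j.1 j.2.2 ≤ murphyOrder i.1 i.2.2 ∧
        (murphyOrder j.1 j.2.2 = murphyOrder i.1 i.2.2 → j = i) := by
    rintro ⟨n, ⟨a, b⟩, i⟩ ⟨m, ⟨a', b'⟩, j⟩ h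
    simp only [LinearMap.comp_apply, joinMurphy] at h
    obtain ⟨w, w', hw⟩ := exists_join_eq_of_joinCoeff_ne_zero (fun h0 => h (by rw [h0, map_zero]))
    obtain rfl := le_antisymm (HalfDiagram.le_of_join_eq hw) (HalfDiagram.le_of_join_eq hw.symm)
    obtain ⟨rfl, -, rfl⟩ := HalfDiagram.join_injective hw
    rw [joinCoeff_joinMap] at h
    exact ⟨murphyOrder_le h, fun h1 => by
      obtain rfl : j = i := murphyOrder_injective _ h1
      rfl⟩
  refine linearIndependent_of_triangular (joinMurphy t k)
    (fun i => murphyDual i.1 i.2.2 ∘ₗ joinCoeff t i.2.1.1 i.2.1.2)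
    (fun i => murphyOrder i.1 i.2.2) ?_ (fun i j h => (key i j h).1) (fun i j h => (key i j h).2)
  intro i
  simp only [LinearMap.comp_apply, joinMurphy, joinCoeff_joinMap]
  exact murphyDual_self _ _

theorem map_mem_span_of_mem_span {V W : Type*} [AddCommGroup V] [Module ℂ V] [AddCommGroup W]
    [Module ℂ W] (f : V →ₗ[ℂ] W) {S : Set V} {U : Submodule ℂ W} (h : ∀ x ∈ S, f x ∈ U) {x : V}
    (hx : x ∈ Submodule.span ℂ S) : f x ∈ U :=
  (Submodule.span_le (p := U.comap f)).2 h hx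

theorem joinMap_mem_span {n : ℕ} (a b : HalfDiagram k n) (F : Perm (Fin n) → ℂ) :
    joinMap t a b F ∈ Submodule.span ℂ (Set.range (joinMurphy t k)) := by
  refine map_mem_span_of_mem_span _ ?_ (mem_span_murphyFun F)
  rintro _ ⟨i, rfl⟩
  exact Submodule.subset_span ⟨⟨n, (a, b), i⟩, rfl⟩

theorem single_eq_joinMap {n : ℕ} (a b : HalfDiagram k n) (w : Perm (Fin n)) (r : ℂ) :
    (PartitionAlgebra.single (HalfDiagram.join a w b) r : PartitionAlgebra ℂ t k) =
      joinMap t a b (Pi.single w r) := by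
  rw [joinMap_apply, Finset.sum_eq_single w]
  · rw [Pi.single_eq_same, PartitionAlgebra.smul_single, mul_one]
  · intro v _ hv
    rw [Pi.single_eq_of_ne hv, zero_smul]
  · simp

theorem mem_span_joinMurphy (x : PartitionAlgebra ℂ t k) :
    x ∈ Submodule.span ℂ (Set.range (joinMurphy t k)) := by
  induction x using PartitionAlgebra.induction_on with
  | h0 => exact zero_mem _
  | hadd x y hx hy => exact add_mem hx hy
  | hs d r =>
    obtain ⟨n, a, w, b, rfl⟩ := HalfDiagram.exists_join d
    rw [single_eq_joinMap]
    exact joinMap_mem_span _ _ _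

noncomputable instance (k n : ℕ) : Fintype (HalfDiagram k n) := Fintype.ofFinite _

/-- The index sets of the cell datum of the partition algebra. -/
abbrev CellIndex {k : ℕ} (l : PartitionUpTo k) : Type :=
  StdFilling l.shape l.shape.card × HalfDiagram k l.shape.card

/-- The elements of the cellular basis of the partition algebra. -/
noncomputable def cellC (t : ℂ) {k : ℕ} (l : PartitionUpTo k) (x y : CellIndex l) :
    PartitionAlgebra ℂ t k :=
  partitionC t x.1.1 x.2 y.1.1 y.2

theorem cellC_eq (l : PartitionUpTo k) (x y : CellIndex l) :
    cellC t l x y = joinMap t x.2 y.2 (tabSum x.1.1.row y.1.1.row) := partitionC_eq _ _ _ _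

/-- The comparison of the index sets. -/
def toJoinIndex (k : ℕ) (i : Σ l : PartitionUpTo k, CellIndex l × CellIndex l) : JoinIndex k :=
  ⟨i.1.shape.card, (i.2.1.2, i.2.2.2), ⟨i.1.shape, i.2.1.1, i.2.2.1⟩⟩

theorem toJoinIndex_injective (k : ℕ) : Function.Injective (toJoinIndex k) := by
  rintro ⟨l, ⟨s, a⟩, ⟨u, b⟩⟩ ⟨m, ⟨s', a'⟩, ⟨u', b'⟩⟩ h
  obtain rfl : l = m := PartitionUpTo.ext (congrArg (fun i : JoinIndex k => i.2.2.1) h)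
  simp only [toJoinIndex, Sigma.mk.injEq, heq_eq_eq, Prod.mk.injEq, true_and] at h
  obtain ⟨⟨rfl, rfl⟩, rfl, rfl⟩ := h
  rfl

/-- A filling forces the size of the shape to be n, and a half diagram with n distinguished blocks
forces n ≤ k. -/
theorem toJoinIndex_surjective (k : ℕ) : Function.Surjective (toJoinIndex k) := by
  rintro ⟨n, ⟨a, b⟩, ⟨l, s, u⟩⟩
  obtain rfl : l.card = n := by simpa using Fintype.card_congr s.1
  exact ⟨⟨⟨l, a.le_of_halfDiagram⟩, ⟨s, a⟩, ⟨u, b⟩⟩, rfl⟩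

theorem cellC_eq_joinMurphy (i : Σ l : PartitionUpTo k, CellIndex l × CellIndex l) :
    cellC t i.1 i.2.1 i.2.2 = joinMurphy t k (toJoinIndex k i) := cellC_eq _ _ _

/-- The span of the basis elements that belong to larger partitions. -/
noncomputable def cellHigher (t : ℂ) {k : ℕ} (l : PartitionUpTo k) :
    Submodule ℂ (PartitionAlgebra ℂ t k) :=
  Submodule.span ℂ {x | ∃ m, l < m ∧ ∃ u v, x = cellC t m u v}

theorem joinMurphy_mem_cellHigher (l : PartitionUpTo k) (i : JoinIndex k)
    (h : i.1 < l.shape.card ∨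
      (i.1 = l.shape.card ∧ Dominated l.shape i.2.2.1 ∧ l.shape ≠ i.2.2.1)) :
    joinMurphy t k i ∈ cellHigher t l := by
  obtain ⟨⟨m, u, v⟩, rfl⟩ := toJoinIndex_surjective k i
  rw [← cellC_eq_joinMurphy]
  refine Submodule.subset_span ⟨m, ?_, u, v, rfl⟩
  refine lt_of_le_of_ne ?_ ?_
  · rcases h with h | h
    · exact Or.inl h
    · exact Or.inr ⟨h.1.symm, h.2.1⟩
  · rintro rfl
    rcases h with h | h
    · exact lt_irrefl _ h
    · exact h.2.2 rfl

theorem joinMap_mem_cellHigher (l : PartitionUpTo k) {n : ℕ} (hn : n < l.shape.card)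
    (a b : HalfDiagram k n) (F : Perm (Fin n) → ℂ) : joinMap t a b F ∈ cellHigher t l := by
  refine map_mem_span_of_mem_span _ ?_ (mem_span_murphyFun F)
  rintro _ ⟨i, rfl⟩
  exact joinMurphy_mem_cellHigher l ⟨n, (a, b), i⟩ (Or.inl hn)

theorem exists_cell_straightening (l : PartitionUpTo k) (s : Filling l.shape l.shape.card)
    (a : HalfDiagram k l.shape.card) :
    ∃ q : CellIndex l → ℂ, ∀ y : CellIndex l,
      joinMap t a y.2 (tabSum s.row y.1.1.row) - ∑ x, q x • cellC t l x y ∈ cellHigher t l := by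
  classical
  obtain ⟨q, hq⟩ := exists_straightening s
  refine ⟨fun x => if x.2 = a then q x.1 else 0, fun y => ?_⟩
  have h : joinMap t a y.2 (tabSum s.row y.1.1.row -
      ∑ c, q c • tabSum c.1.row y.1.1.row) ∈ cellHigher t l := by
    refine map_mem_span_of_mem_span _ ?_ (hq y.1.1)
    rintro _ ⟨i, hi, rfl⟩
    exact joinMurphy_mem_cellHigher l ⟨_, (a, y.2), i⟩ (Or.inr ⟨rfl, hi⟩)
  convert h using 1
  rw [map_sub, map_sum]
  congr 1
  rw [Fintype.sum_prod_type]
  refine Finset.sum_congr rfl fun c _ => ?_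
  rw [Finset.sum_eq_single a]
  · simp only [↓reduceIte, map_smul, cellC_eq]
  · intro b _ hb
    simp only [if_neg hb, zero_smul]
  · simp

theorem tabSum_comp {n : ℕ} (f g : Fin n → ℕ) (σ w : Perm (Fin n)) :
    tabSum (f ∘ ⇑σ⁻¹) g (σ * w) = tabSum f g w := by
  unfold tabSum
  congr 2
  funext x
  simp

/-- For a diagram, `HalfDiagram.comp_join` gives two cases. If propagating blocks are lost, the
product lies in `cellHigher`. Otherwise σ turns the upper tableau into a possibly nonstandard
filling, and straightening it yields coefficients that ignore the lower index y. -/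
theorem exists_mul_cellC (l : PartitionUpTo k) (z : PartitionAlgebra ℂ t k) (x : CellIndex l) :
    ∃ r : CellIndex l → ℂ, ∀ y : CellIndex l,
      z * cellC t l x y - ∑ u, r u • cellC t l u y ∈ cellHigher t l := by
  induction z using PartitionAlgebra.induction_on with
  | h0 => exact ⟨0, fun y => by simp⟩
  | hadd z z' h h' =>
    obtain ⟨r, hr⟩ := h
    obtain ⟨r', hr'⟩ := h'
    refine ⟨r + r', fun y => ?_⟩
    have := add_mem (hr y) (hr' y)
    convert this using 1
    simp only [add_mul, Pi.add_apply, add_smul, Finset.sum_add_distrib]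
    abel
  | hs d r =>
    have hmul : ∀ y : CellIndex l, PartitionAlgebra.single d r * cellC t l x y =
        ∑ w : Perm (Fin l.shape.card), tabSum x.1.1.row y.1.1.row w •
          PartitionAlgebra.single (comp d (HalfDiagram.join x.2 w y.2))
            (r * t ^ loops d (HalfDiagram.join x.2 w y.2)) := by
      intro y
      rw [cellC_eq, joinMap_apply, Finset.mul_sum]
      refine Finset.sum_congr rfl fun w _ => ?_
      rw [mul_smul_comm, PartitionAlgebra.single_mul_single, mul_one]
    rcases HalfDiagram.comp_join d x.2 with ⟨a', σ, N, h⟩ | h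
    · obtain ⟨q, hq⟩ := exists_cell_straightening (t := t) l (x.1.1.trans σ) a'
      refine ⟨fun u => (r * t ^ N) * q u, fun y => ?_⟩
      have h1 := Submodule.smul_mem _ (r * t ^ N) (hq y)
      convert h1 using 1
      rw [smul_sub, Finset.smul_sum]
      simp only [smul_smul]
      congr 1
      rw [hmul, joinMap_apply, Finset.smul_sum]
      refine Fintype.sum_equiv (Equiv.mulLeft σ) _ _ fun w => ?_
      rw [(h w y.2).1, (h w y.2).2]
      simp only [Equiv.coe_mulLeft]
      have hrow : Filling.row (x.1.1.trans σ) = x.1.1.row ∘ ⇑σ⁻¹ := rfl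
      rw [hrow, tabSum_comp, smul_comm]
      simp only [PartitionAlgebra.smul_single, mul_one]
    · refine ⟨0, fun y => ?_⟩
      simp only [Pi.zero_apply, zero_smul, Finset.sum_const_zero, sub_zero]
      rw [hmul]
      refine sum_mem fun w _ => Submodule.smul_mem _ _ ?_
      obtain ⟨m, hm, a', w', b', heq⟩ := h w y.2
      rw [heq, single_eq_joinMap]
      exact joinMap_mem_cellHigher l hm _ _ _

/-- The anti-automorphism of the partition algebra that reflects diagrams. -/
noncomputable def flipMap (t : ℂ) (k : ℕ) : PartitionAlgebra ℂ t k ≃ₗ[ℂ] PartitionAlgebra ℂ t k :=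
  Finsupp.domLCongr (M := ℂ) (R := ℂ) ⟨fun d : Diagram k => flip d, fun d : Diagram k => flip d,
    flip_flip, flip_flip⟩

theorem flipMap_single (d : Diagram k) (r : ℂ) :
    flipMap t k (PartitionAlgebra.single d r) = PartitionAlgebra.single (flip d) r :=
  Finsupp.domLCongr_single _ _ _

theorem flipMap_mul (x y : PartitionAlgebra ℂ t k) :
    flipMap t k (x * y) = flipMap t k y * flipMap t k x := by
  induction x using PartitionAlgebra.induction_on with
  | h0 => simp
  | hadd x x' h h' => rw [add_mul, map_add, map_add, mul_add, h, h']
  | hs d r =>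
  induction y using PartitionAlgebra.induction_on with
  | h0 => simp
  | hadd y y' h h' => rw [mul_add, map_add, map_add, add_mul, h, h']
  | hs e s =>
    rw [PartitionAlgebra.single_mul_single, flipMap_single, flipMap_single, flipMap_single,
      PartitionAlgebra.single_mul_single, comp_flip, loops_flip, mul_comm r s]

theorem flipMap_joinMap {n : ℕ} (a b : HalfDiagram k n) (F : Perm (Fin n) → ℂ) :
    flipMap t k (joinMap t a b F) = joinMap t b a (compInv n F) := by
  rw [joinMap_apply, joinMap_apply, map_sum]
  refine Fintype.sum_equiv (Equiv.inv _) _ _ fun w => ?_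
  rw [map_smul, flipMap_single, HalfDiagram.flip_join]
  simp [compInv, LinearMap.funLeft_apply]

theorem flipMap_cellC (l : PartitionUpTo k) (x y : CellIndex l) :
    flipMap t k (cellC t l x y) = cellC t l y x := by
  rw [cellC_eq, cellC_eq, flipMap_joinMap, compInv_tabSum]

theorem flip_apply {α β : Type} (d : Setoid (α ⊕ β)) (x y : β ⊕ α) :
    flip d x y ↔ d x.swap y.swap := Iff.rfl

theorem flip_permDiagram (σ : Perm (Fin k)) : flip (permDiagram σ) = permDiagram σ⁻¹ := by
  ext x y
  rcases x with x | x <;> rcases y with y | y <;>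
    simp [flip_apply, permDiagram_apply, Equiv.symm_apply_eq, Equiv.eq_symm_apply]

theorem flipMap_symmetrizer (t : ℂ) (k : ℕ) : flipMap t k (symmetrizer t k) = symmetrizer t k := by
  unfold symmetrizer
  rw [map_smul, map_sum]
  congr 1
  refine Fintype.sum_equiv (Equiv.inv _) _ _ fun σ => ?_
  change flipMap t k (PartitionAlgebra.single (permDiagram σ) 1) =
    PartitionAlgebra.single (permDiagram σ⁻¹) 1
  rw [flipMap_single, flip_permDiagram]

/-- The cell datum of the partition algebra. -/
noncomputable def partitionCellDatum (t : ℂ) (k : ℕ) :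
    CellDatum ℂ (PartitionAlgebra ℂ t k) (PartitionUpTo k) where
  T l := CellIndex l
  C l x y := cellC t l x y
  basis := Module.Basis.mk (v := fun i : Σ l : PartitionUpTo k, CellIndex l × CellIndex l =>
      cellC t i.1 i.2.1 i.2.2)
    (by
      have h := (linearIndependent_joinMurphy t k).comp _ (toJoinIndex_injective k)
      rwa [show joinMurphy t k ∘ toJoinIndex k = _ from
        funext fun i => (cellC_eq_joinMurphy i).symm] at h)
    (by
      intro x _
      refine Submodule.span_mono ?_ (mem_span_joinMurphy x)
      rintro _ ⟨i, rfl⟩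
      obtain ⟨i, rfl⟩ := toJoinIndex_surjective k i
      exact ⟨i, cellC_eq_joinMurphy i⟩)
  basis_apply l x y := by simp
  star := flipMap t k
  star_C := flipMap_cellC
  star_mul := flipMap_mul
  r l z x := (exists_mul_cellC l z x).choose
  mul_C l z x y := (exists_mul_cellC l z x).choose_spec y

end

/-! ### Finiteness of the poset and identification with the modules `Delta` -/

theorem cells_subset_range_product (l : YoungDiagram) :
    l.cells ⊆ Finset.range l.card ×ˢ Finset.range l.card := by
  rintro ⟨i, j⟩ h
  rw [Finset.mem_product, Finset.mem_range, Finset.mem_range]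
  constructor
  · refine lt_of_lt_of_le (YoungDiagram.mem_iff_lt_colLen.1 h) ?_
    rw [YoungDiagram.colLen_eq_card]
    exact Finset.card_le_card (Finset.filter_subset _ _)
  · refine lt_of_lt_of_le (YoungDiagram.mem_iff_lt_rowLen.1 h) ?_
    rw [YoungDiagram.rowLen_eq_card]
    exact Finset.card_le_card (Finset.filter_subset _ _)

/-- Finiteness provides the well-foundedness behind the descending induction in `CellDatum.corner`.
-/
instance (k : ℕ) : Finite (PartitionUpTo k) := by
  refine Finite.of_injective (β := {c // c ∈ (Finset.range k ×ˢ Finset.range k).powerset})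
    (fun l => ⟨l.shape.cells, Finset.mem_powerset.2 ?_⟩) ?_
  · refine (cells_subset_range_product _).trans ?_
    have h : Finset.range l.shape.card ⊆ Finset.range k := Finset.range_subset_range.2 l.card_le
    exact Finset.product_subset_product h h
  · intro l m h
    exact PartitionUpTo.ext (YoungDiagram.ext (congrArg Subtype.val h))

theorem rowReading_lt_iff {l : YoungDiagram} (c c' : {c // c ∈ l.cells}) :
    rowReading l c < rowReading l c' ↔ toLex c.1 < toLex c'.1 := by
  unfold rowReading
  simp only [Equiv.trans_apply]
  exact ((lexCells l).orderIsoOfFin (card_lexCells l)).symm.lt_iff_lt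

theorem rowReading_isStandard (l : YoungDiagram) : (rowReading l).IsStandard := by
  constructor
  · intro c c' h h'
    rw [rowReading_lt_iff, Prod.Lex.toLex_lt_toLex]
    exact Or.inr ⟨h, h'⟩
  · intro c c' _ h'
    rw [rowReading_lt_iff, Prod.Lex.toLex_lt_toLex]
    exact Or.inl h'

/-- The linear span of the larger basis elements is already closed under left multiplication, so the
left ideal generated by them is no bigger. -/
theorem mem_cellIdeal_iff (t : ℂ) {k : ℕ} (l : PartitionUpTo k) (x : PartitionAlgebra ℂ t k) :
    x ∈ cellIdeal t l ↔ x ∈ (partitionCellDatum t k).higher l := by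
  constructor
  · intro hx
    induction hx using Submodule.span_induction with
    | mem x hx =>
      obtain ⟨m, hm, s, a, u, b, hs, hu, rfl⟩ := hx
      exact Submodule.subset_span ⟨m, hm, (⟨s, hs⟩, a), (⟨u, hu⟩, b), rfl⟩
    | zero => exact zero_mem _
    | add x y _ _ hx hy => exact add_mem hx hy
    | smul a x _ hx => exact (partitionCellDatum t k).mul_higher l a x hx
  · intro hx
    induction hx using Submodule.span_induction with
    | mem x hx =>
      obtain ⟨m, hm, ⟨s, a⟩, ⟨u, b⟩, rfl⟩ := hx
      exact Submodule.subset_span ⟨m, hm, s.1, a, u.1, b, s.2, u.2, rfl⟩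
    | zero => exact zero_mem _
    | add x y _ _ hx hy => exact add_mem hx hy
    | smul c x _ hx =>
      rw [Algebra.smul_def]
      exact Submodule.smul_mem _ _ hx

/-- The modules `Δ` are the cell modules of the partition algebra. -/
theorem nonempty_cellModule_equiv_Delta (t : ℂ) {k : ℕ} (l : PartitionUpTo k) :
    Nonempty ((partitionCellDatum t k).CellModule l ≃ₗ[PartitionAlgebra ℂ t k] Delta t l) := by
  let y : CellIndex l := (⟨rowReading l.shape, rowReading_isStandard _⟩,
    HalfDiagram.initial l.card_le)
  obtain ⟨φ⟩ := (partitionCellDatum t k).nonempty_cellModule_equiv l y (cellIdeal t l)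
    (mem_cellIdeal_iff t l)
  refine ⟨φ.trans (LinearEquiv.ofEq _ _ ?_)⟩
  unfold Delta
  congr 1
  ext x
  constructor
  · rintro ⟨⟨s, a⟩, rfl⟩
    exact ⟨s.1, a, s.2, rfl⟩
  · rintro ⟨s, a, hs, rfl⟩
    exact ⟨(⟨s, hs⟩, a), rfl⟩

end SphericalPartition

theorem theorem7p3 (k : ℕ) (t : ℂ) :
    ∃ D : SphericalPartition.CellDatum ℂ (SphericalPartition.SphericalPartitionAlgebra t k)
        (SphericalPartition.PartitionUpTo k),
      ∀ l : SphericalPartition.PartitionUpTo k,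
        Nonempty (D.CellModule l ≃ₗ[SphericalPartition.SphericalPartitionAlgebra t k]
          SphericalPartition.Truncation (SphericalPartition.symmetrizer_idem t k)
            (SphericalPartition.Delta t l)) := by
  have hs := SphericalPartition.flipMap_symmetrizer t k
  refine ⟨(SphericalPartition.partitionCellDatum t k).corner
    (SphericalPartition.symmetrizer_idem t k) hs, fun l => ?_⟩
  obtain ⟨φ⟩ := (SphericalPartition.partitionCellDatum t k).nonempty_cellModule_corner
    (SphericalPartition.symmetrizer_idem t k) hs l
  obtain ⟨ψ⟩ := SphericalPartition.nonempty_cellModule_equiv_Delta t l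
  obtain ⟨χ⟩ := SphericalPartition.Truncation.nonempty_congr
    (SphericalPartition.symmetrizer_idem t k) ψ
  exact ⟨φ.trans χ⟩
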